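/- **Setting.** Let $(\Omega,\mathcal F,\mathbb P)$ be a complete probability space with a filtration $(\mathcal F_t)_{t\ge 0}$ satisfying the usual conditions, let $H,G,E$ be real separable Hilbert spaces, $U$ a topological space, and $\mathcal R\subseteq\mathcal B(U)$ a ring of sets generating $\mathcal B(U)$. For a continuous Hilbertian seminorm $q$ on $H$ (with associated bilinear form $q(\cdot,\cdot)$), $H_q$ is the completion of $(H/\ker q,q)$ and $i_q:H\to H_q$ the canonical map; $\mathcal L_2$ denotes Hilbert–Schmidt operators. Let $M=(M(t,A):t\ge 0,A\in\mathcal R)$ be a cylindrical martingale-valued measure in $H$: each $M(t,A)$ is a linear map $H\to L^0(\Omega,\mathcal F,\mathbb P)$, continuous for convergence in probability, and, writing $M((s,t],A)=M(t,A)-M(s,A)$, 1. $M(0,A)(h)=0$ a.s. for all $A\in\mathcal R$, $h\in H$; 2. $M(t,\emptyset)(h)=0$ and $M(t,A\cup B)(h)=M(t,A)(h)+M(t,B)(h)$ a.s. for disjoint $A,B\in\mathcal R$; 3. $(M(t,A)(h))_{t\ge0}$ is a mean-zero square integrable martingale for all $A\in\mathcal R$, $h\in H$; 4. $\mathbb E\big(M(t,A)(h_1)M(s,B)(h_2)\big)=0$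 for disjoint $A,B\in\mathcal R$ and all $s,t\ge 0$, $h_1,h_2\in H$; 5. for $0\le s<t$, $A,B\in\mathcal R$ and $h_1,h_2\in H$, the pair $\big(M((s,t],A)(h_1),M((s,t],B)(h_2)\big)$ is independent of $\mathcal F_s$; 6. $\mathbb E|M((s,t],A)(h)|^2=\int_{(s,t]}\int_A q_{r,u}(h)^2\,\mu(du)\,\lambda(dr)$ for $0\le s<t$, $A\in\mathcal R$, $h\in H$. Here $\mu$ is a measure on $\mathcal B(U)$, finite on $\mathcal R$ and such that countably many sets of $\mathcal R$ cover $U$ up to a $\mu$-null set; $\lambda$ is a Borel measure on $[0,\infty)$, finite on bounded intervals; and the $q_{r,u}$ are continuous Hilbertian seminorms on $H$ such that for all $h_1,h_2$ the map $(r,u)\mapsto q_{r,u}(h_1,h_2)$ is Borel measurable and bounded on $[0,T']\times U$ for every $T'>0$. Fix $T>0$. $\Lambda^2(M,T;H,G)$ is the set of families $\Phi(r,\omega,u)\in\mathcal L_2(H_{q_{r,u}},G)$, $(r,\omega,u)\in[0,T]\times\Omega\times U$, such that $(r,\omega,u)\mapsto q_{r,u}(\Phi(r,\omega,u)^*g,i_{q_{r,u}}h)$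 is $\mathcal P_T\otimes\mathcal B(U)$-measurable for all $g\in G$, $h\in H$ ($\mathcal P_T$ the predictable $\sigma$-algebra on $[0,T]\times\Omega$) and $\|\Phi\|_{\Lambda^2}^2=\mathbb E\int_{(0,T]}\int_U\|\Phi(r,u)\|_{\mathcal L_2(H_{q_{r,u}},G)}^2\,\mu(du)\,\lambda(dr)<\infty$. For a simple integrand $\Phi=\sum_{i,j}\mathbf 1_{(s_i,t_i]}(r)\mathbf 1_{F_i}(\omega)\mathbf 1_{A_j}(u)\,S_{i,j}\circ i_{q_{r,u}}^*$ (finite sum, $0\le s_i<t_i\le T$, $F_i\in\mathcal F_{s_i}$, $A_j\in\mathcal R$, $S_{i,j}\in\mathcal L_2(H,G)$) the integral is $I_t(\Phi)=\sum_{i,j}\mathbf 1_{F_i}Y^{i,j}_t$, where $Y^{i,j}$ is the $G$-valued càdlàg square integrable martingale on $[0,T]$ with $\langle Y^{i,j}_t,g\rangle=M((s_i\wedge t,t_i\wedge t],A_j)(S_{i,j}^*g)$ a.s. for all $t\in[0,T]$, $g\in G$. For $\Phi\in\Lambda^2(M,T;H,G)$, the stochastic integral $\big(\int_0^t\int_U\Phi\,dM\big)_{t\in[0,T]}$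 is the $G$-valued càdlàg square integrable martingale which is the limit, in the norm $(\mathbb E\sup_{t\le T}\|X_t\|^2)^{1/2}$, of the integrals of simple integrands converging to $\Phi$ in $\|\cdot\|_{\Lambda^2}$. **Proposition.** Let $R:G\to E$ be a continuous linear operator and $\Phi\in\Lambda^2(M,T;H,G)$. Then $R\circ\Phi=(R\circ\Phi(r,\omega,u))\in\Lambda^2(M,T;H,E)$. Moreover, the stochastic integrals of $\Phi$ and of $R\circ\Phi$ exist, and $\mathbb P$-a.s., for every $t\in[0,T]$, $$\int_0^t\int_U R\circ\Phi(r,u)\,M(dr,du)=R\left(\int_0^t\int_U\Phi(r,u)\,M(dr,du)\right)$$ (for any versions of the two integrals). -/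

import Mathlib

open MeasureTheory ProbabilityTheory Filter Topology
open scoped NNReal ENNReal InnerProductSpace

noncomputable section

namespace CylMart

/-! ### Hilbertian seminorms and the Hilbert spaces they determine -/

/-- A continuous Hilbertian seminorm on `H`, given by the continuous, symmetric, positive
semidefinite bilinear form `form` associated to it: `q(h)² = form h h`. -/
structure HilbertianSeminorm (H : Type*) [NormedAddCommGroup H] [InnerProductSpace ℝ H] where
  form : H →L[ℝ] H →L[ℝ] ℝ
  symm : ∀ x y, form x y = form y x
  nonneg : ∀ x, 0 ≤ form x x

namespace HilbertianSeminorm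

variable {H : Type*} [NormedAddCommGroup H] [InnerProductSpace ℝ H]

/-- A copy of `H`, to be equipped with the semi-inner product of `q`. -/
def Pre (_q : HilbertianSeminorm H) : Type _ := H

instance (q : HilbertianSeminorm H) : AddCommGroup q.Pre := inferInstanceAs (AddCommGroup H)

instance (q : HilbertianSeminorm H) : Module ℝ q.Pre := inferInstanceAs (Module ℝ H)

/-- The semi-inner product of `q`. -/
@[reducible]
def core (q : HilbertianSeminorm H) : PreInnerProductSpace.Core ℝ q.Pre where
  inner x y := q.form x y
  conj_inner_symm x y := q.symm y x
  re_inner_nonneg x := q.nonneg x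
  add_left x y z := DFunLike.congr_fun (q.form.map_add (x : H) (y : H)) (z : H)
  smul_left x y r := DFunLike.congr_fun (q.form.map_smul r (x : H)) (y : H)

instance (q : HilbertianSeminorm H) : SeminormedAddCommGroup q.Pre :=
  @InnerProductSpace.Core.toSeminormedAddCommGroup ℝ q.Pre _ _ _ q.core

instance (q : HilbertianSeminorm H) : InnerProductSpace ℝ q.Pre :=
  InnerProductSpace.ofCore q.core

/-- The Hilbert space `H_q`: the (Hausdorff) completion of `H` for the seminorm `q`, that is,
the completion of the pre-Hilbert space `H / ker q`. -/
abbrev Space (q : HilbertianSeminorm H) : Type _ := UniformSpace.Completion q.Pre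

/-- The identity of `H`, as a continuous map from `H` to `H` with the seminorm `q`. -/
def toPre (q : HilbertianSeminorm H) : H →L[ℝ] q.Pre where
  toFun x := x
  map_add' _ _ := rfl
  map_smul' _ _ := rfl
  cont := by
    have key : ∀ x y : H, dist (α := q.Pre) x y = √(q.form (x - y) (x - y)) :=
      fun x y => (dist_eq_norm (E := q.Pre) x y).trans rfl
    refine continuous_iff_continuousAt.2 fun x => ?_
    refine tendsto_iff_dist_tendsto_zero.2 ?_
    have h : Continuous fun y : H => √(q.form (y - x) (y - x)) := by fun_prop
    have h0 := h.tendsto x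
    simp only [sub_self, map_zero, Real.sqrt_zero] at h0
    exact h0.congr fun y => (key y x).symm

/-- The canonical map `i_q : H → H_q`. -/
def incl (q : HilbertianSeminorm H) : H →L[ℝ] q.Space :=
  (UniformSpace.Completion.toComplL (𝕜 := ℝ) (E := q.Pre)).comp q.toPre

end HilbertianSeminorm

/-! ### Hilbert–Schmidt operators -/

section HilbertSchmidt

variable {K G : Type*} [NormedAddCommGroup K] [InnerProductSpace ℝ K] [CompleteSpace K]
  [NormedAddCommGroup G] [InnerProductSpace ℝ G]

/-- The squared Hilbert–Schmidt norm `∑ ‖S e‖²`, the sum being over the vectors of a complete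
orthonormal system of `K` (the value does not depend on the system). -/
def hsNormSq (S : K →L[ℝ] G) : ℝ≥0∞ :=
  ∑' e : (exists_hilbertBasis ℝ K).choose, ‖S (e : K)‖ₑ ^ 2

/-- Hilbert–Schmidt operators. -/
def IsHilbertSchmidt (S : K →L[ℝ] G) : Prop := hsNormSq S < ∞

end HilbertSchmidt

/-! ### Square integrable càdlàg martingales on `[0, T]` -/

section Processes

variable {Ω : Type*} [mΩ : MeasurableSpace Ω]

/-- The usual conditions: the filtration is right continuous and `ℱ 0` contains every subset of
every set of measure zero (in particular the probability space is complete). -/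
structure UsualConditions (P : Measure Ω) (ℱ : Filtration ℝ≥0 mΩ) : Prop where
  rightContinuous : ℱ.IsRightContinuous
  null : ∀ s : Set Ω, P s = 0 → MeasurableSet[ℱ 0] s

/-- `f` is càdlàg on `[0, T]`. -/
def IsCadlagOn {G : Type*} [TopologicalSpace G] (T : ℝ≥0) (f : ℝ≥0 → G) : Prop :=
  ∀ t ≤ T, ContinuousWithinAt f (Set.Icc t T) t ∧ ∃ l, Tendsto f (𝓝[<] t) (𝓝 l)

variable {G : Type*} [NormedAddCommGroup G] [InnerProductSpace ℝ G] [CompleteSpace G]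

/-- `X` restricted to `[0, T]` is a `G`-valued càdlàg square integrable martingale. -/
structure IsSqMartingale (P : Measure Ω) (ℱ : Filtration ℝ≥0 mΩ) (T : ℝ≥0)
    (X : ℝ≥0 → Ω → G) : Prop where
  adapted : ∀ t ≤ T, StronglyMeasurable[ℱ t] (X t)
  memLp : ∀ t ≤ T, MemLp (X t) 2 P
  condExp : ∀ s t, s ≤ t → t ≤ T → P[X t|ℱ s] =ᵐ[P] X s
  cadlag : ∀ᵐ ω ∂P, IsCadlagOn T fun t => X t ω

/-- `𝔼 sup_{t ≤ T} ‖X_t‖²`, the square of the norm on the space of càdlàg square integrable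
martingales on `[0, T]`. -/
def martNormSq (P : Measure Ω) (T : ℝ≥0) (X : ℝ≥0 → Ω → G) : ℝ≥0∞ :=
  ∫⁻ ω, ⨆ t : Set.Iic T, ‖X t ω‖ₑ ^ 2 ∂P

/-- The trace of the predictable `σ`-algebra on `[0, T] × Ω`. -/
@[reducible]
def predictableOn (ℱ : Filtration ℝ≥0 mΩ) (T : ℝ≥0) : MeasurableSpace (Set.Iic T × Ω) :=
  ℱ.predictable.comap fun p => ((p.1 : ℝ≥0), p.2)

end Processes

/-! ### Cylindrical martingale-valued measures -/

/-- Cylindrical martingale-valued measures `M = (M(t, A) : t ≥ 0, A ∈ ring)` in `H`, together with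
their covariance structure `(μ, lam, q)`. Each `M(t, A)` is a cylindrical random variable, i.e. a
linear map from `H` into the space of classes of real random variables; the values `val t A` for
`A` outside the ring are irrelevant. -/
structure CylMartingaleMeasure {Ω : Type*} [mΩ : MeasurableSpace Ω] (P : Measure Ω)
    (ℱ : Filtration ℝ≥0 mΩ) (U : Type*) [TopologicalSpace U] [mU : MeasurableSpace U]
    [BorelSpace U] (H : Type*) [NormedAddCommGroup H] [InnerProductSpace ℝ H] where
  ring : Set (Set U)
  isSetRing : IsSetRing ring
  generate : mU = MeasurableSpace.generateFrom ring
  val : ℝ≥0 → Set U → H →ₗ[ℝ] (Ω →ₘ[P] ℝ)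
  val_zero : ∀ A ∈ ring, ∀ h, val 0 A h = 0
  val_empty : ∀ t h, val t ∅ h = 0
  val_union : ∀ t, ∀ A ∈ ring, ∀ B ∈ ring, Disjoint A B → ∀ h,
    val t (A ∪ B) h = val t A h + val t B h
  martingale : ∀ A ∈ ring, ∀ h, Martingale (fun t ω => val t A h ω) ℱ P
  memLp : ∀ t, ∀ A ∈ ring, ∀ h, MemLp (val t A h) 2 P
  mean_zero : ∀ t, ∀ A ∈ ring, ∀ h, ∫ ω, val t A h ω ∂P = 0
  /-- Continuity of `M(t, A) : H → L⁰`, for the topology of convergence in probability. -/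
  continuous : ∀ t, ∀ A ∈ ring, ∀ h,
    TendstoInMeasure P (fun h' : H => (val t A h' : Ω → ℝ)) (𝓝 h) (val t A h)
  orthogonal : ∀ s t, ∀ A ∈ ring, ∀ B ∈ ring, Disjoint A B → ∀ h₁ h₂,
    ∫ ω, val t A h₁ ω * val s B h₂ ω ∂P = 0
  /-- Increments over `(s, t]` are independent of `ℱ s`, any two of them jointly. -/
  indep : ∀ s t, s < t → ∀ A ∈ ring, ∀ B ∈ ring, ∀ h₁ h₂,
    Indep (MeasurableSpace.comap
      (fun ω => (val t A h₁ ω - val s A h₁ ω, val t B h₂ ω - val s B h₂ ω))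
      (inferInstance : MeasurableSpace (ℝ × ℝ))) (ℱ s) P
  μ : Measure U
  μ_lt_top : ∀ A ∈ ring, μ A < ∞
  /-- `μ` is `σ`-finite along the ring. -/
  μ_sigmaFinite : ∃ A : ℕ → Set U, (∀ n, A n ∈ ring) ∧ μ (⋃ n, A n)ᶜ = 0
  lam : Measure ℝ≥0
  lam_lt_top : ∀ t, lam (Set.Iic t) < ∞
  q : ℝ≥0 → U → HilbertianSeminorm H
  q_measurable : ∀ h₁ h₂, Measurable fun p : ℝ≥0 × U => (q p.1 p.2).form h₁ h₂
  q_bounded : ∀ (t : ℝ≥0) (h₁ h₂ : H), ∃ C : ℝ, ∀ r ≤ t, ∀ u, |(q r u).form h₁ h₂| ≤ C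
  covariance : ∀ s t, s < t → ∀ A ∈ ring, ∀ h,
    ∫⁻ ω, ‖val t A h ω - val s A h ω‖ₑ ^ 2 ∂P =
      ∫⁻ r in Set.Ioc s t, ∫⁻ u in A, ENNReal.ofReal ((q r u).form h h) ∂μ ∂lam

namespace CylMartingaleMeasure

variable {Ω : Type*} [mΩ : MeasurableSpace Ω] {P : Measure Ω} {ℱ : Filtration ℝ≥0 mΩ}
  {U : Type*} [TopologicalSpace U] [mU : MeasurableSpace U] [BorelSpace U]
  {H : Type*} [NormedAddCommGroup H] [InnerProductSpace ℝ H]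
  (M : CylMartingaleMeasure P ℱ U H) (T : ℝ≥0)
  {G : Type*} [NormedAddCommGroup G] [InnerProductSpace ℝ G]

variable (G) in
/-- Families `Φ(r, ω, u) : H_{q_{r,u}} → G` of operators. For integrands on `[0, T]` only the
values for `r ≤ T` matter. -/
abbrev OperatorFamily : Type _ := (r : ℝ≥0) → Ω → (u : U) → (M.q r u).Space →L[ℝ] G

variable {M}

/-- `𝔼 ∫_{(0,T]} ∫_U ‖Φ(r, u)‖² μ(du) lam(dr)`, with Hilbert–Schmidt norms. -/
def lambdaNormSq (Φ : M.OperatorFamily G) : ℝ≥0∞ :=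
  ∫⁻ ω, ∫⁻ r in Set.Ioc 0 T, ∫⁻ u, hsNormSq (Φ r ω u) ∂M.μ ∂M.lam ∂P

/-- Membership in the space `Λ²(M, T; H, G)` of integrands. -/
structure MemLambda2 [CompleteSpace G] (Φ : M.OperatorFamily G) : Prop where
  hilbertSchmidt : ∀ r ≤ T, ∀ ω u, IsHilbertSchmidt (Φ r ω u)
  predictable : ∀ (h : H) (g : G),
    Measurable[(predictableOn ℱ T).prod mU]
      (fun p : (Set.Iic T × Ω) × U =>
        ⟪ContinuousLinearMap.adjoint (Φ p.1.1 p.1.2 p.2) g, (M.q p.1.1 p.2).incl h⟫_ℝ)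
  norm_lt_top : lambdaNormSq T Φ < ∞

variable (M G)

/-- The data of a simple integrand
`∑ i, ∑ j, 1_{(s i, t i]}(r) 1_{F i}(ω) 1_{A j}(u) S i j ∘ i_{q_{r,u}}^*`. -/
structure SimpleIntegrand [CompleteSpace H] where
  n : ℕ
  m : ℕ
  s : Fin n → ℝ≥0
  t : Fin n → ℝ≥0
  F : Fin n → Set Ω
  A : Fin m → Set U
  S : Fin n → Fin m → H →L[ℝ] G
  s_lt_t : ∀ i, s i < t i
  t_le : ∀ i, t i ≤ T
  measurable_F : ∀ i, MeasurableSet[ℱ (s i)] (F i)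
  A_mem : ∀ j, A j ∈ M.ring
  hilbertSchmidt : ∀ i j, IsHilbertSchmidt (S i j)

variable {M G T}
variable [CompleteSpace H] [CompleteSpace G]

/-- The family of operators given by the data of a simple integrand. -/
def SimpleIntegrand.toFamily (D : SimpleIntegrand M T G) : M.OperatorFamily G := fun r ω u =>
  ∑ i, ∑ j,
    ((Set.Ioc (D.s i) (D.t i)).indicator (fun _ => (1 : ℝ)) r *
      (D.F i).indicator (fun _ => (1 : ℝ)) ω * (D.A j).indicator (fun _ => (1 : ℝ)) u) •
    (D.S i j).comp (ContinuousLinearMap.adjoint (M.q r u).incl)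

variable (M T)

/-- `Y` is (a version of) the radonification by the Hilbert–Schmidt operator `S` of the cylindrical
martingale `r ↦ M((s ∧ r, t ∧ r], A)`: a `G`-valued càdlàg square integrable martingale on `[0, T]`
with `⟪Y_r, g⟫ = M((s ∧ r, t ∧ r], A)(S^* g)` a.s. -/
structure IsRadonification (s t : ℝ≥0) (A : Set U) (S : H →L[ℝ] G) (Y : ℝ≥0 → Ω → G) :
    Prop where
  martingale : IsSqMartingale P ℱ T Y
  inner_eq : ∀ r ≤ T, ∀ g : G, ∀ᵐ ω ∂P,
    ⟪Y r ω, g⟫_ℝ = M.val (min t r) A (ContinuousLinearMap.adjoint S g) ω -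
      M.val (min s r) A (ContinuousLinearMap.adjoint S g) ω

variable {M T}

/-- `X` is (a version of) the stochastic integral of a simple integrand:
`X_t = ∑ i, ∑ j, 1_{F i} Y_t(s i, t i, A j, S i j)`, with `Y` the radonifications above. -/
def IsSimpleIntegral (D : SimpleIntegrand M T G) (X : ℝ≥0 → Ω → G) : Prop :=
  ∃ Y : Fin D.n → Fin D.m → ℝ≥0 → Ω → G,
    (∀ i j, M.IsRadonification T (D.s i) (D.t i) (D.A j) (D.S i j) (Y i j)) ∧
    ∀ t ≤ T, ∀ ω, X t ω = ∑ i, ∑ j, (D.F i).indicator (fun ω' => Y i j t ω') ω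

variable (T)

/-- `I` is (a version of) the stochastic integral process `(∫_0^t ∫_U Φ(r, u) M(dr, du))_{t ≤ T}`,
i.e. the value at `Φ` of the continuous extension of the integral from simple integrands to
`Λ²(M, T; H, G)`: `I` is a càdlàg square integrable martingale that is the limit, in the norm
`(𝔼 sup_{t ≤ T} ‖·‖²)^{1/2}`, of the integrals of simple integrands that converge to `Φ` in the
norm of `Λ²(M, T; H, G)`. -/
def IsStochasticIntegral (Φ : M.OperatorFamily G) (I : ℝ≥0 → Ω → G) : Prop :=
  IsSqMartingale P ℱ T I ∧
  ∃ (D : ℕ → SimpleIntegrand M T G) (X : ℕ → ℝ≥0 → Ω → G),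
    (∀ n, IsSimpleIntegral (D n) (X n)) ∧
    Tendsto (fun n => lambdaNormSq T
      (fun r ω u => (D n).toFamily r ω u - Φ r ω u : M.OperatorFamily G)) atTop (𝓝 0) ∧
    Tendsto (fun n => martNormSq P T (fun t ω => X n t ω - I t ω)) atTop (𝓝 0)

end CylMartingaleMeasure

end CylMart

end

/-! For simple integrands the identity is pure algebra: since ⟨R y, g⟩ = ⟨y, R^* g⟩, applying R to a
radonification by S gives a radonification by R ∘ S, so R maps the integral of a simple D to an
integral of the simple integrand R ∘ D. Both norms in the definition of the integral are multiplied
by at most ‖R‖ under R. Hence an approximating sequence for Φ is carried to one for R ∘ Φ, and R I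
is a version of the integral of R ∘ Φ whenever I is one for Φ (`IsStochasticIntegral.comp`). The
theorem then follows from uniqueness up to indistinguishability (`IsStochasticIntegral.ae_eq`) and
from existence (`exists_isStochasticIntegral`), which are the bulk of the work.

Uniqueness and the Cauchy property rest on one estimate, `IsSimpleIntegral.martNormSq_sub_le`:
Doob's L² inequality combined with the Itô isometry `IsSimpleIntegral.lintegral_sq`. The isometry
comes from the covariance of localised increments (`integral_indicator_incr_mul_general`): the
diagonal covariance is polarised, disjoint sets are orthogonal, joint increments are independent of
the past, and successive increments are orthogonal by the martingale property. Doob's inequality is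
proved pathwise on dyadic grids, transferred to càdlàg paths, and summed over an orthonormal basis.

Existence needs three more ingredients. First, simple integrals must exist:
`exists_isRadonification` sums càdlàg versions of real martingales along a basis of G, the
Hilbert–Schmidt property giving convergence. The càdlàg versions come from counting oscillations on
dyadic grids, together with right continuity in L², which holds because lam((t, s]) tends to 0 as s
decreases to t. Second, càdlàg square integrable martingales are complete for the supremum norm
(`exists_limit_of_cauchy`). Third, simple integrands are dense (`exists_lambdaNormSq_sub_le`): the
coordinates Φ^* b_i are sections of the field of spaces H_{q_{r,u}}, locally close to constant
sections i_q h, and indicators of predictable sets times constant sections are reached by a π-λ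
argument. -/

noncomputable section

set_option linter.unusedSectionVars false

namespace CylMart

/-! ### Two pathwise inequalities for discrete martingales -/

/-- The running maximum of the positive part of a sequence. -/
def runMax (x : ℕ → ℝ) : ℕ → ℝ
  | 0 => max (x 0) 0
  | n + 1 => max (runMax x n) (x (n + 1))

lemma le_runMax (x : ℕ → ℝ) {k n : ℕ} (h : k ≤ n) : x k ≤ runMax x n := by
  induction n with
  | zero => obtain rfl : k = 0 := by omega
            exact le_max_left _ _
  | succ n ih =>
    rcases Nat.lt_or_ge n k with h' | h'
    · obtain rfl : k = n + 1 := by omega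
      exact le_max_right _ _
    · exact (ih h').trans (le_max_left _ _)

/-- The running maximum S moves only to a new value of x, so summation by parts gives S² ≤ 2Sx − ∑ 2
S_k Δx_k; then (S − 2x)² ≥ 0 absorbs S on the right. For a martingale the sum has mean zero: this is
Doob's inequality before taking expectations. -/
lemma runMax_sq_le (x : ℕ → ℝ) (n : ℕ) :
    runMax x n ^ 2 ≤ 4 * x n ^ 2 -
      ∑ k ∈ Finset.range n, 4 * runMax x k * (x (k + 1) - x k) := by
  have key : runMax x n ^ 2 ≤ 2 * (runMax x n * x n) -
      ∑ k ∈ Finset.range n, 2 * runMax x k * (x (k + 1) - x k) := by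
    induction n with
    | zero =>
      simp only [runMax, Finset.range_zero, Finset.sum_empty, sub_zero]
      rcases le_total (x 0) 0 with h | h
      · simp [max_eq_right h]
      · rw [max_eq_left h]; nlinarith
    | succ n ih =>
      rw [Finset.sum_range_succ]
      simp only [runMax]
      rcases le_total (x (n + 1)) (runMax x n) with h | h
      · rw [max_eq_left h]; nlinarith
      · rw [max_eq_right h]; nlinarith [sq_nonneg (x (n + 1) - runMax x n)]
  have h4 : ∑ k ∈ Finset.range n, 4 * runMax x k * (x (k + 1) - x k) =
      2 * ∑ k ∈ Finset.range n, 2 * runMax x k * (x (k + 1) - x k) := by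
    rw [Finset.mul_sum]; exact Finset.sum_congr rfl fun k _ => by ring
  rw [h4]
  nlinarith [sq_nonneg (runMax x n - 2 * x n)]

/-- The last reference value of a sequence: it is renewed each time that the sequence has moved
by at least `ε`. -/
def oscRef (ε : ℝ) (x : ℕ → ℝ) : ℕ → ℝ
  | 0 => x 0
  | n + 1 => if ε ≤ |x (n + 1) - oscRef ε x n| then x (n + 1) else oscRef ε x n

/-- The number of renewals of the reference value. -/
def oscCount (ε : ℝ) (x : ℕ → ℝ) : ℕ → ℕ
  | 0 => 0
  | n + 1 => if ε ≤ |x (n + 1) - oscRef ε x n| then oscCount ε x n + 1 else oscCount ε x n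

/-- With a fixed reference, the increments of x² − ∑ 2·ref·Δx are those of (x − ref)². A renewal
trades a square of size at least ε² for one unit of the counter and resets the remainder to 0. The
factor `1 *` matches the constant `c` of `integral_le_of_pathwise`. -/
lemma oscCount_le {ε : ℝ} (hε : 0 < ε) (x : ℕ → ℝ) (n : ℕ) :
    ε ^ 2 * oscCount ε x n ≤ 1 * x n ^ 2 -
      ∑ k ∈ Finset.range n, 2 * oscRef ε x k * (x (k + 1) - x k) := by
  have key : ε ^ 2 * oscCount ε x n + (x n - oscRef ε x n) ^ 2 ≤ x n ^ 2 -
      ∑ k ∈ Finset.range n, 2 * oscRef ε x k * (x (k + 1) - x k) := by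
    induction n with
    | zero => simp [oscCount, oscRef]; positivity
    | succ n ih =>
      rw [Finset.sum_range_succ]
      simp only [oscCount, oscRef]
      split_ifs with h
      · have := pow_le_pow_left₀ hε.le h 2
        rw [sq_abs] at this
        push_cast
        nlinarith
      · nlinarith
  nlinarith [sq_nonneg (x n - oscRef ε x n)]

lemma abs_sub_oscRef_lt {ε : ℝ} (hε : 0 < ε) (x : ℕ → ℝ) (n : ℕ) : |x n - oscRef ε x n| < ε := by
  cases n with
  | zero => simpa [oscRef] using hε
  | succ n =>
    simp only [oscRef]
    split_ifs with h
    · simpa using hε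
    · exact not_le.1 h

lemma oscCount_mono (ε : ℝ) (x : ℕ → ℝ) : Monotone (oscCount ε x) := by
  refine monotone_nat_of_le_succ fun n => ?_
  simp only [oscCount]
  split_ifs <;> omega

lemma oscRef_eq {ε : ℝ} {x : ℕ → ℝ} {i j : ℕ} (hij : i ≤ j)
    (h : oscCount ε x j = oscCount ε x i) : oscRef ε x j = oscRef ε x i := by
  induction j, hij using Nat.le_induction with
  | base => rfl
  | succ j hij ih =>
    have h1 := oscCount_mono ε x hij
    simp only [oscCount, oscRef] at h ⊢
    split_ifs at h ⊢ with h2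
    · omega
    · exact ih h

/-- Without a renewal both values lie within ε of a common reference, hence less than 2ε apart. -/
lemma oscCount_lt {ε : ℝ} (hε : 0 < ε) {x : ℕ → ℝ} {i j : ℕ} (hij : i ≤ j)
    (h : 2 * ε ≤ |x i - x j|) : oscCount ε x i < oscCount ε x j := by
  refine lt_of_le_of_ne (oscCount_mono ε x hij) fun he => ?_
  have h1 := oscRef_eq hij he.symm
  have h2 := abs_sub_oscRef_lt hε x i
  have h3 := abs_sub_oscRef_lt hε x j
  rw [h1] at h3
  rw [abs_lt] at h2 h3
  rcases abs_cases (x i - x j) with h4 | h4 <;> linarith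

/-! ### Maximal and oscillation inequalities in discrete time -/

section DiscreteMartingale

variable {Ω : Type*} {mΩ : MeasurableSpace Ω} {P : Measure Ω}

lemma integral_mul_sub_eq_zero [IsFiniteMeasure P] {m : MeasurableSpace Ω} (hm : m ≤ mΩ)
    {Y f g : Ω → ℝ} (hY : StronglyMeasurable[m] Y) (hY2 : MemLp Y 2 P) (hf : MemLp f 2 P)
    (hg : MemLp g 2 P) (h : P[f|m] =ᵐ[P] g) : ∫ ω, Y ω * (f ω - g ω) ∂P = 0 := by
  have h1 : Integrable (Y * f) P := hY2.integrable_mul hf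
  have h2 : Integrable (Y * g) P := hY2.integrable_mul hg
  have h3 : ∫ ω, (Y * f) ω ∂P = ∫ ω, (Y * g) ω ∂P := by
    rw [← integral_condExp hm (f := Y * f)]
    refine integral_congr_ae ?_
    filter_upwards [condExp_mul_of_stronglyMeasurable_left hY h1 (hf.integrable one_le_two), h]
      with ω h4 h5
    rw [h4, Pi.mul_apply, Pi.mul_apply, h5]
  simp only [mul_sub]
  have := integral_sub h1 h2
  simp only [Pi.mul_apply] at this h3
  rw [this, h3, sub_self]

variable {F : Filtration ℕ mΩ} {X : ℕ → Ω → ℝ}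

/-- The subtracted sum is a martingale transform with adapted weights, so it has mean zero and only
the terminal square survives. Both pathwise inequalities above have this shape. -/
lemma integral_le_of_pathwise [IsFiniteMeasure P] (hX : Martingale X F P) (hX2 : ∀ n, MemLp (X n) 2 P)
    {Y : ℕ → Ω → ℝ} (hY : ∀ n, StronglyMeasurable[F n] (Y n)) (hY2 : ∀ n, MemLp (Y n) 2 P)
    {f : Ω → ℝ} (hf : Integrable f P) {c : ℝ} {n : ℕ}
    (hle : ∀ ω, f ω ≤ c * X n ω ^ 2 - ∑ k ∈ Finset.range n, Y k ω * (X (k + 1) ω - X k ω)) :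
    ∫ ω, f ω ∂P ≤ c * ∫ ω, X n ω ^ 2 ∂P := by
  have hint : ∀ k ∈ Finset.range n, Integrable (fun ω => Y k ω * (X (k + 1) ω - X k ω)) P :=
    fun k _ => (hY2 k).integrable_mul ((hX2 (k + 1)).sub (hX2 k))
  have h0 : ∀ k ∈ Finset.range n, ∫ ω, Y k ω * (X (k + 1) ω - X k ω) ∂P = 0 := fun k _ =>
    integral_mul_sub_eq_zero (F.le k) (hY k) (hY2 k) (hX2 _) (hX2 _) (hX.2 k (k + 1) k.le_succ)
  have hsq : Integrable (fun ω => c * X n ω ^ 2) P := (hX2 n).integrable_sq.const_mul c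
  have h1 := integral_mono hf (hsq.sub (integrable_finsetSum _ hint)) hle
  simp only [Pi.sub_apply] at h1
  rw [integral_sub hsq (integrable_finsetSum _ hint), integral_finsetSum _ hint,
    Finset.sum_eq_zero h0, sub_zero, integral_const_mul] at h1
  exact h1

lemma stronglyMeasurable_runMax (hX : ∀ n, StronglyMeasurable[F n] (X n)) (n : ℕ) :
    StronglyMeasurable[F n] fun ω => runMax (fun k => X k ω) n := by
  induction n with
  | zero =>
    exact continuous_max.comp_stronglyMeasurable
      ((hX 0).prodMk (stronglyMeasurable_const (b := (0 : ℝ))))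
  | succ n ih =>
    exact continuous_max.comp_stronglyMeasurable
      ((ih.mono (F.mono n.le_succ)).prodMk (hX (n + 1)))

lemma memLp_runMax [IsFiniteMeasure P] (hX2 : ∀ n, MemLp (X n) 2 P) (n : ℕ) :
    MemLp (fun ω => runMax (fun k => X k ω) n) 2 P := by
  induction n with
  | zero => exact (hX2 0).sup (memLp_const 0)
  | succ n ih => exact ih.sup (hX2 (n + 1))

lemma integral_runMax_sq_le [IsFiniteMeasure P] (hX : Martingale X F P) (hX2 : ∀ n, MemLp (X n) 2 P) (n : ℕ) :
    ∫ ω, runMax (fun k => X k ω) n ^ 2 ∂P ≤ 4 * ∫ ω, X n ω ^ 2 ∂P :=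
  integral_le_of_pathwise hX hX2 (Y := fun k ω => 4 * runMax (fun k => X k ω) k)
    (fun k => (stronglyMeasurable_runMax hX.1 k).const_mul 4)
    (fun k => (memLp_runMax hX2 k).const_mul 4) (memLp_runMax hX2 n).integrable_sq
    fun _ => runMax_sq_le _ n

/-- Doob's maximal inequality in `L²`. -/
lemma lintegral_iSup_sq_le [IsFiniteMeasure P] (hX : Martingale X F P)
    (hX2 : ∀ n, MemLp (X n) 2 P) (n : ℕ) :
    ∫⁻ ω, ⨆ k : Set.Iic n, ‖X k ω‖ₑ ^ 2 ∂P ≤ 8 * ∫⁻ ω, ‖X n ω‖ₑ ^ 2 ∂P := by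
  have hsq : ∀ y : ℝ, ‖y‖ₑ ^ 2 = ENNReal.ofReal (y ^ 2) := fun y => by
    rw [← ofReal_norm, ← ENNReal.ofReal_pow (norm_nonneg _), Real.norm_eq_abs, sq_abs]
  -- `runMax` sees only positive parts, so X and −X are treated separately; each contributes the
  -- constant 4, whence 8.
  have hX' : Martingale (fun k => -X k) F P := hX.neg
  have hX2' : ∀ n, MemLp (-X n) 2 P := fun n => (hX2 n).neg
  set S : Ω → ℝ := fun ω => runMax (fun k => X k ω) n
  set S' : Ω → ℝ := fun ω => runMax (fun k => (-X k) ω) n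
  have hS : Integrable (fun ω => S ω ^ 2) P := (memLp_runMax hX2 n).integrable_sq
  have hS' : Integrable (fun ω => S' ω ^ 2) P := (memLp_runMax hX2' n).integrable_sq
  calc ∫⁻ ω, ⨆ k : Set.Iic n, ‖X k ω‖ₑ ^ 2 ∂P
      ≤ ∫⁻ ω, ENNReal.ofReal (S ω ^ 2 + S' ω ^ 2) ∂P := by
        refine lintegral_mono fun ω => iSup_le fun k => ?_
        rw [hsq]
        refine ENNReal.ofReal_le_ofReal ?_
        have h1 : X k ω ≤ S ω := le_runMax (fun k => X k ω) k.2
        have h2 : -X k ω ≤ S' ω := le_runMax (fun k => (-X k) ω) k.2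
        rcases le_total 0 (X k ω) with h | h
        · nlinarith [sq_nonneg (S' ω)]
        · nlinarith [sq_nonneg (S ω)]
    _ = ENNReal.ofReal (∫ ω, S ω ^ 2 + S' ω ^ 2 ∂P) :=
        (ofReal_integral_eq_lintegral_ofReal (hS.add hS')
          (ae_of_all _ fun ω => add_nonneg (sq_nonneg _) (sq_nonneg _))).symm
    _ ≤ ENNReal.ofReal (8 * ∫ ω, X n ω ^ 2 ∂P) := by
        refine ENNReal.ofReal_le_ofReal ?_
        rw [integral_add hS hS']
        have h1 := integral_runMax_sq_le hX hX2 n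
        have h2 := integral_runMax_sq_le hX' hX2' n
        simp only [Pi.neg_apply, neg_sq] at h2
        change _ + ∫ ω, runMax (fun k => -X k ω) n ^ 2 ∂P ≤ _
        linarith
    _ = 8 * ∫⁻ ω, ‖X n ω‖ₑ ^ 2 ∂P := by
        rw [ENNReal.ofReal_mul (by norm_num), ofReal_integral_eq_lintegral_ofReal
          (hX2 n).integrable_sq (ae_of_all _ fun ω => sq_nonneg _)]
        simp only [hsq]
        norm_num

lemma stronglyMeasurable_oscRef (ε : ℝ) (hX : ∀ n, StronglyMeasurable[F n] (X n)) (n : ℕ) :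
    StronglyMeasurable[F n] fun ω => oscRef ε (fun k => X k ω) n := by
  induction n with
  | zero => exact hX 0
  | succ n ih =>
    have ih' := ih.mono (F.mono n.le_succ)
    exact StronglyMeasurable.ite (stronglyMeasurable_const.measurableSet_le
      ((hX (n + 1)).sub ih').norm) (hX (n + 1)) ih'

lemma memLp_oscRef (ε : ℝ) (hX : ∀ n, StronglyMeasurable[F n] (X n))
    (hX2 : ∀ n, MemLp (X n) 2 P) (n : ℕ) :
    MemLp (fun ω => oscRef ε (fun k => X k ω) n) 2 P := by
  induction n with
  | zero => exact hX2 0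
  | succ n ih =>
    refine ((hX2 (n + 1)).norm.add ih.norm).mono
      ((stronglyMeasurable_oscRef ε hX (n + 1)).mono (F.le _)).aestronglyMeasurable
      (ae_of_all _ fun ω => ?_)
    refine le_trans ?_ (le_abs_self _)
    simp only [oscRef, Pi.add_apply]
    split_ifs
    · simp
    · simp

lemma measurable_oscCount (ε : ℝ) (hX : ∀ n, StronglyMeasurable[F n] (X n)) (n : ℕ) :
    Measurable[F n] fun ω => oscCount ε (fun k => X k ω) n := by
  induction n with
  | zero => exact measurable_const
  | succ n ih =>
    have ih' := ih.mono (F.mono n.le_succ) le_rfl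
    have ih2 := (stronglyMeasurable_oscRef ε hX n).mono (F.mono n.le_succ)
    exact Measurable.ite (stronglyMeasurable_const.measurableSet_le
      ((hX (n + 1)).sub ih2).norm) ((measurable_from_top (f := fun k : ℕ => k + 1)).comp ih') ih'

/-- A square integrable martingale oscillates by `ε` many times with small probability only. -/
lemma mul_measure_le_oscCount [IsFiniteMeasure P] {ε : ℝ} (hε : 0 < ε) (hX : Martingale X F P)
    (hX2 : ∀ n, MemLp (X n) 2 P) (n K : ℕ) :
    ε ^ 2 * K * P.real {ω | K ≤ oscCount ε (fun k => X k ω) n} ≤ ∫ ω, X n ω ^ 2 ∂P := by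
  set A : Set Ω := {ω | K ≤ oscCount ε (fun k => X k ω) n}
  have hA : MeasurableSet A :=
    F.le n _ (measurable_oscCount ε hX.1 n (measurableSet_Ici : MeasurableSet (Set.Ici K)))
  have h := integral_le_of_pathwise hX hX2 (c := 1) (n := n)
    (Y := fun k ω => 2 * oscRef ε (fun k => X k ω) k)
    (f := A.indicator fun _ => ε ^ 2 * K)
    (fun k => (stronglyMeasurable_oscRef ε hX.1 k).const_mul 2)
    (fun k => (memLp_oscRef ε hX.1 hX2 k).const_mul 2) ((integrable_const _).indicator hA)
    fun ω => by
      refine le_trans ?_ (oscCount_le hε (fun k => X k ω) n)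
      refine Set.indicator_apply_le' (fun h => ?_) fun _ => by positivity
      have : (K : ℝ) ≤ oscCount ε (fun k => X k ω) n := by exact_mod_cast h
      gcongr
  rw [integral_indicator_const _ hA, one_mul, smul_eq_mul] at h
  linarith

end DiscreteMartingale

/-! ### Chains of oscillations and one-sided limits -/

/-- There is an increasing chain of `K` oscillations of `x` by `ε` along `D` that ends at `t`. -/
def ChainTo (D : Set ℝ≥0) (x : ℝ≥0 → ℝ) (ε : ℝ) : ℕ → ℝ≥0 → Prop
  | 0, t => t ∈ D
  | K + 1, t => t ∈ D ∧ ∃ s < t, ChainTo D x ε K s ∧ ε ≤ |x s - x t|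

/-- There is an increasing chain of `K` oscillations of `x` by `ε` along `D` that starts at `t`. -/
def ChainFrom (D : Set ℝ≥0) (x : ℝ≥0 → ℝ) (ε : ℝ) : ℕ → ℝ≥0 → Prop
  | 0, t => t ∈ D
  | K + 1, t => t ∈ D ∧ ∃ s > t, ChainFrom D x ε K s ∧ ε ≤ |x t - x s|

section Chains

variable {D : Set ℝ≥0} {x : ℝ≥0 → ℝ}

lemma ChainTo.mem {ε : ℝ} {K : ℕ} {t : ℝ≥0} (h : ChainTo D x ε K t) : t ∈ D := by
  cases K with
  | zero => exact h
  | succ K => exact h.1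

lemma ChainFrom.mem {ε : ℝ} {K : ℕ} {t : ℝ≥0} (h : ChainFrom D x ε K t) : t ∈ D := by
  cases K with
  | zero => exact h
  | succ K => exact h.1

lemma exists_tendsto_of_not_exists {l : Filter ℝ≥0}
    (h : ∀ ε > 0, ¬ ∀ s ∈ l, ∃ a ∈ s, ∃ b ∈ s, ε ≤ |x a - x b|) :
    ∃ y, Tendsto x l (𝓝 y) := by
  rcases l.eq_or_neBot with rfl | hl
  · exact ⟨0, tendsto_bot⟩
  refine cauchy_map_iff_exists_tendsto.1 (Metric.cauchy_iff.2 ⟨hl.map x, fun ε hε => ?_⟩)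
  have h1 := h ε hε
  push Not at h1
  obtain ⟨s, hs, h2⟩ := h1
  refine ⟨x '' s, image_mem_map hs, ?_⟩
  rintro _ ⟨a, ha, rfl⟩ _ ⟨b, hb, rfl⟩
  exact h2 a ha b hb

/-- If the limit failed to exist, x would oscillate by some ε along D arbitrarily close to t, and a
chain of ε/2-oscillations could be prolonged towards t without end. -/
lemma exists_left_limit (h : ∀ ε > 0, ∃ K, ∀ t, ¬ ChainTo D x ε K t) (t : ℝ≥0) :
    ∃ y, Tendsto x (𝓝[D ∩ Set.Iio t] t) (𝓝 y) := by
  rcases (𝓝[D ∩ Set.Iio t] t).eq_or_neBot with h0 | h0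
  · rw [h0]; exact ⟨0, tendsto_bot⟩
  refine exists_tendsto_of_not_exists fun ε hε hosc => ?_
  obtain ⟨K, hK⟩ := h (ε / 2) (half_pos hε)
  have : ∀ K, ∃ r ∈ D ∩ Set.Iio t, ChainTo D x (ε / 2) K r := by
    intro K
    induction K with
    | zero =>
      obtain ⟨r, hr⟩ := h0.nonempty_of_mem self_mem_nhdsWithin
      exact ⟨r, hr, hr.1⟩
    | succ K ih =>
      obtain ⟨r, hr, hc⟩ := ih
      obtain ⟨a, ha, b, hb, hab⟩ := hosc (D ∩ Set.Iio t ∩ Set.Ioi r)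
        (inter_mem self_mem_nhdsWithin (mem_nhdsWithin_of_mem_nhds (Ioi_mem_nhds hr.2)))
      -- Two values ε apart cannot both be within ε/2 of the value at r, so one of a, b prolongs the
      -- chain.
      rcases le_or_gt (ε / 2) |x r - x a| with h1 | h1
      · exact ⟨a, ha.1, ha.1.1, r, ha.2, hc, h1⟩
      · refine ⟨b, hb.1, hb.1.1, r, hb.2, hc, ?_⟩
        have h2 := abs_sub_le (x a) (x r) (x b)
        rw [abs_sub_comm (x a) (x r)] at h2
        linarith
  obtain ⟨r, -, hr⟩ := this K
  exact hK r hr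

lemma exists_right_limit (h : ∀ ε > 0, ∃ K, ∀ t, ¬ ChainFrom D x ε K t) (t : ℝ≥0) :
    ∃ y, Tendsto x (𝓝[D ∩ Set.Ioi t] t) (𝓝 y) := by
  rcases (𝓝[D ∩ Set.Ioi t] t).eq_or_neBot with h0 | h0
  · rw [h0]; exact ⟨0, tendsto_bot⟩
  refine exists_tendsto_of_not_exists fun ε hε hosc => ?_
  obtain ⟨K, hK⟩ := h (ε / 2) (half_pos hε)
  have : ∀ K, ∃ r ∈ D ∩ Set.Ioi t, ChainFrom D x (ε / 2) K r := by
    intro K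
    induction K with
    | zero =>
      obtain ⟨r, hr⟩ := h0.nonempty_of_mem self_mem_nhdsWithin
      exact ⟨r, hr, hr.1⟩
    | succ K ih =>
      obtain ⟨r, hr, hc⟩ := ih
      obtain ⟨a, ha, b, hb, hab⟩ := hosc (D ∩ Set.Ioi t ∩ Set.Iio r)
        (inter_mem self_mem_nhdsWithin (mem_nhdsWithin_of_mem_nhds (Iio_mem_nhds hr.2)))
      rcases le_or_gt (ε / 2) |x a - x r| with h1 | h1
      · exact ⟨a, ha.1, ha.1.1, r, ha.2, hc, h1⟩
      · refine ⟨b, hb.1, hb.1.1, r, hb.2, hc, ?_⟩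
        have h2 := abs_sub_le (x a) (x r) (x b)
        rw [abs_sub_comm (x r) (x b)] at h2
        linarith
  obtain ⟨r, -, hr⟩ := this K
  exact hK r hr

open Classical in
/-- The right-continuous regularisation on `[0, T]` of `x` along the set `D`. -/
def regularize (D : Set ℝ≥0) (T : ℝ≥0) (x : ℝ≥0 → ℝ) (t : ℝ≥0) : ℝ :=
  if t < T then limUnder (𝓝[D ∩ Set.Ioi t] t) x else x t

/-- A bound for x along D on an open interval passes through right limits to the regularisation on
that interval (`hclose`), so the one-sided limits of x along D become those of the regularisation.
At T nothing lies to the right: the value of x is kept, and right continuity within [T, T] is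
trivial. -/
lemma isCadlagOn_regularize {T : ℝ≥0} (hD : ∀ a b, a < b → b ≤ T → ∃ d ∈ D, a < d ∧ d < b)
    (hl : ∀ ε > 0, ∃ K, ∀ t, ¬ ChainTo D x ε K t) (hr : ∀ ε > 0, ∃ K, ∀ t, ¬ ChainFrom D x ε K t) :
    IsCadlagOn T (regularize D T x) := by
  have hne : ∀ t < T, (𝓝[D ∩ Set.Ioi t] t).NeBot := by
    intro t ht
    rw [Set.inter_comm, nhdsWithin_inter',
      (nhdsGT_basis_of_exists_gt ⟨T, ht⟩).inf_principal_neBot_iff]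
    intro b hb
    obtain ⟨d, hd, h1, h2⟩ := hD t (min b T) (lt_min hb ht) (min_le_right _ _)
    exact ⟨d, ⟨h1, h2.trans_le (min_le_left _ _)⟩, hd⟩
  have hlim : ∀ t < T, Tendsto x (𝓝[D ∩ Set.Ioi t] t) (𝓝 (regularize D T x t)) := by
    intro t ht
    have := hne t ht
    simp only [regularize, if_pos ht]
    exact tendsto_nhds_limUnder (exists_right_limit hr t)
  have hclose : ∀ (y ε : ℝ) (a b : ℝ≥0), b ≤ T → (∀ d ∈ D, a < d → d < b → |x d - y| ≤ ε) →
      ∀ s, a < s → s < b → |regularize D T x s - y| ≤ ε := by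
    intro y ε a b hb h s has hsb
    have := hne s (hsb.trans_le hb)
    refine le_of_tendsto ((hlim s (hsb.trans_le hb)).sub_const y).abs ?_
    filter_upwards [self_mem_nhdsWithin, mem_nhdsWithin_of_mem_nhds (Iio_mem_nhds hsb)]
      with d hd hd'
    exact h d hd.1 (has.trans hd.2) hd'
  intro t ht
  constructor
  · rcases ht.eq_or_lt with rfl | ht
    · simp only [Set.Icc_self]
      exact continuousWithinAt_singleton
    · refine Metric.continuousWithinAt_iff'.2 fun ε hε => ?_
      have h1 := Metric.tendsto_nhds.1 (hlim t ht) (ε / 2) (half_pos hε)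
      rw [Set.inter_comm, nhdsWithin_inter',
        ((nhdsGT_basis_of_exists_gt ⟨T, ht⟩).inf_principal D).eventually_iff] at h1
      obtain ⟨b, hb, h2⟩ := h1
      filter_upwards [self_mem_nhdsWithin,
        mem_nhdsWithin_of_mem_nhds (Iio_mem_nhds (lt_min hb ht))] with s hs hs'
      rcases hs.1.eq_or_lt with rfl | hts
      · simpa using hε
      · refine lt_of_le_of_lt (hclose _ (ε / 2) t (min b T) (min_le_right _ _) ?_ s hts hs')
          (half_lt_self hε)
        exact fun d hd h3 h4 => (h2 ⟨⟨h3, h4.trans_le (min_le_left _ _)⟩, hd⟩).le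
  · obtain ⟨y, hy⟩ := exists_left_limit hl t
    refine ⟨y, Metric.tendsto_nhds.2 fun ε hε => ?_⟩
    -- At 0 the filter of left neighbourhoods is trivial, and the basis of intervals used below
    -- needs a point to the left.
    rcases eq_or_ne t 0 with rfl | h0
    · simp
    have h0' : 0 < t := pos_iff_ne_zero.2 h0
    have h1 := Metric.tendsto_nhds.1 hy (ε / 2) (half_pos hε)
    rw [Set.inter_comm, nhdsWithin_inter',
      ((nhdsLT_basis_of_exists_lt ⟨0, h0'⟩).inf_principal D).eventually_iff] at h1
    obtain ⟨a, ha, h2⟩ := h1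
    filter_upwards [Ioo_mem_nhdsLT ha] with s hs
    refine lt_of_le_of_lt (hclose y (ε / 2) a t ht ?_ s hs.1 hs.2) (half_lt_self hε)
    exact fun d hd h3 h4 => (h2 ⟨⟨h3, h4⟩, hd⟩).le

end Chains

/-! ### Dyadic grids of `[0, T]` -/

/-- The points of the dyadic grid of mesh `2 ^ (-m)` of `[0, T]`. -/
def grid (T : ℝ≥0) (m k : ℕ) : ℝ≥0 := min (k / 2 ^ m) T

/-- The index of the last point of a dyadic grid. -/
def gridLen (T : ℝ≥0) (m : ℕ) : ℕ := ⌈T⌉₊ * 2 ^ m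

/-- The dyadic points of `[0, T]`. -/
def dyadicPoints (T : ℝ≥0) : Set ℝ≥0 := ⋃ m, grid T m '' Set.Iic (gridLen T m)

section Grid

variable (T : ℝ≥0)

lemma grid_mono (m : ℕ) : Monotone (grid T m) := fun i j h =>
  min_le_min_right _ (by gcongr)

lemma grid_le (m k : ℕ) : grid T m k ≤ T := min_le_right _ _

lemma grid_gridLen (m : ℕ) : grid T m (gridLen T m) = T := by
  refine min_eq_right ?_
  rw [gridLen, Nat.cast_mul, Nat.cast_pow, Nat.cast_ofNat, mul_div_assoc,
    div_self (by positivity), mul_one]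
  exact Nat.le_ceil T

lemma grid_succ (m k : ℕ) : grid T (m + 1) (2 * k) = grid T m k := by
  unfold grid
  congr 1
  push_cast
  rw [pow_succ, mul_comm (2 : ℝ≥0) k, mul_div_mul_right _ _ (by norm_num)]

lemma gridSet_mono : Monotone fun m => grid T m '' Set.Iic (gridLen T m) := by
  refine monotone_nat_of_le_succ fun m => ?_
  rintro _ ⟨k, hk, rfl⟩
  refine ⟨2 * k, ?_, grid_succ T m k⟩
  simp only [Set.mem_Iic, gridLen] at hk ⊢
  rw [pow_succ]
  calc 2 * k ≤ 2 * (⌈T⌉₊ * 2 ^ m) := by omega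
    _ = _ := by ring

lemma grid_mem_gridSet (m k : ℕ) : grid T m k ∈ grid T m '' Set.Iic (gridLen T m) := by
  rcases le_total k (gridLen T m) with h | h
  · exact ⟨k, h, rfl⟩
  · refine ⟨gridLen T m, Set.mem_Iic.2 le_rfl, le_antisymm (grid_mono T m h) ?_⟩
    rw [grid_gridLen]
    exact grid_le T m k

lemma grid_mem_dyadicPoints (m k : ℕ) : grid T m k ∈ dyadicPoints T :=
  Set.mem_iUnion.2 ⟨m, grid_mem_gridSet T m k⟩

lemma dyadicPoints_subset : dyadicPoints T ⊆ Set.Iic T := by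
  rintro _ h
  obtain ⟨m, k, -, rfl⟩ := Set.mem_iUnion.1 h
  exact grid_le T m k

lemma exists_dyadicPoints_between {a b : ℝ≥0} (hab : a < b) (hb : b ≤ T) :
    ∃ d ∈ dyadicPoints T, a < d ∧ d < b := by
  obtain ⟨m, hm⟩ := exists_nat_gt (1 / (b - a))
  have hpos : 0 < b - a := tsub_pos_of_lt hab
  have hm2 : 1 / (b - a) < 2 ^ m := hm.trans (by exact_mod_cast Nat.lt_two_pow_self)
  have h1 : (1 : ℝ≥0) < 2 ^ m * (b - a) := by rwa [div_lt_iff₀ hpos] at hm2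
  have h1' : (1 : ℝ) < 2 ^ m * (b - a) := by
    have := NNReal.coe_lt_coe.2 h1
    rwa [NNReal.coe_mul, NNReal.coe_sub hab.le] at this
  -- This indexes the first multiple of 2^(-m) strictly above a; the mesh is smaller than b − a, so
  -- it stays below b.
  set k := ⌊a * 2 ^ m⌋₊ + 1
  have hk1 : a * 2 ^ m < k := by
    simpa [k] using Nat.lt_floor_add_one (a * 2 ^ m)
  have hk2 : (k : ℝ≥0) ≤ a * 2 ^ m + 1 := by
    push_cast [k]
    gcongr
    exact Nat.floor_le (by positivity)
  have hlt1 : a < k / 2 ^ m := by rwa [lt_div_iff₀ (by positivity)]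
  have hlt2 : (k : ℝ≥0) / 2 ^ m < b := by
    rw [div_lt_iff₀ (by positivity)]
    refine lt_of_le_of_lt hk2 ?_
    rw [← NNReal.coe_lt_coe]
    push_cast
    nlinarith
  refine ⟨grid T m k, grid_mem_dyadicPoints T m k, ?_, ?_⟩
  · exact lt_min hlt1 (hab.trans_le hb)
  · exact (min_le_left _ _).trans_lt hlt2

/-- Each link of size 2ε forces a renewal of the ε-reference (`oscCount_lt`). -/
lemma chainTo_grid_le_oscCount {x : ℝ≥0 → ℝ} {ε : ℝ} (hε : 0 < ε) (m K : ℕ) (j : ℕ)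
    (h : ChainTo (grid T m '' Set.Iic (gridLen T m)) x (2 * ε) K (grid T m j)) :
    K ≤ oscCount ε (fun k => x (grid T m k)) j := by
  induction K generalizing j with
  | zero => exact Nat.zero_le _
  | succ K ih =>
    obtain ⟨-, s, hs, hc, hosc⟩ := h
    obtain ⟨i, -, rfl⟩ := hc.mem
    have hij : i ≤ j := ((grid_mono T m).reflect_lt hs).le
    exact (ih i hc).trans_lt (oscCount_lt hε hij hosc)

lemma chainFrom_grid_le_oscCount {x : ℝ≥0 → ℝ} {ε : ℝ} (hε : 0 < ε) (m K : ℕ) (i : ℕ)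
    (hi : i ≤ gridLen T m)
    (h : ChainFrom (grid T m '' Set.Iic (gridLen T m)) x (2 * ε) K (grid T m i)) :
    oscCount ε (fun k => x (grid T m k)) i + K ≤
      oscCount ε (fun k => x (grid T m k)) (gridLen T m) := by
  induction K generalizing i with
  | zero => exact oscCount_mono ε _ hi
  | succ K ih =>
    obtain ⟨-, s, hs, hc, hosc⟩ := h
    obtain ⟨j, hj, rfl⟩ := hc.mem
    have hij : i ≤ j := ((grid_mono T m).reflect_lt hs).le
    have h1 := ih j hj hc
    have h2 := oscCount_lt hε hij (x := fun k => x (grid T m k)) hosc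
    omega

/-- A chain has finitely many points, so one member of the increasing family already contains it. -/
lemma ChainTo.exists_of_iUnion {S : ℕ → Set ℝ≥0} (hS : Monotone S) {x : ℝ≥0 → ℝ} {ε : ℝ} {K : ℕ}
    {t : ℝ≥0} (h : ChainTo (⋃ m, S m) x ε K t) : ∃ m, ∀ n ≥ m, ChainTo (S n) x ε K t := by
  induction K generalizing t with
  | zero =>
    obtain ⟨m, hm⟩ := Set.mem_iUnion.1 h
    exact ⟨m, fun n hn => hS hn hm⟩
  | succ K ih =>
    obtain ⟨ht, s, hs, hc, hosc⟩ := h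
    obtain ⟨m, hm⟩ := Set.mem_iUnion.1 ht
    obtain ⟨m', hm'⟩ := ih hc
    exact ⟨max m m', fun n hn => ⟨hS (le_of_max_le_left hn) hm, s, hs,
      hm' n (le_of_max_le_right hn), hosc⟩⟩

lemma ChainFrom.exists_of_iUnion {S : ℕ → Set ℝ≥0} (hS : Monotone S) {x : ℝ≥0 → ℝ} {ε : ℝ}
    {K : ℕ} {t : ℝ≥0} (h : ChainFrom (⋃ m, S m) x ε K t) :
    ∃ m, ∀ n ≥ m, ChainFrom (S n) x ε K t := by
  induction K generalizing t with
  | zero =>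
    obtain ⟨m, hm⟩ := Set.mem_iUnion.1 h
    exact ⟨m, fun n hn => hS hn hm⟩
  | succ K ih =>
    obtain ⟨ht, s, hs, hc, hosc⟩ := h
    obtain ⟨m, hm⟩ := Set.mem_iUnion.1 ht
    obtain ⟨m', hm'⟩ := ih hc
    exact ⟨max m m', fun n hn => ⟨hS (le_of_max_le_left hn) hm, s, hs,
      hm' n (le_of_max_le_right hn), hosc⟩⟩

/-- Having the bound on all sufficiently fine grids, not just on one, puts the chain event inside an
increasing union, whose measure is a supremum. -/
lemma exists_le_oscCount_of_chain {x : ℝ≥0 → ℝ} {ε : ℝ} (hε : 0 < ε) {K : ℕ} {t : ℝ≥0}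
    (h : ChainTo (dyadicPoints T) x (2 * ε) K t ∨ ChainFrom (dyadicPoints T) x (2 * ε) K t) :
    ∃ m, ∀ n ≥ m, K ≤ oscCount ε (fun k => x (grid T n k)) (gridLen T n) := by
  rcases h with h | h
  · obtain ⟨m, hm⟩ := h.exists_of_iUnion (gridSet_mono T)
    refine ⟨m, fun n hn => ?_⟩
    have h1 := hm n hn
    obtain ⟨j, hj, rfl⟩ := h1.mem
    exact (chainTo_grid_le_oscCount T hε n K j h1).trans (oscCount_mono ε _ hj)
  · obtain ⟨m, hm⟩ := h.exists_of_iUnion (gridSet_mono T)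
    refine ⟨m, fun n hn => ?_⟩
    have h1 := hm n hn
    obtain ⟨j, hj, rfl⟩ := h1.mem
    exact (Nat.le_add_left _ _).trans (chainFrom_grid_le_oscCount T hε n K j hj h1)

end Grid

/-! ### Square integrable martingales without path regularity -/

section Processes

variable {Ω : Type*} {mΩ : MeasurableSpace Ω} {P : Measure Ω} {ℱ : Filtration ℝ≥0 mΩ} {T : ℝ≥0}
  {G : Type*} [NormedAddCommGroup G] [InnerProductSpace ℝ G] [CompleteSpace G]

lemma lintegral_enorm_sq_eq {f : Ω → G} : ∫⁻ ω, ‖f ω‖ₑ ^ 2 ∂P = eLpNorm f 2 P ^ 2 := by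
  have := eLpNorm_nnreal_pow_eq_lintegral (μ := P) (f := f) (p := 2) two_ne_zero
  simpa using this.symm

lemma tendstoInMeasure_of_lintegral_sq {ι : Type*} {l : Filter ι} {f : ι → Ω → G} {g : Ω → G}
    (hf : ∀ n, AEStronglyMeasurable (f n) P) (hg : AEStronglyMeasurable g P)
    (h : Tendsto (fun n => ∫⁻ ω, ‖f n ω - g ω‖ₑ ^ 2 ∂P) l (𝓝 0)) :
    TendstoInMeasure P f l g := by
  refine tendstoInMeasure_of_tendsto_eLpNorm two_ne_zero hf hg ?_
  have h2 : ∀ n, (∫⁻ ω, ‖f n ω - g ω‖ₑ ^ 2 ∂P) ^ (1 / 2 : ℝ) = eLpNorm (f n - g) 2 P := by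
    intro n
    have := lintegral_enorm_sq_eq (P := P) (f := f n - g)
    simp only [Pi.sub_apply] at this
    rw [this, ← ENNReal.rpow_natCast, ← ENNReal.rpow_mul]
    norm_num
  have h3 := h.ennrpow_const (1 / 2 : ℝ)
  simp only [h2] at h3
  simpa using h3

/-- `X` restricted to `[0, T]` is a square integrable martingale. -/
structure IsL2Martingale (P : Measure Ω) (ℱ : Filtration ℝ≥0 mΩ) (T : ℝ≥0)
    (X : ℝ≥0 → Ω → G) : Prop where
  adapted : ∀ t ≤ T, StronglyMeasurable[ℱ t] (X t)
  memLp : ∀ t ≤ T, MemLp (X t) 2 P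
  condExp : ∀ s t, s ≤ t → t ≤ T → P[X t|ℱ s] =ᵐ[P] X s

lemma IsSqMartingale.isL2Martingale {X : ℝ≥0 → Ω → G} (h : IsSqMartingale P ℱ T X) :
    IsL2Martingale P ℱ T X := ⟨h.adapted, h.memLp, h.condExp⟩

/-- The restriction of a filtration to a dyadic grid. -/
def gridFiltration (ℱ : Filtration ℝ≥0 mΩ) (T : ℝ≥0) (m : ℕ) : Filtration ℕ mΩ where
  seq k := ℱ (grid T m k)
  mono' _ _ h := ℱ.mono (grid_mono T m h)
  le' _ := ℱ.le _

lemma IsL2Martingale.martingale_grid {X : ℝ≥0 → Ω → G} (hX : IsL2Martingale P ℱ T X) (m : ℕ) :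
    Martingale (fun k => X (grid T m k)) (gridFiltration ℱ T m) P :=
  ⟨fun k => hX.adapted _ (grid_le T m k),
    fun _ j hij => hX.condExp _ _ (grid_mono T m hij) (grid_le T m j)⟩

/-- Every grid ends at T, so the oscillation bounds share the right-hand side 𝔼 X_T² and survive the
increasing union over grids. Length K + 1 keeps the denominator positive. -/
lemma measure_chain_le [IsFiniteMeasure P] {X : ℝ≥0 → Ω → ℝ} (hX : IsL2Martingale P ℱ T X) {ε : ℝ}
    (hε : 0 < ε) (K : ℕ) :
    P {ω | ∃ t, ChainTo (dyadicPoints T) (fun t => X t ω) (2 * ε) (K + 1) t ∨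
        ChainFrom (dyadicPoints T) (fun t => X t ω) (2 * ε) (K + 1) t} ≤
      ENNReal.ofReal ((∫ ω, X T ω ^ 2 ∂P) / ε ^ 2 / (K + 1)) := by
  set A : ℕ → Set Ω := fun m =>
    ⋂ n ≥ m, {ω | K + 1 ≤ oscCount ε (fun k => X (grid T n k) ω) (gridLen T n)}
  have hA : Monotone A := fun m m' h => Set.iInter₂_mono' fun n hn => ⟨n, h.trans hn, le_rfl⟩
  have hsub : {ω | ∃ t, ChainTo (dyadicPoints T) (fun t => X t ω) (2 * ε) (K + 1) t ∨
        ChainFrom (dyadicPoints T) (fun t => X t ω) (2 * ε) (K + 1) t} ⊆ ⋃ m, A m := by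
    rintro ω ⟨t, ht⟩
    obtain ⟨m, hm⟩ := exists_le_oscCount_of_chain T hε ht
    exact Set.mem_iUnion.2 ⟨m, Set.mem_iInter₂.2 hm⟩
  refine (measure_mono hsub).trans ?_
  rw [hA.measure_iUnion]
  refine iSup_le fun m => ?_
  refine (measure_mono (Set.iInter₂_subset m le_rfl)).trans ?_
  rw [← ofReal_measureReal]
  refine ENNReal.ofReal_le_ofReal ?_
  have h1 := mul_measure_le_oscCount hε (hX.martingale_grid m)
    (fun k => hX.memLp _ (grid_le T m k)) (gridLen T m) (K + 1)
  rw [grid_gridLen] at h1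
  push_cast at h1
  rw [div_div, le_div_iff₀ (by positivity)]
  linarith

/-- For fixed ε, arbitrarily long chains have probability at most c/(K + 1) for every K, hence zero.
The values ε = 2/(j + 1) suffice, since a chain for a larger ε is also one for a smaller ε. -/
lemma ae_forall_not_chain [IsFiniteMeasure P] {X : ℝ≥0 → Ω → ℝ} (hX : IsL2Martingale P ℱ T X) :
    ∀ᵐ ω ∂P, ∀ ε > 0, ∃ K, ∀ t, ¬ (ChainTo (dyadicPoints T) (fun t => X t ω) ε K t ∨
        ChainFrom (dyadicPoints T) (fun t => X t ω) ε K t) := by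
  have key : ∀ j : ℕ, ∀ᵐ ω ∂P, ∃ K, ∀ t,
      ¬ (ChainTo (dyadicPoints T) (fun t => X t ω) (2 * (1 / (j + 1 : ℝ))) K t ∨
        ChainFrom (dyadicPoints T) (fun t => X t ω) (2 * (1 / (j + 1 : ℝ))) K t) := by
    intro j
    have hj : (0 : ℝ) < 1 / (j + 1 : ℝ) := by positivity
    rw [ae_iff]
    push Not
    set S : Set Ω := {ω | ∀ K, ∃ t,
      (ChainTo (dyadicPoints T) (fun t => X t ω) (2 * (1 / (j + 1 : ℝ))) K t ∨
        ChainFrom (dyadicPoints T) (fun t => X t ω) (2 * (1 / (j + 1 : ℝ))) K t)} with hS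
    set c := (∫ ω, X T ω ^ 2 ∂P) / (1 / (j + 1 : ℝ)) ^ 2
    have hle : ∀ K : ℕ, P S ≤ ENNReal.ofReal (c / (K + 1)) := fun K =>
      (measure_mono fun ω (hω : ω ∈ S) => hω (K + 1)).trans (measure_chain_le hX hj K)
    have hlim : Tendsto (fun K : ℕ => ENNReal.ofReal (c / (K + 1))) atTop (𝓝 0) := by
      rw [← ENNReal.ofReal_zero]
      refine ENNReal.tendsto_ofReal ?_
      have := (tendsto_one_div_add_atTop_nhds_zero_nat (𝕜 := ℝ)).const_mul c
      simpa [div_eq_mul_inv] using this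
    exact le_antisymm (ge_of_tendsto' hlim hle) zero_le
  filter_upwards [ae_all_iff.2 key] with ω hω ε hε
  obtain ⟨j, hj⟩ := exists_nat_one_div_lt (half_pos hε)
  obtain ⟨K, hK⟩ := hω j
  have hle : 2 * (1 / (j + 1 : ℝ)) ≤ ε := by linarith
  have hto : ∀ K t, ChainTo (dyadicPoints T) (fun t => X t ω) ε K t →
      ChainTo (dyadicPoints T) (fun t => X t ω) (2 * (1 / (j + 1 : ℝ))) K t := by
    intro K
    induction K with
    | zero => exact fun t h => h
    | succ K ih => exact fun t ⟨h, s, hs, hc, ho⟩ => ⟨h, s, hs, ih s hc, hle.trans ho⟩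
  have hfrom : ∀ K t, ChainFrom (dyadicPoints T) (fun t => X t ω) ε K t →
      ChainFrom (dyadicPoints T) (fun t => X t ω) (2 * (1 / (j + 1 : ℝ))) K t := by
    intro K
    induction K with
    | zero => exact fun t h => h
    | succ K ih => exact fun t ⟨h, s, hs, hc, ho⟩ => ⟨h, s, hs, ih s hc, hle.trans ho⟩
  exact ⟨K, fun t ht => hK t (ht.imp (hto K t) (hfrom K t))⟩

/-- This is where completeness of the filtration acts: modifications on null sets remain adapted. -/
lemma stronglyMeasurable_of_ae_eq [SecondCountableTopology G] {m : MeasurableSpace Ω}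
    (hnull : ∀ s, P s = 0 → MeasurableSet[m] s) {f g : Ω → G} (hf : StronglyMeasurable[m] f)
    (h : g =ᵐ[P] f) : StronglyMeasurable[m] g := by
  borelize G
  suffices h' : Measurable[m] g from h'.stronglyMeasurable
  intro B hB
  set N : Set Ω := {ω | g ω ≠ f ω}
  have hN : P N = 0 := h
  have h1 : g ⁻¹' B = (f ⁻¹' B \ N) ∪ (g ⁻¹' B ∩ N) := by
    ext ω
    by_cases hω : g ω = f ω <;> simp [N, hω]
  rw [h1]
  exact ((hf.measurable hB).diff (hnull N hN)).union
    (hnull _ (measure_mono_null Set.inter_subset_right hN))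

/-- A square integrable real martingale that is right-continuous in `L²` has a càdlàg version. -/
theorem IsL2Martingale.exists_cadlag_version [IsFiniteMeasure P] {X : ℝ≥0 → Ω → ℝ}
    (hX : IsL2Martingale P ℱ T X) (hnull : ∀ s, P s = 0 → MeasurableSet[ℱ 0] s)
    (hrc : ∀ t < T, Tendsto (fun s => ∫⁻ ω, ‖X s ω - X t ω‖ₑ ^ 2 ∂P) (𝓝[>] t) (𝓝 0)) :
    ∃ Y, IsSqMartingale P ℱ T Y ∧ ∀ t ≤ T, Y t =ᵐ[P] X t := by
  set D := dyadicPoints T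
  set Y : ℝ≥0 → Ω → ℝ := fun t ω => regularize D T (fun t => X t ω) t
  have hgood := ae_forall_not_chain hX
  have hne : ∀ t < T, (𝓝[D ∩ Set.Ioi t] t).NeBot := by
    intro t ht
    rw [Set.inter_comm, nhdsWithin_inter',
      (nhdsGT_basis_of_exists_gt ⟨T, ht⟩).inf_principal_neBot_iff]
    intro b hb
    obtain ⟨d, hd, h1, h2⟩ := exists_dyadicPoints_between T (lt_min hb ht) (min_le_right b T)
    exact ⟨d, ⟨h1, h2.trans_le (min_le_left _ _)⟩, hd⟩
  have hYX : ∀ t ≤ T, Y t =ᵐ[P] X t := by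
    intro t ht
    rcases ht.eq_or_lt with rfl | ht'
    · exact ae_of_all _ fun ω => by simp [Y, regularize]
    have := hne t ht'
    obtain ⟨d, hd⟩ := exists_seq_tendsto (𝓝[D ∩ Set.Ioi t] t)
    have hd' : Tendsto d atTop (𝓝[D ∩ Set.Ioi t] t) := hd
    have hdD : ∀ᶠ n in atTop, d n ∈ D ∩ Set.Ioi t := hd.eventually self_mem_nhdsWithin
    obtain ⟨N, hN⟩ := eventually_atTop.1 hdD
    have hmeas : ∀ n, AEStronglyMeasurable (X (d (n + N))) P := fun n =>
      (hX.memLp _ (dyadicPoints_subset T (hN (n + N) (Nat.le_add_left _ _)).1)).1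
    have hd2 := hd'.comp (tendsto_add_atTop_nat N)
    -- Along dyadic times tending to t from the right, X converges almost surely to Y t by
    -- construction and in L² to X t by hypothesis; limits in probability are unique. The shift by N
    -- keeps all times in the dyadic set.
    have hlim1 : TendstoInMeasure P (fun n => X (d (n + N))) atTop (Y t) := by
      refine tendstoInMeasure_of_tendsto_ae hmeas ?_
      filter_upwards [hgood] with ω hω
      have h1 := exists_right_limit (D := D) (x := fun t => X t ω)
        (fun ε hε => (hω ε hε).imp fun K hK t ht => hK t (Or.inr ht)) t
      simp only [Y, regularize, if_pos ht']
      exact (tendsto_nhds_limUnder h1).comp hd2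
    have hlim2 : TendstoInMeasure P (fun n => X (d (n + N))) atTop (X t) :=
      tendstoInMeasure_of_lintegral_sq hmeas (hX.memLp t ht).1
        ((hrc t ht').comp (hd2.mono_right (nhdsWithin_mono _ Set.inter_subset_right)))
    exact tendstoInMeasure_ae_unique hlim1 hlim2
  refine ⟨Y, ⟨fun t ht => ?_, fun t ht => (hX.memLp t ht).ae_eq (hYX t ht).symm,
    fun s t hst ht => ?_, ?_⟩, hYX⟩
  · exact stronglyMeasurable_of_ae_eq (fun s hs => ℱ.mono zero_le _ (hnull s hs))
      (hX.adapted t ht) (hYX t ht)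
  · exact ((condExp_congr_ae (hYX t ht)).trans (hX.condExp s t hst ht)).trans
      (hYX s (hst.trans ht)).symm
  · filter_upwards [hgood] with ω hω
    exact isCadlagOn_regularize (fun a b hab hb => exists_dyadicPoints_between T hab hb)
      (fun ε hε => (hω ε hε).imp fun K hK t ht => hK t (Or.inl ht))
      (fun ε hε => (hω ε hε).imp fun K hK t ht => hK t (Or.inr ht))

end Processes

/-! ### Càdlàg functions -/

section Cadlag

variable {G E : Type*} [NormedAddCommGroup G] [InnerProductSpace ℝ G]
  [NormedAddCommGroup E] [InnerProductSpace ℝ E] {T : ℝ≥0} {f g : ℝ≥0 → G}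

lemma isCadlagOn_const (c : G) : IsCadlagOn T fun _ => c :=
  fun _ _ => ⟨continuousWithinAt_const, c, tendsto_const_nhds⟩

lemma IsCadlagOn.clm (hf : IsCadlagOn T f) (L : G →L[ℝ] E) : IsCadlagOn T fun t => L (f t) :=
  fun t ht => ⟨L.continuous.continuousAt.comp_continuousWithinAt (hf t ht).1,
    (hf t ht).2.imp' L fun l hl => (L.continuous.tendsto l).comp hl⟩

lemma IsCadlagOn.add (hf : IsCadlagOn T f) (hg : IsCadlagOn T g) :
    IsCadlagOn T fun t => f t + g t := by
  refine fun t ht => ⟨(hf t ht).1.add (hg t ht).1, ?_⟩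
  obtain ⟨a, ha⟩ := (hf t ht).2
  obtain ⟨b, hb⟩ := (hg t ht).2
  exact ⟨a + b, ha.add hb⟩

lemma IsCadlagOn.of_uniform_limit [CompleteSpace G]
    (h : ∀ ε > 0, ∃ g : ℝ≥0 → G, IsCadlagOn T g ∧ ∀ t ≤ T, dist (f t) (g t) ≤ ε) :
    IsCadlagOn T f := by
  intro t ht
  constructor
  · refine Metric.continuousWithinAt_iff'.2 fun ε hε => ?_
    obtain ⟨g, hg, hfg⟩ := h (ε / 3) (by positivity)
    filter_upwards [Metric.continuousWithinAt_iff'.1 (hg t ht).1 (ε / 3) (by positivity),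
      self_mem_nhdsWithin] with s hs hs'
    have h1 := hfg s hs'.2
    have h2 := hfg t ht
    have h3 := dist_triangle4 (f s) (g s) (g t) (f t)
    rw [dist_comm (g t) (f t)] at h3
    linarith
  · rcases (𝓝[<] t).eq_or_neBot with h0 | h0
    · rw [h0]; exact ⟨0, tendsto_bot⟩
    refine cauchy_map_iff_exists_tendsto.1 (Metric.cauchy_iff.2 ⟨h0.map f, fun ε hε => ?_⟩)
    obtain ⟨g, hg, hfg⟩ := h (ε / 4) (by positivity)
    obtain ⟨l, hl⟩ := (hg t ht).2
    refine ⟨f '' {s | dist (g s) l < ε / 4 ∧ s < t}, image_mem_map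
      (inter_mem (Metric.tendsto_nhds.1 hl (ε / 4) (by positivity)) self_mem_nhdsWithin), ?_⟩
    rintro _ ⟨a, ha, rfl⟩ _ ⟨b, hb, rfl⟩
    have h1 := hfg a (ha.2.le.trans ht)
    have h2 := hfg b (hb.2.le.trans ht)
    have h3 := dist_triangle4 (f a) (g a) (g b) (f b)
    have h4 := dist_triangle_right (g a) (g b) l
    rw [dist_comm (g b) (f b)] at h3
    linarith [ha.1, hb.1]

/-- By right continuity the dyadic times suffice. The maximal function thereby becomes measurable,
and discrete Doob passes to continuous time by monotone convergence over the grids. -/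
lemma IsCadlagOn.iSup_eq (hf : IsCadlagOn T f) :
    ⨆ t : Set.Iic T, ‖f t‖ₑ ^ 2 = ⨆ m, ⨆ k : Set.Iic (gridLen T m), ‖f (grid T m k)‖ₑ ^ 2 := by
  refine le_antisymm (iSup_le ?_) (iSup_le fun m => iSup_le fun k => ?_)
  · rintro ⟨t, ht⟩
    have hle : ∀ d ∈ dyadicPoints T,
        ‖f d‖ₑ ^ 2 ≤ ⨆ m, ⨆ k : Set.Iic (gridLen T m), ‖f (grid T m k)‖ₑ ^ 2 := by
      intro d hd
      obtain ⟨m, k, hk, rfl⟩ := Set.mem_iUnion.1 hd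
      exact le_iSup_of_le m (le_iSup (fun k : Set.Iic (gridLen T m) => ‖f (grid T m k)‖ₑ ^ 2)
        ⟨k, hk⟩)
    rcases (Set.mem_Iic.1 ht).eq_or_lt with rfl | ht'
    · exact hle _ (by simpa [grid_gridLen] using grid_mem_dyadicPoints t 0 (gridLen t 0))
    have hne : (𝓝[dyadicPoints T ∩ Set.Ioi t] t).NeBot := by
      rw [Set.inter_comm, nhdsWithin_inter',
        (nhdsGT_basis_of_exists_gt ⟨T, ht'⟩).inf_principal_neBot_iff]
      intro b hb
      obtain ⟨d, hd, h1, h2⟩ := exists_dyadicPoints_between T (lt_min hb ht') (min_le_right b T)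
      exact ⟨d, ⟨h1, h2.trans_le (min_le_left _ _)⟩, hd⟩
    have hc : Tendsto f (𝓝[dyadicPoints T ∩ Set.Ioi t] t) (𝓝 (f t)) :=
      (hf t ht).1.mono fun d hd => ⟨le_of_lt hd.2, dyadicPoints_subset T hd.1⟩
    refine le_of_tendsto ((ENNReal.continuous_pow 2).continuousAt.tendsto.comp hc.enorm) ?_
    filter_upwards [self_mem_nhdsWithin] with d hd
    exact hle d hd.1
  · exact le_iSup (fun t : Set.Iic T => ‖f t‖ₑ ^ 2) ⟨grid T m k, grid_le T m k⟩

end Cadlag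

/-! ### Hilbert bases -/

section HilbertBases

variable {G : Type*} [NormedAddCommGroup G] [InnerProductSpace ℝ G]

/-- Distinct basis vectors are √2 apart, so balls of radius 1/2 around them are disjoint, open and
nonempty. -/
lemma HilbertBasis.countable_of_separable [TopologicalSpace.SeparableSpace G] {ι : Type*}
    (b : HilbertBasis ι ℝ G) : Countable ι := by
  have hd : Pairwise (Function.onFun Disjoint fun i => Metric.ball (b i) (1 / 2)) := by
    intro i j hij
    refine Metric.ball_disjoint_ball ?_
    have h1 : ‖b i - b j‖ ^ 2 = 2 := by
      rw [norm_sub_sq_real, b.orthonormal.1 i, b.orthonormal.1 j, b.orthonormal.2 hij]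
      norm_num
    rw [dist_eq_norm]
    nlinarith [norm_nonneg (b i - b j)]
  have := (Set.pairwiseDisjoint_iff.2 fun i _ j _ h => by
    by_contra hij
    exact h.ne_empty (Set.disjoint_iff_inter_eq_empty.1 (hd hij)) :
    Set.univ.PairwiseDisjoint fun i => Metric.ball (b i) (1 / 2)).countable_of_isOpen
      (fun i _ => Metric.isOpen_ball) (fun i _ => ⟨b i, Metric.mem_ball_self (by norm_num)⟩)
  exact Set.countable_univ_iff.1 this

/-- Parseval in `ℝ≥0∞`, where sums can be exchanged with each other and with integrals without
summability conditions. -/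
lemma HilbertBasis.tsum_enorm_inner_sq {ι : Type*} (b : HilbertBasis ι ℝ G) (x : G) :
    ∑' i, ‖⟪b i, x⟫_ℝ‖ₑ ^ 2 = ‖x‖ₑ ^ 2 := by
  have hsq : ∀ y : ℝ, ‖y‖ₑ ^ 2 = ENNReal.ofReal (y ^ 2) := fun y => by
    rw [← ofReal_norm, ← ENNReal.ofReal_pow (norm_nonneg _), Real.norm_eq_abs, sq_abs]
  have h := b.hasSum_inner_mul_inner x x
  have h1 : ∀ i, ⟪x, b i⟫_ℝ * ⟪b i, x⟫_ℝ = ⟪b i, x⟫_ℝ ^ 2 := fun i => by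
    rw [real_inner_comm, sq]
  simp only [h1] at h
  rw [← ofReal_norm, ← ENNReal.ofReal_pow (norm_nonneg _), ← real_inner_self_eq_norm_sq,
    ← h.tsum_eq, ENNReal.ofReal_tsum_of_nonneg (fun i => sq_nonneg _) h.summable]
  simp only [hsq]

end HilbertBases

/-! ### The space of square integrable càdlàg martingales -/

section Processes

variable {Ω : Type*} {mΩ : MeasurableSpace Ω} {P : Measure Ω} {ℱ : Filtration ℝ≥0 mΩ} {T : ℝ≥0}
  {G E : Type*} [NormedAddCommGroup G] [InnerProductSpace ℝ G] [CompleteSpace G]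
  [NormedAddCommGroup E] [InnerProductSpace ℝ E] [CompleteSpace E] {X Y : ℝ≥0 → Ω → G}

lemma isSqMartingale_zero : IsSqMartingale P ℱ T (fun _ _ => (0 : G)) where
  adapted _ _ := stronglyMeasurable_const
  memLp _ _ := MemLp.zero
  condExp s t _ _ := by
    have := condExp_zero (m := ℱ s) (μ := P) (E := G)
    exact Eq.eventuallyEq this
  cadlag := ae_of_all _ fun _ => isCadlagOn_const 0

lemma IsSqMartingale.add [IsFiniteMeasure P] (hX : IsSqMartingale P ℱ T X)
    (hY : IsSqMartingale P ℱ T Y) : IsSqMartingale P ℱ T (fun t ω => X t ω + Y t ω) where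
  adapted t ht := (hX.adapted t ht).add (hY.adapted t ht)
  memLp t ht := (hX.memLp t ht).add (hY.memLp t ht)
  condExp s t hst ht := by
    refine (condExp_add ((hX.memLp t ht).integrable one_le_two)
      ((hY.memLp t ht).integrable one_le_two) (ℱ s)).trans ?_
    exact (hX.condExp s t hst ht).add (hY.condExp s t hst ht)
  cadlag := by
    filter_upwards [hX.cadlag, hY.cadlag] with ω h1 h2 using h1.add h2

lemma IsSqMartingale.clm [IsFiniteMeasure P] (hX : IsSqMartingale P ℱ T X) (L : G →L[ℝ] E) :
    IsSqMartingale P ℱ T (fun t ω => L (X t ω)) where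
  adapted t ht := L.continuous.comp_stronglyMeasurable (hX.adapted t ht)
  memLp t ht := L.comp_memLp' (hX.memLp t ht)
  condExp s t hst ht := by
    refine (L.comp_condExp_comm ((hX.memLp t ht).integrable one_le_two)).symm.trans ?_
    filter_upwards [hX.condExp s t hst ht] with ω hω
    simp [hω]
  cadlag := by filter_upwards [hX.cadlag] with ω h using h.clm L

lemma IsSqMartingale.neg [IsFiniteMeasure P] (hX : IsSqMartingale P ℱ T X) :
    IsSqMartingale P ℱ T (fun t ω => -X t ω) := hX.clm (-ContinuousLinearMap.id ℝ G)

lemma IsSqMartingale.sub [IsFiniteMeasure P] (hX : IsSqMartingale P ℱ T X)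
    (hY : IsSqMartingale P ℱ T Y) : IsSqMartingale P ℱ T (fun t ω => X t ω - Y t ω) := by
  simpa only [sub_eq_add_neg] using hX.add hY.neg

lemma isSqMartingale_sum [IsFiniteMeasure P] {ι : Type*} (s : Finset ι) {X : ι → ℝ≥0 → Ω → G}
    (hX : ∀ i ∈ s, IsSqMartingale P ℱ T (X i)) :
    IsSqMartingale P ℱ T (fun t ω => ∑ i ∈ s, X i t ω) := by
  classical
  induction s using Finset.induction_on with
  | empty => simpa using isSqMartingale_zero
  | insert a s ha ih =>
    simp only [Finset.sum_insert ha]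
    exact (hX a (Finset.mem_insert_self _ _)).add
      (ih fun i hi => hX i (Finset.mem_insert_of_mem hi))

lemma IsSqMartingale.congr_of_le (hX : IsSqMartingale P ℱ T X)
    (h : ∀ t ≤ T, ∀ ω, Y t ω = X t ω) : IsSqMartingale P ℱ T Y := by
  have h' : ∀ t ≤ T, Y t = X t := fun t ht => funext (h t ht)
  refine ⟨fun t ht => h' t ht ▸ hX.adapted t ht, fun t ht => h' t ht ▸ hX.memLp t ht,
    fun s t hst ht => h' t ht ▸ h' s (hst.trans ht) ▸ hX.condExp s t hst ht, ?_⟩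
  filter_upwards [hX.cadlag] with ω hω
  intro t ht
  refine ⟨(hω t ht).1.congr (fun s hs => h s hs.2 ω) (h t ht ω), ?_⟩
  obtain ⟨l, hl⟩ := (hω t ht).2
  refine ⟨l, hl.congr' ?_⟩
  filter_upwards [self_mem_nhdsWithin] with s hs
  exact (h s ((le_of_lt hs).trans ht) ω).symm

/-- After time s the event F is known and factors out of conditional expectations; before s the
process is null, so 1_F X is adapted there by completeness although F is not yet known. -/
lemma IsSqMartingale.indicator [IsFiniteMeasure P] [SecondCountableTopology G]
    (hnull : ∀ s, P s = 0 → MeasurableSet[ℱ 0] s) (hX : IsSqMartingale P ℱ T X) {s : ℝ≥0}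
    {F : Set Ω} (hF : MeasurableSet[ℱ s] F) (h0 : ∀ r ≤ T, r ≤ s → X r =ᵐ[P] 0) :
    IsSqMartingale P ℱ T (fun t => F.indicator (X t)) := by
  have hz : ∀ r ≤ T, r ≤ s → F.indicator (X r) =ᵐ[P] 0 := fun r hr hrs => by
    filter_upwards [h0 r hr hrs] with ω hω
    simp [hω]
  have hF' : MeasurableSet F := ℱ.le s F hF
  refine ⟨fun t ht => ?_, fun t ht => (hX.memLp t ht).indicator hF', fun a b hab hb => ?_, ?_⟩
  · rcases le_total s t with h | h
    · exact (hX.adapted t ht).indicator (ℱ.mono h F hF)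
    · exact stronglyMeasurable_of_ae_eq (fun A hA => ℱ.mono zero_le _ (hnull A hA))
        stronglyMeasurable_zero (hz t ht h)
  · have hint := (hX.memLp b hb).integrable one_le_two
    rcases le_total s a with h | h
    · refine (condExp_indicator hint (ℱ.mono h F hF)).trans ?_
      filter_upwards [hX.condExp a b hab hb] with ω hω
      by_cases hF : ω ∈ F
      · rw [Set.indicator_of_mem hF, Set.indicator_of_mem hF, hω]
      · rw [Set.indicator_of_notMem hF, Set.indicator_of_notMem hF]
    · refine EventuallyEq.trans ?_ (hz a (hab.trans hb) h).symm
      have hcz : P[(0 : Ω → G)|ℱ a] =ᵐ[P] 0 := Eq.eventuallyEq condExp_zero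
      rcases le_total b s with h' | h'
      · exact (condExp_congr_ae (hz b hb h')).trans hcz
      -- For a ≤ s ≤ b, condition first on `ℱ s`: there F factors out and leaves 1_F X_s = 0.
      · refine (condExp_condExp_of_le (ℱ.mono h) (ℱ.le s)).symm.trans ?_
        refine (condExp_congr_ae ?_).trans hcz
        refine (condExp_indicator hint hF).trans ?_
        filter_upwards [hX.condExp s b h' hb, hz s (h'.trans hb) le_rfl] with ω h1 h2
        simpa [Set.indicator_apply, h1] using h2
  · filter_upwards [hX.cadlag] with ω hω
    by_cases h : ω ∈ F
    · simp only [Set.indicator_of_mem h]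
      exact hω
    · simpa only [Set.indicator_of_notMem h] using isCadlagOn_const (0 : G)

lemma IsSqMartingale.aemeasurable_iSup (hX : IsSqMartingale P ℱ T X) :
    AEMeasurable (fun ω => ⨆ t : Set.Iic T, ‖X t ω‖ₑ ^ 2) P := by
  have h : (fun ω => ⨆ t : Set.Iic T, ‖X t ω‖ₑ ^ 2) =ᵐ[P]
      fun ω => ⨆ m, ⨆ k : Set.Iic (gridLen T m), ‖X (grid T m k) ω‖ₑ ^ 2 := by
    filter_upwards [hX.cadlag] with ω hω using hω.iSup_eq
  refine AEMeasurable.congr ?_ h.symm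
  exact AEMeasurable.iSup fun m => AEMeasurable.iSup fun k =>
    ((hX.memLp _ (grid_le T m k)).1.enorm.pow_const 2)

lemma martNormSq_real_le [IsFiniteMeasure P] {X : ℝ≥0 → Ω → ℝ} (hX : IsSqMartingale P ℱ T X) :
    martNormSq P T X ≤ 8 * ∫⁻ ω, ‖X T ω‖ₑ ^ 2 ∂P := by
  have h : martNormSq P T X =
      ∫⁻ ω, ⨆ m, ⨆ k : Set.Iic (gridLen T m), ‖X (grid T m k) ω‖ₑ ^ 2 ∂P := by
    refine lintegral_congr_ae ?_
    filter_upwards [hX.cadlag] with ω hω using hω.iSup_eq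
  rw [h, lintegral_iSup' (f := fun m ω => ⨆ k : Set.Iic (gridLen T m), ‖X (grid T m k) ω‖ₑ ^ 2)
    (fun m => AEMeasurable.iSup fun k => ((hX.memLp _ (grid_le T m k)).1.enorm.pow_const 2))]
  · refine iSup_le fun m => ?_
    have h1 := lintegral_iSup_sq_le (hX.isL2Martingale.martingale_grid m)
      (fun k => hX.memLp _ (grid_le T m k)) (gridLen T m)
    rwa [grid_gridLen] at h1
  · refine ae_of_all _ fun ω m m' hm => iSup_le fun k => ?_
    obtain ⟨k', hk', h2⟩ := gridSet_mono T hm ⟨k, k.2, rfl⟩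
    rw [← h2]
    exact le_iSup (fun k : Set.Iic (gridLen T m') => ‖X (grid T m' k) ω‖ₑ ^ 2) ⟨k', hk'⟩

/-- Doob's maximal inequality for Hilbert space valued martingales. -/
theorem IsSqMartingale.martNormSq_le [IsFiniteMeasure P] [TopologicalSpace.SeparableSpace G]
    (hX : IsSqMartingale P ℱ T X) : martNormSq P T X ≤ 8 * ∫⁻ ω, ‖X T ω‖ₑ ^ 2 ∂P := by
  obtain ⟨w, b, -⟩ := exists_hilbertBasis ℝ G
  have : Countable w := HilbertBasis.countable_of_separable b
  have hb : ∀ i, IsSqMartingale P ℱ T fun t ω => ⟪b i, X t ω⟫_ℝ := fun i =>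
    hX.clm (innerSL ℝ (b i))
  -- Parseval, and the bound of a supremum of sums by the sum of suprema, reduce to real
  -- coordinates; summing Doob's inequality back by Parseval keeps the constant free of the
  -- dimension.
  calc martNormSq P T X
      ≤ ∫⁻ ω, ∑' i, ⨆ t : Set.Iic T, ‖⟪b i, X t ω⟫_ℝ‖ₑ ^ 2 ∂P := by
        refine lintegral_mono fun ω => iSup_le fun t => ?_
        rw [← HilbertBasis.tsum_enorm_inner_sq b]
        exact ENNReal.tsum_le_tsum fun i =>
          le_iSup (fun t : Set.Iic T => ‖⟪b i, X t ω⟫_ℝ‖ₑ ^ 2) t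
    _ = ∑' i, ∫⁻ ω, ⨆ t : Set.Iic T, ‖⟪b i, X t ω⟫_ℝ‖ₑ ^ 2 ∂P :=
        lintegral_tsum fun i => (hb i).aemeasurable_iSup
    _ ≤ ∑' i, 8 * ∫⁻ ω, ‖⟪b i, X T ω⟫_ℝ‖ₑ ^ 2 ∂P :=
        ENNReal.tsum_le_tsum fun i => martNormSq_real_le (hb i)
    _ = 8 * ∫⁻ ω, ‖X T ω‖ₑ ^ 2 ∂P := by
        rw [ENNReal.tsum_mul_left, ← lintegral_tsum fun i =>
          ((hb i).memLp T le_rfl).1.enorm.pow_const 2]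
        simp only [HilbertBasis.tsum_enorm_inner_sq b]

lemma enorm_sub_sq_le (x y z : G) : ‖x - z‖ₑ ^ 2 ≤ 2 * ‖x - y‖ₑ ^ 2 + 2 * ‖y - z‖ₑ ^ 2 := by
  have h : ‖x - z‖ₑ ≤ ‖x - y‖ₑ + ‖y - z‖ₑ := by
    rw [← sub_add_sub_cancel x y z]; exact enorm_add_le _ _
  calc ‖x - z‖ₑ ^ 2 ≤ (‖x - y‖ₑ + ‖y - z‖ₑ) ^ 2 := by gcongr
    _ ≤ 2 * (‖x - y‖ₑ ^ 2 + ‖y - z‖ₑ ^ 2) := by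
        have := ENNReal.rpow_add_le_mul_rpow_add_rpow ‖x - y‖ₑ ‖y - z‖ₑ one_le_two
        norm_num at this
        exact this
    _ = _ := mul_add _ _ _

/-- Regularity is required of X − Y only: the lower integral of a sum splits once one summand is
measurable. -/
lemma martNormSq_sub_le {X Y Z : ℝ≥0 → Ω → G}
    (hXY : IsSqMartingale P ℱ T fun t ω => X t ω - Y t ω) :
    martNormSq P T (fun t ω => X t ω - Z t ω) ≤
      2 * martNormSq P T (fun t ω => X t ω - Y t ω) +
      2 * martNormSq P T (fun t ω => Y t ω - Z t ω) := by
  unfold martNormSq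
  rw [← lintegral_const_mul' _ _ ENNReal.ofNat_ne_top,
    ← lintegral_const_mul' _ _ ENNReal.ofNat_ne_top,
    ← lintegral_add_left' (hXY.aemeasurable_iSup.const_mul 2)]
  refine lintegral_mono fun ω => iSup_le fun t => ?_
  refine (enorm_sub_sq_le _ (Y t ω) _).trans ?_
  gcongr
  · exact le_iSup (fun t : Set.Iic T => ‖X t ω - Y t ω‖ₑ ^ 2) t
  · exact le_iSup (fun t : Set.Iic T => ‖Y t ω - Z t ω‖ₑ ^ 2) t

lemma martNormSq_sub_comm (X Y : ℝ≥0 → Ω → G) :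
    martNormSq P T (fun t ω => X t ω - Y t ω) = martNormSq P T (fun t ω => Y t ω - X t ω) := by
  simp only [martNormSq, enorm_sub_rev]

lemma lintegral_le_martNormSq (X : ℝ≥0 → Ω → G) {t : ℝ≥0} (ht : t ≤ T) :
    ∫⁻ ω, ‖X t ω‖ₑ ^ 2 ∂P ≤ martNormSq P T X :=
  lintegral_mono fun ω => le_iSup (fun t : Set.Iic T => ‖X t ω‖ₑ ^ 2) ⟨t, ht⟩

lemma IsSqMartingale.ae_eq_zero (hX : IsSqMartingale P ℱ T X) (h : martNormSq P T X = 0) :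
    ∀ᵐ ω ∂P, ∀ t ≤ T, X t ω = 0 := by
  filter_upwards [(lintegral_eq_zero_iff' hX.aemeasurable_iSup).1 h] with ω hω t ht
  have h1 := (le_iSup (fun t : Set.Iic T => ‖X t ω‖ₑ ^ 2) ⟨t, ht⟩).trans_eq hω
  simpa using h1

end Processes

/-! ### Limits of square integrable càdlàg martingales -/

section Completeness

variable {Ω : Type*} {mΩ : MeasurableSpace Ω} {P : Measure Ω} {ℱ : Filtration ℝ≥0 mΩ} {T : ℝ≥0}
  {G : Type*} [NormedAddCommGroup G] [InnerProductSpace ℝ G] [CompleteSpace G]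

/-- Conditional expectations are characterised by integrals over sets of `ℱ s`; these are continuous
in L¹, and L² convergence implies L¹ convergence under a probability measure. -/
lemma condExp_of_tendsto_L2 [IsProbabilityMeasure P] {s : ℝ≥0} {f g : ℕ → Ω → G} {f' g' : Ω → G}
    (hf : ∀ n, MemLp (f n) 2 P) (hg : ∀ n, MemLp (g n) 2 P) (hf' : MemLp f' 2 P)
    (hg' : MemLp g' 2 P) (hgm : StronglyMeasurable[ℱ s] g') (h : ∀ n, P[f n|ℱ s] =ᵐ[P] g n)
    (hft : Tendsto (fun n => ∫⁻ ω, ‖f n ω - f' ω‖ₑ ^ 2 ∂P) atTop (𝓝 0))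
    (hgt : Tendsto (fun n => ∫⁻ ω, ‖g n ω - g' ω‖ₑ ^ 2 ∂P) atTop (𝓝 0)) :
    P[f'|ℱ s] =ᵐ[P] g' := by
  have hL1 : ∀ {f : ℕ → Ω → G} {f' : Ω → G}, (∀ n, MemLp (f n) 2 P) → MemLp f' 2 P →
      Tendsto (fun n => ∫⁻ ω, ‖f n ω - f' ω‖ₑ ^ 2 ∂P) atTop (𝓝 0) →
      Tendsto (fun n => eLpNorm (f n - f') 1 P) atTop (𝓝 0) := by
    intro f f' hf hf' h
    have h2 : ∀ n, (∫⁻ ω, ‖f n ω - f' ω‖ₑ ^ 2 ∂P) ^ (1 / 2 : ℝ) = eLpNorm (f n - f') 2 P := by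
      intro n
      have := lintegral_enorm_sq_eq (P := P) (f := f n - f')
      simp only [Pi.sub_apply] at this
      rw [this, ← ENNReal.rpow_natCast, ← ENNReal.rpow_mul]
      norm_num
    have h3 := h.ennrpow_const (1 / 2 : ℝ)
    simp only [h2] at h3
    rw [ENNReal.zero_rpow_of_pos (by norm_num)] at h3
    exact tendsto_of_tendsto_of_tendsto_of_le_of_le tendsto_const_nhds h3 (fun _ => zero_le)
      fun n => eLpNorm_le_eLpNorm_of_exponent_le one_le_two ((hf n).sub hf').1
  refine (ae_eq_condExp_of_forall_setIntegral_eq (ℱ.le s) (hf'.integrable one_le_two)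
    (fun A _ _ => (hg'.integrable one_le_two).integrableOn) (fun A hA _ => ?_)
    hgm.aestronglyMeasurable).symm
  have h1 := tendsto_setIntegral_of_L1' f' hf'.1
    (Eventually.of_forall fun n => (hf n).integrable one_le_two) (hL1 hf hf' hft) A
  have h2 := tendsto_setIntegral_of_L1' g' hg'.1
    (Eventually.of_forall fun n => (hg n).integrable one_le_two) (hL1 hg hg' hgt) A
  refine tendsto_nhds_unique h2 (h1.congr fun n => ?_)
  rw [← setIntegral_condExp (ℱ.le s) ((hf n).integrable one_le_two) hA]
  exact setIntegral_congr_ae (ℱ.le s _ hA) ((h n).mono fun ω hω _ => hω)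

/-- A fast Cauchy sequence of martingales converges uniformly, almost surely. -/
lemma ae_exists_uniform_bound {X : ℕ → ℝ≥0 → Ω → G} (hX : ∀ n, IsSqMartingale P ℱ T (X n))
    [IsFiniteMeasure P]
    (h : ∀ k, martNormSq P T (fun t ω => X k t ω - X (k + 1) t ω) ≤ (8⁻¹ : ℝ≥0∞) ^ k) :
    ∀ᵐ ω ∂P, ∃ C : ℝ, ∀ t ≤ T, ∀ k, dist (X k t ω) (X (k + 1) t ω) ≤ C * (1 / 2) ^ k := by
  set A : ℕ → Ω → ℝ≥0∞ := fun k ω => ⨆ t : Set.Iic T, ‖X k t ω - X (k + 1) t ω‖ₑ ^ 2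
  have hA : ∀ k, AEMeasurable (A k) P := fun k => ((hX k).sub (hX (k + 1))).aemeasurable_iSup
  -- The weight 4^k leaves the convergent series ∑ 4^k 8^(-k) = ∑ 2^(-k), and where the weighted sum
  -- B is finite its square root bounds the k-th increment by √B · 2^(-k).
  have h1 : ∫⁻ ω, ∑' k, 4 ^ k * A k ω ∂P ≠ ∞ := by
    rw [lintegral_tsum fun k => (hA k).const_mul _]
    refine ne_top_of_le_ne_top (b := ∑' k : ℕ, (2⁻¹ : ℝ≥0∞) ^ k) ?_
      (ENNReal.tsum_le_tsum fun k => ?_)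
    · rw [ENNReal.tsum_geometric, ENNReal.one_sub_inv_two]
      simp
    · rw [lintegral_const_mul' _ _ (by simp)]
      calc (4 : ℝ≥0∞) ^ k * ∫⁻ ω, A k ω ∂P ≤ 4 ^ k * 8⁻¹ ^ k := by
            gcongr
            exact h k
        _ = 2⁻¹ ^ k := by
            rw [← mul_pow]
            congr 1
            rw [show (8 : ℝ≥0∞) = 4 * 2 by norm_num,
              ENNReal.mul_inv (Or.inl (by norm_num)) (Or.inl (by norm_num)), ← mul_assoc,
              ENNReal.mul_inv_cancel (by norm_num) (by norm_num), one_mul]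
  filter_upwards [ae_lt_top' (AEMeasurable.tsum fun k => (hA k).const_mul _) h1] with ω hω
  set B : ℝ≥0∞ := ∑' k, 4 ^ k * A k ω
  refine ⟨√B.toReal, fun t ht k => ?_⟩
  have h2 : (4 : ℝ≥0∞) ^ k * ‖X k t ω - X (k + 1) t ω‖ₑ ^ 2 ≤ B :=
    le_trans (by gcongr; exact le_iSup (fun t : Set.Iic T => ‖X k t ω - X (k + 1) t ω‖ₑ ^ 2) ⟨t, ht⟩)
      (ENNReal.le_tsum k)
  have h3 := ENNReal.toReal_mono hω.ne h2
  rw [ENNReal.toReal_mul, ENNReal.toReal_pow, ENNReal.toReal_pow, toReal_enorm] at h3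
  simp only [ENNReal.toReal_ofNat] at h3
  rw [dist_eq_norm]
  have h4 : (2 ^ k * ‖X k t ω - X (k + 1) t ω‖) ^ 2 ≤ B.toReal := by
    rw [mul_pow, ← pow_mul, mul_comm k 2, pow_mul]
    norm_num
    exact h3
  have h5 := Real.le_sqrt_of_sq_le h4
  rw [one_div, inv_pow, ← div_eq_mul_inv, le_div_iff₀ (by positivity)]
  linarith

/-- The space of square integrable càdlàg martingales is complete. -/
theorem exists_limit_of_cauchy [IsProbabilityMeasure P] [SecondCountableTopology G]
    (hnull : ∀ s, P s = 0 → MeasurableSet[ℱ 0] s) {X : ℕ → ℝ≥0 → Ω → G}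
    (hX : ∀ n, IsSqMartingale P ℱ T (X n))
    (hC : ∀ ε > 0, ∃ N, ∀ m ≥ N, ∀ n ≥ N,
      martNormSq P T (fun t ω => X m t ω - X n t ω) ≤ ε) :
    ∃ I, IsSqMartingale P ℱ T I ∧
      Tendsto (fun n => martNormSq P T (fun t ω => X n t ω - I t ω)) atTop (𝓝 0) := by
  obtain ⟨φ, hφ, hφ'⟩ := extraction_forall_of_eventually'
    (P := fun k N => ∀ m ≥ N, ∀ n ≥ N,
      martNormSq P T (fun t ω => X m t ω - X n t ω) ≤ (8⁻¹ : ℝ≥0∞) ^ k)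
    (fun k => by
      obtain ⟨N, hN⟩ := hC (8⁻¹ ^ k) (ENNReal.pow_pos (by simp) k)
      exact ⟨N, fun K hK m hm n hn => hN m (hK.trans hm) n (hK.trans hn)⟩)
  have hub := ae_exists_uniform_bound (fun k => hX (φ k))
    fun k => hφ' k _ le_rfl _ (hφ.monotone k.le_succ)
  -- The good set lies in `ℱ 0`, its complement being null. Putting the processes to 0 off S makes
  -- the limit exist for every ω, so the limit is adapted.
  set S : Set Ω := {ω | ∃ C : ℝ, ∀ t ≤ T, ∀ k,
    dist (X (φ k) t ω) (X (φ (k + 1)) t ω) ≤ C * (1 / 2) ^ k}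
  have hS : MeasurableSet[ℱ 0] S := by
    have := (hnull Sᶜ hub).compl
    rwa [compl_compl] at this
  set I : ℝ≥0 → Ω → G := fun t ω => limUnder atTop fun k => S.indicator (X (φ k) t) ω
  have hlim : ∀ t ≤ T, ∀ ω, Tendsto (fun k => S.indicator (X (φ k) t) ω) atTop (𝓝 (I t ω)) := by
    intro t ht ω
    refine tendsto_nhds_limUnder ?_
    by_cases hω : ω ∈ S
    · obtain ⟨C, hC⟩ := hω
      have hω : ω ∈ S := ⟨C, hC⟩
      simp only [Set.indicator_of_mem hω]
      exact cauchySeq_tendsto_of_complete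
        (cauchySeq_of_le_geometric (1 / 2) C (by norm_num) (hC t ht))
    · simp only [Set.indicator_of_notMem hω]
      exact ⟨0, tendsto_const_nhds⟩
  have hlim' : ∀ ω ∈ S, ∀ t ≤ T, Tendsto (fun k => X (φ k) t ω) atTop (𝓝 (I t ω)) := by
    intro ω hω t ht
    simpa only [Set.indicator_of_mem hω] using hlim t ht ω
  have hcad : ∀ᵐ ω ∂P, IsCadlagOn T fun t => I t ω := by
    filter_upwards [hub, ae_all_iff.2 fun n => (hX n).cadlag] with ω hω hc
    refine IsCadlagOn.of_uniform_limit fun ε hε => ?_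
    have hωS : ω ∈ S := hω
    obtain ⟨C, hC⟩ := hω
    have ht0 : Tendsto (fun k : ℕ => C * (1 / 2) ^ k / (1 - 1 / 2)) atTop (𝓝 0) := by
      have := ((tendsto_pow_atTop_nhds_zero_of_lt_one (r := (1 / 2 : ℝ)) (by norm_num)
        (by norm_num)).const_mul C).div_const (1 - 1 / 2)
      simpa using this
    obtain ⟨k, hk⟩ := (ht0.eventually (gt_mem_nhds hε)).exists
    refine ⟨fun t => X (φ k) t ω, hc (φ k), fun t ht => ?_⟩
    rw [dist_comm]
    exact (dist_le_of_le_geometric_of_tendsto (1 / 2) C (by norm_num) (hC t ht)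
      (hlim' ω hωS t ht) k).trans hk.le
  have hadapt : ∀ t ≤ T, StronglyMeasurable[ℱ t] (I t) := fun t ht =>
    stronglyMeasurable_of_tendsto atTop
      (fun k => ((hX (φ k)).adapted t ht).indicator (ℱ.mono zero_le _ hS))
      (tendsto_pi_nhds.2 fun ω => hlim t ht ω)
  have hconv : Tendsto (fun n => martNormSq P T (fun t ω => X n t ω - I t ω)) atTop (𝓝 0) := by
    refine ENNReal.tendsto_nhds_zero.2 fun ε hε => ?_
    obtain ⟨N, hN⟩ := hC ε hε
    filter_upwards [eventually_ge_atTop N] with n hn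
    -- Fatou's lemma along the subsequence carries the Cauchy bound of the whole sequence to the
    -- limit.
    calc martNormSq P T (fun t ω => X n t ω - I t ω)
        ≤ ∫⁻ ω, liminf (fun k => ⨆ t : Set.Iic T, ‖X n t ω - X (φ k) t ω‖ₑ ^ 2) atTop ∂P := by
          refine lintegral_mono_ae ?_
          filter_upwards [hub] with ω hω
          refine iSup_le fun t => ?_
          have h1 : Tendsto (fun k => ‖X n t ω - X (φ k) t ω‖ₑ ^ 2) atTop
              (𝓝 (‖X n t ω - I t ω‖ₑ ^ 2)) :=
            (ENNReal.continuous_pow 2).continuousAt.tendsto.comp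
              ((hlim' ω hω t t.2).const_sub _).enorm
          rw [← h1.liminf_eq]
          exact liminf_le_liminf (Eventually.of_forall fun k =>
            le_iSup (fun t : Set.Iic T => ‖X n t ω - X (φ k) t ω‖ₑ ^ 2) t)
      _ ≤ liminf (fun k => martNormSq P T (fun t ω => X n t ω - X (φ k) t ω)) atTop :=
          lintegral_liminf_le' fun k => ((hX n).sub (hX (φ k))).aemeasurable_iSup
      _ ≤ ε := by
          refine liminf_le_of_frequently_le' (Eventually.frequently ?_)
          filter_upwards [eventually_ge_atTop N] with k hk
          exact hN n hn _ (hk.trans (hφ.id_le k))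
  have hL2 : ∀ t ≤ T, Tendsto (fun n => ∫⁻ ω, ‖X n t ω - I t ω‖ₑ ^ 2 ∂P) atTop (𝓝 0) :=
    fun t ht => tendsto_of_tendsto_of_tendsto_of_le_of_le tendsto_const_nhds hconv
      (fun _ => zero_le) fun n => lintegral_le_martNormSq (fun t ω => X n t ω - I t ω) ht
  have hmem : ∀ t ≤ T, MemLp (I t) 2 P := by
    intro t ht
    obtain ⟨n, hn⟩ := ((hL2 t ht).eventually (gt_mem_nhds one_pos)).exists
    have hIm : AEStronglyMeasurable (I t) P := ((hadapt t ht).mono (ℱ.le t)).aestronglyMeasurable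
    have h1 : MemLp (X n t - I t) 2 P := by
      refine ⟨((hX n).memLp t ht).1.sub hIm, ?_⟩
      have h2 := lintegral_enorm_sq_eq (P := P) (f := X n t - I t)
      simp only [Pi.sub_apply] at h2
      rw [h2] at hn
      by_contra h3
      rw [not_lt_top_iff] at h3
      simp [h3] at hn
    simpa using ((hX n).memLp t ht).sub h1
  exact ⟨I, ⟨hadapt, hmem, fun s t hst ht => condExp_of_tendsto_L2
    (fun n => (hX n).memLp t ht) (fun n => (hX n).memLp s (hst.trans ht)) (hmem t ht)
    (hmem s (hst.trans ht)) (hadapt s (hst.trans ht)) (fun n => (hX n).condExp s t hst ht)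
    (hL2 t ht) (hL2 s (hst.trans ht)), hcad⟩, hconv⟩

end Completeness

lemma lintegral_sq_congr_ae {Ω G : Type*} {mΩ : MeasurableSpace Ω} {P : Measure Ω}
    [NormedAddCommGroup G] {f g : Ω → G} (h : f =ᵐ[P] g) :
    ∫⁻ ω, ‖f ω‖ₑ ^ 2 ∂P = ∫⁻ ω, ‖g ω‖ₑ ^ 2 ∂P :=
  lintegral_congr_ae (h.mono fun ω hω => by simp only [hω])

lemma enorm_inner_le {G : Type*} [NormedAddCommGroup G] [InnerProductSpace ℝ G] (x y : G) :
    ‖⟪x, y⟫_ℝ‖ₑ ≤ ‖x‖ₑ * ‖y‖ₑ := by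
  rw [← ofReal_norm, ← ofReal_norm, ← ofReal_norm, ← ENNReal.ofReal_mul (norm_nonneg _)]
  exact ENNReal.ofReal_le_ofReal (norm_inner_le_norm _ _)

/-! ### Hilbert–Schmidt norms -/

section HilbertSchmidt

variable {K G E : Type*} [NormedAddCommGroup K] [InnerProductSpace ℝ K] [CompleteSpace K]
  [NormedAddCommGroup G] [InnerProductSpace ℝ G] [CompleteSpace G]
  [NormedAddCommGroup E] [InnerProductSpace ℝ E] [CompleteSpace E]

/-- Parseval on both sides and Tonelli. The domain of an integrand varies with (r, u) while G is
fixed; moving the sum to G allows one countable basis for all (r, u), which makes measurability and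
coordinatewise approximation possible. -/
lemma hsNormSq_eq_tsum_adjoint {ι : Type*} (b : HilbertBasis ι ℝ G) (S : K →L[ℝ] G) :
    hsNormSq S = ∑' i, ‖ContinuousLinearMap.adjoint S (b i)‖ₑ ^ 2 := by
  obtain ⟨e, he⟩ := (exists_hilbertBasis ℝ K).choose_spec
  calc hsNormSq S = ∑' k : (exists_hilbertBasis ℝ K).choose, ∑' i, ‖⟪b i, S (k : K)⟫_ℝ‖ₑ ^ 2 :=
        tsum_congr fun k => (HilbertBasis.tsum_enorm_inner_sq b _).symm
    _ = ∑' i, ∑' k : (exists_hilbertBasis ℝ K).choose, ‖⟪b i, S (k : K)⟫_ℝ‖ₑ ^ 2 :=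
        ENNReal.tsum_comm
    _ = _ := by
        refine tsum_congr fun i => ?_
        rw [← HilbertBasis.tsum_enorm_inner_sq e]
        refine tsum_congr fun k => ?_
        rw [ContinuousLinearMap.adjoint_inner_right, he, real_inner_comm]

lemma hsNormSq_comp_le (R : G →L[ℝ] E) (S : K →L[ℝ] G) :
    hsNormSq (R.comp S) ≤ ‖R‖ₑ ^ 2 * hsNormSq S := by
  unfold hsNormSq
  rw [← ENNReal.tsum_mul_left]
  refine ENNReal.tsum_le_tsum fun k => ?_
  rw [← mul_pow]
  gcongr
  exact R.le_opENorm _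

lemma hsNormSq_add_le (S S' : K →L[ℝ] G) :
    hsNormSq (S + S') ≤ 2 * hsNormSq S + 2 * hsNormSq S' := by
  unfold hsNormSq
  rw [← ENNReal.tsum_mul_left, ← ENNReal.tsum_mul_left, ← ENNReal.tsum_add]
  refine ENNReal.tsum_le_tsum fun k => ?_
  simpa using enorm_sub_sq_le (S (k : K)) 0 (-S' (k : K))

lemma hsNormSq_neg (S : K →L[ℝ] G) : hsNormSq (-S) = hsNormSq S := by
  simp [hsNormSq]

lemma hsNormSq_zero : hsNormSq (0 : K →L[ℝ] G) = 0 := by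
  simp [hsNormSq]

end HilbertSchmidt

namespace CylMartingaleMeasure

variable {Ω : Type*} [mΩ : MeasurableSpace Ω] {P : Measure Ω} {ℱ : Filtration ℝ≥0 mΩ}
  {U : Type*} [TopologicalSpace U] [mU : MeasurableSpace U] [BorelSpace U]
  {H : Type*} [NormedAddCommGroup H] [InnerProductSpace ℝ H]
  (M : CylMartingaleMeasure P ℱ U H) (T : ℝ≥0)
  {G : Type*} [NormedAddCommGroup G] [InnerProductSpace ℝ G]

/-! ### Increments of a cylindrical martingale-valued measure -/

/-- Uniform boundedness twice: pointwise bounds on q(h₁, h₂) bound the functionals q(h₁, ·) for each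
h₁, and these bounds in turn bound the operators h₁ ↦ q(h₁, ·). -/
lemma exists_form_le [CompleteSpace H] (t : ℝ≥0) :
    ∃ C : ℝ, ∀ r ≤ t, ∀ u h, (M.q r u).form h h ≤ C * ‖h‖ ^ 2 := by
  have h1 : ∀ h₁ : H, ∃ C : ℝ, ∀ p : Set.Iic t × U, ‖(M.q p.1 p.2).form h₁‖ ≤ C := by
    intro h₁
    refine banach_steinhaus (g := fun p : Set.Iic t × U => (M.q p.1 p.2).form h₁) fun h₂ => ?_
    obtain ⟨C, hC⟩ := M.q_bounded t h₁ h₂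
    exact ⟨C, fun p => hC p.1 p.1.2 p.2⟩
  obtain ⟨C, hC⟩ := banach_steinhaus (g := fun p : Set.Iic t × U => (M.q p.1 p.2).form) h1
  refine ⟨C, fun r hr u h => ?_⟩
  calc (M.q r u).form h h ≤ ‖(M.q r u).form h h‖ := le_abs_self _
    _ ≤ ‖(M.q r u).form‖ * ‖h‖ * ‖h‖ := (M.q r u).form.le_opNorm₂ h h
    _ ≤ C * ‖h‖ * ‖h‖ := by
        gcongr
        exact hC (⟨r, hr⟩, u)
    _ = C * ‖h‖ ^ 2 := by ring

/-- The increment `M((s, t], A)`. -/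
def incr (s t : ℝ≥0) (A : Set U) : H →ₗ[ℝ] (Ω →ₘ[P] ℝ) := M.val t A - M.val s A

lemma coeFn_incr (s t : ℝ≥0) (A : Set U) (h : H) :
    (M.incr s t A h : Ω → ℝ) =ᵐ[P] fun ω => M.val t A h ω - M.val s A h ω :=
  AEEqFun.coeFn_sub _ _

lemma coeFn_sum_smul {ι : Type*} (f : H →ₗ[ℝ] (Ω →ₘ[P] ℝ)) (s : Finset ι) (c : ι → ℝ) (h : ι → H) :
    (f (∑ i ∈ s, c i • h i) : Ω → ℝ) =ᵐ[P] fun ω => ∑ i ∈ s, c i * f (h i) ω := by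
  classical
  induction s using Finset.induction_on with
  | empty =>
    simp only [Finset.sum_empty, map_zero]
    exact AEEqFun.coeFn_zero
  | insert a s ha ih =>
    simp only [Finset.sum_insert ha, map_add, map_smul]
    filter_upwards [ih, AEEqFun.coeFn_add (c a • f (h a)) (f (∑ i ∈ s, c i • h i)),
      AEEqFun.coeFn_smul (c a) (f (h a))] with ω h1 h2 h3
    rw [h2, Pi.add_apply, h1, h3, Pi.smul_apply, smul_eq_mul]

lemma memLp_incr (s t : ℝ≥0) {A : Set U} (hA : A ∈ M.ring) (h : H) :
    MemLp (M.incr s t A h) 2 P :=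
  ((M.memLp t A hA h).sub (M.memLp s A hA h)).ae_eq (M.coeFn_incr s t A h).symm

lemma lintegral_incr_sq {s t : ℝ≥0} (hst : s ≤ t) {A : Set U} (hA : A ∈ M.ring) (h : H) :
    ∫⁻ ω, ‖M.incr s t A h ω‖ₑ ^ 2 ∂P =
      ∫⁻ r in Set.Ioc s t, ∫⁻ u in A, ENNReal.ofReal ((M.q r u).form h h) ∂M.μ ∂M.lam := by
  have h1 : ∫⁻ ω, ‖M.incr s t A h ω‖ₑ ^ 2 ∂P =
      ∫⁻ ω, ‖M.val t A h ω - M.val s A h ω‖ₑ ^ 2 ∂P :=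
    lintegral_sq_congr_ae (M.coeFn_incr s t A h)
  rw [h1]
  rcases hst.eq_or_lt with rfl | hst
  · simp
  · exact M.covariance s t hst A hA h

lemma lintegral_incr_sq_le {C : ℝ} (hC : ∀ r ≤ T, ∀ u h, (M.q r u).form h h ≤ C * ‖h‖ ^ 2)
    {s t : ℝ≥0} (hst : s ≤ t) (htT : t ≤ T) {A : Set U} (hA : A ∈ M.ring) (h : H) :
    ∫⁻ ω, ‖M.incr s t A h ω‖ₑ ^ 2 ∂P ≤
      ENNReal.ofReal (C * ‖h‖ ^ 2) * M.μ A * M.lam (Set.Ioc s t) := by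
  rw [M.lintegral_incr_sq hst hA]
  calc ∫⁻ r in Set.Ioc s t, ∫⁻ u in A, ENNReal.ofReal ((M.q r u).form h h) ∂M.μ ∂M.lam
      ≤ ∫⁻ r in Set.Ioc s t, ∫⁻ u in A, ENNReal.ofReal (C * ‖h‖ ^ 2) ∂M.μ ∂M.lam :=
        setLIntegral_mono' measurableSet_Ioc fun r hr => lintegral_mono fun u =>
          ENNReal.ofReal_le_ofReal (hC r (hr.2.trans htT) u h)
    _ = _ := by simp

/-- The intervals (t, s] decrease to the empty set; a possible atom of `lam` at t is excluded by the
open left end. -/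
lemma tendsto_lam_Ioc (t : ℝ≥0) :
    Tendsto (fun s => M.lam (Set.Ioc t s)) (𝓝[>] t) (𝓝 0) := by
  have h := tendsto_measure_biInter_gt (μ := M.lam) (s := fun s => Set.Ioc t s) (a := t)
    (fun _ _ => measurableSet_Ioc.nullMeasurableSet)
    (fun i j _ hij => Set.Ioc_subset_Ioc_right hij)
    ⟨t + 1, by simp, ((measure_mono Set.Ioc_subset_Iic_self).trans_lt (M.lam_lt_top _)).ne⟩
  have h0 : ⋂ r > t, Set.Ioc t r = ∅ := by
    refine Set.eq_empty_of_forall_notMem fun x hx => ?_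
    simp only [Set.mem_iInter] at hx
    have h1 : t < x := (hx (t + 1) (by simp)).1
    obtain ⟨y, hy1, hy2⟩ := exists_between h1
    exact absurd (hx y hy1).2 (not_le.2 hy2)
  rwa [h0, measure_empty] at h

/-- The stopped increment `r ↦ M((s ∧ r, t ∧ r], A)(h)`. -/
def stoppedIncr (s t : ℝ≥0) (A : Set U) (h : H) (r : ℝ≥0) (ω : Ω) : ℝ :=
  M.val (min t r) A h ω - M.val (min s r) A h ω

lemma stoppedIncr_ae_eq (s t : ℝ≥0) (A : Set U) (h : H) (r : ℝ≥0) :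
    M.stoppedIncr s t A h r =ᵐ[P] M.incr (min s r) (min t r) A h :=
  (M.coeFn_incr _ _ A h).symm

variable [IsProbabilityMeasure P]

lemma condExp_val {A : Set U} (hA : A ∈ M.ring) (h : H) (t a : ℝ≥0) :
    P[M.val t A h|ℱ a] =ᵐ[P] M.val (min t a) A h := by
  have hM := M.martingale A hA h
  rcases le_total t a with hta | hta
  · rw [min_eq_left hta]
    exact Eq.eventuallyEq (condExp_of_stronglyMeasurable (ℱ.le a)
      ((hM.1 t).mono (ℱ.mono hta)) (hM.integrable t))
  · rw [min_eq_right hta]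
    exact hM.2 a t hta

lemma isL2Martingale_stoppedIncr (s t : ℝ≥0) {A : Set U} (hA : A ∈ M.ring) (h : H) :
    IsL2Martingale P ℱ T (M.stoppedIncr s t A h) := by
  have hM := M.martingale A hA h
  refine ⟨fun r _ => ?_, fun r _ => (M.memLp _ A hA h).sub (M.memLp _ A hA h), fun a b hab _ => ?_⟩
  · exact ((hM.1 _).mono (ℱ.mono (min_le_right t r))).sub
      ((hM.1 _).mono (ℱ.mono (min_le_right s r)))
  · have h1 : ∀ x, P[M.val (min x b) A h|ℱ a] =ᵐ[P] M.val (min x a) A h := fun x => by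
      have := M.condExp_val hA h (min x b) a
      rwa [min_assoc, min_eq_right hab] at this
    refine (condExp_sub ((M.memLp _ A hA h).integrable one_le_two)
      ((M.memLp _ A hA h).integrable one_le_two) (ℱ a)).trans ?_
    exact (h1 t).sub (h1 s)

/-- By the covariance formula and the uniform bound on the forms, the variance accumulated over (r,
r'] is at most a constant times lam((r, r']). This supplies the right continuity needed for a càdlàg
version. -/
lemma tendsto_stoppedIncr [CompleteSpace H] (s t : ℝ≥0) {A : Set U} (hA : A ∈ M.ring) (h : H)
    {r : ℝ≥0} (hr : r < T) :
    Tendsto (fun r' => ∫⁻ ω, ‖M.stoppedIncr s t A h r' ω - M.stoppedIncr s t A h r ω‖ₑ ^ 2 ∂P)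
      (𝓝[>] r) (𝓝 0) := by
  obtain ⟨C, hC⟩ := M.exists_form_le T
  set c := ENNReal.ofReal (C * ‖h‖ ^ 2) * M.μ A
  have hc : c ≠ ∞ := ENNReal.mul_ne_top ENNReal.ofReal_ne_top (M.μ_lt_top A hA).ne
  have hle : ∀ x r', r ≤ r' → r' ≤ T →
      ∫⁻ ω, ‖M.val (min x r') A h ω - M.val (min x r) A h ω‖ₑ ^ 2 ∂P ≤
        c * M.lam (Set.Ioc r r') := by
    intro x r' hrr' hr'
    have h1 := M.lintegral_incr_sq_le T hC (min_le_min_left x hrr')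
      ((min_le_right _ _).trans hr') hA h
    rw [lintegral_sq_congr_ae (M.coeFn_incr (min x r) (min x r') A h)] at h1
    refine h1.trans ?_
    gcongr 1
    refine measure_mono fun y hy => ?_
    rcases le_total x r with hx | hx
    · simp [min_eq_left hx, min_eq_left (hx.trans hrr')] at hy
    · rw [min_eq_right hx] at hy
      exact ⟨hy.1, hy.2.trans (min_le_right _ _)⟩
  have hlim : Tendsto (fun r' => 2 * (c * M.lam (Set.Ioc r r')) + 2 * (c * M.lam (Set.Ioc r r')))
      (𝓝[>] r) (𝓝 0) := by
    have h1 := ENNReal.Tendsto.const_mul (a := 2)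
      (ENNReal.Tendsto.const_mul (a := c) (M.tendsto_lam_Ioc r) (Or.inr hc))
      (Or.inr ENNReal.ofNat_ne_top)
    simpa using h1.add h1
  refine tendsto_of_tendsto_of_tendsto_of_le_of_le' tendsto_const_nhds hlim
    (Eventually.of_forall fun _ => zero_le) ?_
  filter_upwards [self_mem_nhdsWithin, mem_nhdsWithin_of_mem_nhds (Iic_mem_nhds hr)]
    with r' hr' hr'T
  have h1 := hle t r' (le_of_lt hr') hr'T
  have h2 := hle s r' (le_of_lt hr') hr'T
  calc ∫⁻ ω, ‖M.stoppedIncr s t A h r' ω - M.stoppedIncr s t A h r ω‖ₑ ^ 2 ∂P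
      ≤ ∫⁻ ω, 2 * ‖M.val (min t r') A h ω - M.val (min t r) A h ω‖ₑ ^ 2 +
          2 * ‖M.val (min s r') A h ω - M.val (min s r) A h ω‖ₑ ^ 2 ∂P := by
        refine lintegral_mono fun ω => ?_
        have := enorm_sub_sq_le (M.val (min t r') A h ω - M.val (min t r) A h ω) 0
          (M.val (min s r') A h ω - M.val (min s r) A h ω)
        simp only [sub_zero, zero_sub, enorm_neg] at this
        refine le_trans (le_of_eq ?_) this
        unfold stoppedIncr
        congr 2
        ring
    _ = 2 * ∫⁻ ω, ‖M.val (min t r') A h ω - M.val (min t r) A h ω‖ₑ ^ 2 ∂P +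
          2 * ∫⁻ ω, ‖M.val (min s r') A h ω - M.val (min s r) A h ω‖ₑ ^ 2 ∂P := by
        rw [lintegral_add_left' (f := fun ω =>
            2 * ‖M.val (min t r') A h ω - M.val (min t r) A h ω‖ₑ ^ 2)
          (((((M.memLp _ A hA h).1.sub (M.memLp _ A hA h).1).enorm).pow_const 2).const_mul 2),
          lintegral_const_mul' _ _ ENNReal.ofNat_ne_top,
          lintegral_const_mul' _ _ ENNReal.ofNat_ne_top]
    _ ≤ _ := by gcongr

lemma exists_cadlag_stoppedIncr [CompleteSpace H] (hnull : ∀ s, P s = 0 → MeasurableSet[ℱ 0] s)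
    (s t : ℝ≥0) {A : Set U} (hA : A ∈ M.ring) (h : H) :
    ∃ Z, IsSqMartingale P ℱ T Z ∧ ∀ r ≤ T, Z r =ᵐ[P] M.incr (min s r) (min t r) A h := by
  obtain ⟨Z, hZ, hZ'⟩ := (M.isL2Martingale_stoppedIncr T s t hA h).exists_cadlag_version hnull
    fun r hr => M.tendsto_stoppedIncr T s t hA h hr
  exact ⟨Z, hZ, fun r hr => (hZ' r hr).trans (M.stoppedIncr_ae_eq s t A h r)⟩

/-- Radonification of the cylindrical martingales `r ↦ M((s ∧ r, t ∧ r], A)` by a Hilbert–Schmidt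
operator. -/
theorem exists_isRadonification [CompleteSpace H] [CompleteSpace G]
    [TopologicalSpace.SeparableSpace G]
    (hnull : ∀ s, P s = 0 → MeasurableSet[ℱ 0] s) {s t : ℝ≥0} (hst : s ≤ t) {A : Set U}
    (hA : A ∈ M.ring) {S : H →L[ℝ] G} (hS : IsHilbertSchmidt S) :
    ∃ Y, M.IsRadonification T s t A S Y := by
  classical
  have := UniformSpace.secondCountable_of_separable G
  obtain ⟨w, b, -⟩ := exists_hilbertBasis ℝ G
  have : Countable w := HilbertBasis.countable_of_separable b
  have := Encodable.ofCountable w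
  obtain ⟨C, hC⟩ := M.exists_form_le T
  set c := M.μ A * M.lam (Set.Iic T)
  have hc : c ≠ ∞ := ENNReal.mul_ne_top (M.μ_lt_top A hA).ne (M.lam_lt_top T).ne
  -- The increment is bounded from H into L², uniformly in r ≤ T; this controls both the series
  -- below and the identification of its limit.
  have hbound : ∀ r ≤ T, ∀ h, ∫⁻ ω, ‖M.incr (min s r) (min t r) A h ω‖ₑ ^ 2 ∂P ≤
      ENNReal.ofReal C * c * ‖h‖ₑ ^ 2 := by
    intro r hr h
    have h1 := M.lintegral_incr_sq_le T hC (min_le_min_right r hst)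
      ((min_le_right _ _).trans hr) hA h
    refine h1.trans ?_
    rw [ENNReal.ofReal_mul' (by positivity), ENNReal.ofReal_pow (norm_nonneg _), ofReal_norm]
    calc _ ≤ ENNReal.ofReal C * ‖h‖ₑ ^ 2 * M.μ A * M.lam (Set.Iic T) := by
          gcongr
          exact fun y hy => hy.2.trans ((min_le_right _ _).trans hr)
      _ = _ := by simp only [c]; ring
  choose Z hZ hZ' using fun i => M.exists_cadlag_stoppedIncr T hnull s t hA
    (ContinuousLinearMap.adjoint S (b i))
  set F : ℕ → Finset w := fun n => (Finset.range n).preimage Encodable.encode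
    Encodable.encode_injective.injOn
  have hFmem : ∀ n i, i ∈ F n ↔ Encodable.encode i < n := fun n i => by simp [F]
  have hFmono : Monotone F := fun m n hmn i hi => by
    rw [hFmem] at hi ⊢; omega
  have hF : Tendsto F atTop atTop := tendsto_atTop_finset_of_monotone hFmono
    fun i => ⟨Encodable.encode i + 1, by simp [hFmem]⟩
  set X : ℕ → ℝ≥0 → Ω → G := fun n r ω => ∑ i ∈ F n, Z i r ω • b i
  have hX : ∀ n, IsSqMartingale P ℱ T (X n) := fun n =>
    isSqMartingale_sum _ fun i _ => (hZ i).clm (ContinuousLinearMap.toSpanSingleton ℝ (b i))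
  have hXb : ∀ n r ω i, ⟪b i, X n r ω⟫_ℝ = if i ∈ F n then Z i r ω else 0 := by
    intro n r ω i
    simp only [X, inner_sum, inner_smul_right]
    rw [← Finset.sum_ite_eq' (F n) i (fun i => Z i r ω)]
    refine Finset.sum_congr rfl fun j _ => ?_
    rw [orthonormal_iff_ite.1 b.orthonormal i j]
    simp [eq_comm]
  have hCauchy : ∀ ε > 0, ∃ N, ∀ m ≥ N, ∀ n ≥ N,
      martNormSq P T (fun t ω => X m t ω - X n t ω) ≤ ε := by
    -- Doob's inequality (the factor 8) and `hbound` dominate differences of partial sums by a tail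
    -- of ∑ a_i, whose total is a multiple of the squared Hilbert–Schmidt norm of S.
    set a : w → ℝ≥0∞ := fun i => 8 * (ENNReal.ofReal C * c *
      ‖ContinuousLinearMap.adjoint S (b i)‖ₑ ^ 2)
    have ha : ∑' i, a i ≠ ∞ := by
      simp only [a, ENNReal.tsum_mul_left, ← hsNormSq_eq_tsum_adjoint b S]
      exact ENNReal.mul_ne_top (by norm_num)
        (ENNReal.mul_ne_top (ENNReal.mul_ne_top ENNReal.ofReal_ne_top hc) hS.ne)
    intro ε hε
    have h0 := (ENNReal.tendsto_tsum_compl_atTop_zero ha).comp hF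
    obtain ⟨N, hN⟩ := (h0.eventually (ge_mem_nhds hε)).exists
    refine ⟨N, fun m hm n hn => le_trans ?_ hN⟩
    refine ((hX m).sub (hX n)).martNormSq_le.trans ?_
    calc 8 * ∫⁻ ω, ‖X m T ω - X n T ω‖ₑ ^ 2 ∂P
        ≤ 8 * ∫⁻ ω, ∑' i : {i // i ∉ F N}, ‖Z i T ω‖ₑ ^ 2 ∂P := by
          gcongr with ω
          rw [← HilbertBasis.tsum_enorm_inner_sq b]
          have hsub : Function.support (fun i => ‖⟪b i, X m T ω - X n T ω⟫_ℝ‖ₑ ^ 2) ⊆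
              {i | i ∉ F N} := by
            intro i hi hiN
            refine hi ?_
            simp [inner_sub_right, hXb, hFmono hm hiN, hFmono hn hiN]
          rw [← tsum_subtype_eq_of_support_subset hsub]
          refine ENNReal.tsum_le_tsum fun i => ?_
          simp only [inner_sub_right, hXb]
          split_ifs <;> simp
      _ = ∑' i : {i // i ∉ F N}, 8 * ∫⁻ ω, ‖Z i T ω‖ₑ ^ 2 ∂P := by
          rw [lintegral_tsum fun i : {i // i ∉ F N} => ((hZ i).memLp T le_rfl).1.enorm.pow_const 2,
            ENNReal.tsum_mul_left]
      _ ≤ ∑' i : {i // i ∉ F N}, a i := by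
          refine ENNReal.tsum_le_tsum fun i => ?_
          simp only [a]
          gcongr
          rw [lintegral_sq_congr_ae (hZ' i T le_rfl)]
          exact hbound T le_rfl _
  obtain ⟨Y, hY, hYX⟩ := exists_limit_of_cauchy hnull hX hCauchy
  refine ⟨Y, hY, fun r hr g => ?_⟩
  have hcoe := M.coeFn_incr (min s r) (min t r) A (ContinuousLinearMap.adjoint S g)
  refine EventuallyEq.trans ?_ hcoe
  set L := M.incr (min s r) (min t r) A
  have hXr : ∀ n, MemLp (fun ω => ⟪X n r ω, g⟫_ℝ) 2 P := fun n => ((hX n).memLp r hr).inner_const g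
  have hYr : MemLp (fun ω => ⟪Y r ω, g⟫_ℝ) 2 P := (hY.memLp r hr).inner_const g
  -- The pairings have two limits in probability: ⟨Y_r, g⟩ by construction, and the increment at S^*
  -- g, because by linearity they are the increment at S^* of the partial expansions of g.
  have h1 : TendstoInMeasure P (fun n ω => ⟪X n r ω, g⟫_ℝ) atTop (fun ω => ⟪Y r ω, g⟫_ℝ) := by
    refine tendstoInMeasure_of_lintegral_sq (fun n => (hXr n).1) hYr.1 ?_
    have h0 := ENNReal.Tendsto.const_mul (a := ‖g‖ₑ ^ 2) hYX (Or.inr (by simp))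
    rw [mul_zero] at h0
    refine tendsto_of_tendsto_of_tendsto_of_le_of_le tendsto_const_nhds h0 (fun _ => zero_le)
      fun n => ?_
    refine le_trans ?_ (mul_le_mul_right
      (lintegral_le_martNormSq (fun t ω => X n t ω - Y t ω) hr) _)
    rw [← lintegral_const_mul' _ _ (by simp)]
    refine lintegral_mono fun ω => ?_
    simp only [← inner_sub_left]
    rw [mul_comm, ← mul_pow]
    gcongr
    exact enorm_inner_le _ _
  have h2 : TendstoInMeasure P (fun n ω => ⟪X n r ω, g⟫_ℝ) atTop
      (L (ContinuousLinearMap.adjoint S g)) := by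
    have hXL : ∀ n, (fun ω => ⟪X n r ω, g⟫_ℝ) =ᵐ[P]
        L (ContinuousLinearMap.adjoint S (∑ i ∈ F n, ⟪b i, g⟫_ℝ • b i)) := by
      intro n
      simp only [map_sum, map_smul]
      have h3 := coeFn_sum_smul L (F n) (fun i => ⟪b i, g⟫_ℝ)
        (fun i => ContinuousLinearMap.adjoint S (b i))
      simp only [map_sum, map_smul] at h3
      refine EventuallyEq.trans ?_ h3.symm
      filter_upwards [(F n).eventually_all.2 fun i _ => hZ' i r hr] with ω hω
      simp only [X, sum_inner, inner_smul_left]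
      refine Finset.sum_congr rfl fun i hi => ?_
      rw [hω i hi]
      simp [mul_comm, L]
    refine tendstoInMeasure_of_lintegral_sq (fun n => (hXr n).1) (M.memLp_incr _ _ hA _).1 ?_
    have h0 : Tendsto (fun n => ENNReal.ofReal C * c *
        ‖ContinuousLinearMap.adjoint S (∑ i ∈ F n, ⟪b i, g⟫_ℝ • b i - g)‖ₑ ^ 2) atTop (𝓝 0) := by
      have h3 : Tendsto (fun n => ∑ i ∈ F n, ⟪b i, g⟫_ℝ • b i) atTop (𝓝 g) := by
        have := b.hasSum_repr g
        simp only [b.repr_apply_apply, HasSum, SummationFilter.unconditional_filter] at this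
        exact this.comp hF
      have h4 := ((ContinuousLinearMap.adjoint S).continuous.tendsto 0).comp
        ((h3.sub_const g).trans_eq (by simp))
      have h5 := ENNReal.Tendsto.const_mul (a := ENNReal.ofReal C * c)
        (((ENNReal.continuous_pow 2).tendsto _).comp h4.enorm)
        (Or.inr (ENNReal.mul_ne_top ENNReal.ofReal_ne_top hc))
      simpa using h5
    refine tendsto_of_tendsto_of_tendsto_of_le_of_le tendsto_const_nhds h0 (fun _ => zero_le)
      fun n => ?_
    refine le_trans (le_of_eq (lintegral_congr_ae ?_)) (hbound r hr _)
    filter_upwards [hXL n, AEEqFun.coeFn_sub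
      (L (ContinuousLinearMap.adjoint S (∑ i ∈ F n, ⟪b i, g⟫_ℝ • b i)))
      (L (ContinuousLinearMap.adjoint S g))] with ω h3 h4
    rw [map_sub, map_sub, h4, Pi.sub_apply]
    simp only [h3]
  exact tendstoInMeasure_ae_unique h1 h2

end CylMartingaleMeasure

lemma integral_add_add {α : Type*} {m : MeasurableSpace α} {ν : Measure α} {f g k : α → ℝ}
    (hf : Integrable f ν) (hg : Integrable g ν) (hk : Integrable k ν) :
    ∫ x, f x + g x + k x ∂ν = ∫ x, f x ∂ν + ∫ x, g x ∂ν + ∫ x, k x ∂ν := by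
  have h := integral_add (hf.add hg) hk
  simp only [Pi.add_apply] at h
  rw [h, integral_add hf hg]

namespace CylMartingaleMeasure

variable {Ω : Type*} [mΩ : MeasurableSpace Ω] {P : Measure Ω} {ℱ : Filtration ℝ≥0 mΩ}
  {U : Type*} [TopologicalSpace U] [mU : MeasurableSpace U] [BorelSpace U]
  {H : Type*} [NormedAddCommGroup H] [InnerProductSpace ℝ H]
  (M : CylMartingaleMeasure P ℱ U H) (T : ℝ≥0)

/-! ### The covariance of the increments -/

lemma measurableSet_of_mem_ring {A : Set U} (hA : A ∈ M.ring) : MeasurableSet A := by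
  have h := MeasurableSpace.measurableSet_generateFrom hA
  rwa [← M.generate] at h

instance : SigmaFinite M.μ := by
  obtain ⟨A, hA, hA0⟩ := M.μ_sigmaFinite
  -- The null complement of the ring sets is inserted as the set of index 0, so that the cover is
  -- exact.
  refine ⟨⟨⟨fun n => Nat.casesOn n (⋃ n, A n)ᶜ A, fun _ => trivial, fun n => ?_, ?_⟩⟩⟩
  · cases n with
    | zero => exact hA0.trans_lt ENNReal.zero_lt_top
    | succ n => exact M.μ_lt_top _ (hA n)
  · refine Set.eq_univ_of_forall fun u => ?_
    by_cases hu : u ∈ ⋃ n, A n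
    · obtain ⟨n, hn⟩ := Set.mem_iUnion.1 hu
      exact Set.mem_iUnion.2 ⟨n + 1, hn⟩
    · exact Set.mem_iUnion.2 ⟨0, hu⟩

instance : IsFiniteMeasure (M.lam.restrict (Set.Ioc 0 T)) :=
  ⟨by
    rw [Measure.restrict_apply_univ]
    exact (measure_mono Set.Ioc_subset_Iic_self).trans_lt (M.lam_lt_top T)⟩

/-- The measure `lam ⊗ μ` on `(0, T] × U`. -/
def base : Measure (ℝ≥0 × U) := (M.lam.restrict (Set.Ioc 0 T)).prod M.μ

instance : SigmaFinite (M.base T) :=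
  inferInstanceAs (SigmaFinite ((M.lam.restrict (Set.Ioc 0 T)).prod M.μ))

lemma ae_base : ∀ᵐ p ∂M.base T, p.1 ∈ Set.Ioc 0 T := by
  have h : M.base T = ((M.lam.restrict (Set.Ioc 0 T)).restrict (Set.Ioc 0 T)).prod
      (M.μ.restrict Set.univ) := by
    rw [Measure.restrict_restrict_of_subset le_rfl, Measure.restrict_univ, base]
  rw [h, Measure.prod_restrict]
  filter_upwards [ae_restrict_mem (measurableSet_Ioc.prod MeasurableSet.univ)] with p hp
  exact hp.1

/-- The function `(r, u) ↦ q_{r,u}(h₁, h₂)`. -/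
def formFun (h₁ h₂ : H) (p : ℝ≥0 × U) : ℝ := (M.q p.1 p.2).form h₁ h₂

lemma measurable_formFun (h₁ h₂ : H) : Measurable (M.formFun h₁ h₂) := M.q_measurable h₁ h₂

lemma formFun_nonneg (h : H) (p : ℝ≥0 × U) : 0 ≤ M.formFun h h p := (M.q p.1 p.2).nonneg h

lemma integrableOn_formFun {I : Set ℝ≥0} {A : Set U} (hA : A ∈ M.ring) (h₁ h₂ : H) :
    IntegrableOn (M.formFun h₁ h₂) (I ×ˢ A) (M.base T) := by
  obtain ⟨C, hC⟩ := M.q_bounded T h₁ h₂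
  refine Measure.integrableOn_of_bounded (M := C) ?_
    (M.measurable_formFun h₁ h₂).aestronglyMeasurable ?_
  · rw [base, Measure.prod_prod]
    exact ENNReal.mul_ne_top (measure_ne_top _ _) (M.μ_lt_top A hA).ne
  · refine ae_restrict_of_ae ?_
    filter_upwards [M.ae_base T] with p hp
    exact hC p.1 hp.2 p.2

variable {T}

lemma integral_incr_sq {s t : ℝ≥0} (hst : s ≤ t) (ht : t ≤ T) {A : Set U} (hA : A ∈ M.ring)
    (h : H) : ∫ ω, M.incr s t A h ω ^ 2 ∂P =
      ∫ p in Set.Ioc s t ×ˢ A, M.formFun h h p ∂M.base T := by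
  have hsq : ∀ ω, ENNReal.ofReal (M.incr s t A h ω ^ 2) = ‖M.incr s t A h ω‖ₑ ^ 2 := fun ω => by
    rw [← ofReal_norm, ← ENNReal.ofReal_pow (norm_nonneg _), Real.norm_eq_abs, sq_abs]
  rw [integral_eq_lintegral_of_nonneg_ae (ae_of_all _ fun _ => sq_nonneg _)
    ((M.memLp_incr s t hA h).integrable_sq.1),
    integral_eq_lintegral_of_nonneg_ae (f := M.formFun h h) (ae_of_all _ (M.formFun_nonneg h))
    (M.measurable_formFun h h).aestronglyMeasurable]
  simp only [hsq]
  rw [M.lintegral_incr_sq hst hA, base, ← Measure.prod_restrict,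
    Measure.restrict_restrict measurableSet_Ioc, Set.inter_eq_self_of_subset_left
      (Set.Ioc_subset_Ioc zero_le ht),
    lintegral_prod _ (M.measurable_formFun h h).ennreal_ofReal.aemeasurable]
  rfl

lemma integrable_incr_mul_incr (s t s' t' : ℝ≥0) {A B : Set U} (hA : A ∈ M.ring) (hB : B ∈ M.ring)
    (h h' : H) : Integrable (fun ω => M.incr s t A h ω * M.incr s' t' B h' ω) P :=
  (M.memLp_incr s t hA h).integrable_mul (M.memLp_incr s' t' hB h')

/-- Polarisation at h + h', since the covariance is postulated on the diagonal only. -/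
lemma integral_incr_mul_self {s t : ℝ≥0} (hst : s ≤ t) (ht : t ≤ T) {A : Set U} (hA : A ∈ M.ring)
    (h h' : H) : ∫ ω, M.incr s t A h ω * M.incr s t A h' ω ∂P =
      ∫ p in Set.Ioc s t ×ˢ A, M.formFun h h' p ∂M.base T := by
  have h1 := M.integral_incr_sq hst ht hA (h + h')
  have e1 : ∫ ω, M.incr s t A (h + h') ω ^ 2 ∂P = ∫ ω, (M.incr s t A h ω ^ 2 +
      2 * (M.incr s t A h ω * M.incr s t A h' ω)) + M.incr s t A h' ω ^ 2 ∂P := by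
    refine integral_congr_ae ?_
    rw [map_add]
    filter_upwards [AEEqFun.coeFn_add (M.incr s t A h) (M.incr s t A h')] with ω hω
    rw [hω, Pi.add_apply]
    ring
  have e2 : ∀ p, M.formFun (h + h') (h + h') p =
      (M.formFun h h p + 2 * M.formFun h h' p) + M.formFun h' h' p := by
    intro p
    simp only [formFun, map_add, add_apply]
    rw [(M.q p.1 p.2).symm h' h]
    ring
  have i1 := (M.memLp_incr s t hA h).integrable_sq
  have i2 := (M.memLp_incr s t hA h').integrable_sq
  have i3 := (M.integrable_incr_mul_incr s t s t hA hA h h').const_mul 2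
  have j1 := M.integrableOn_formFun T (I := Set.Ioc s t) hA h h
  have j2 := M.integrableOn_formFun T (I := Set.Ioc s t) hA h' h'
  have j3 := (M.integrableOn_formFun T (I := Set.Ioc s t) hA h h').const_mul 2
  simp only [e2] at h1
  rw [e1, integral_add_add i1 i3 i2, integral_const_mul,
    integral_add_add j1 j3 j2, integral_const_mul,
    M.integral_incr_sq hst ht hA h, M.integral_incr_sq hst ht hA h'] at h1
  linarith

lemma integral_incr_mul_of_disjoint (s t s' t' : ℝ≥0) {A B : Set U} (hA : A ∈ M.ring)
    (hB : B ∈ M.ring) (hAB : Disjoint A B) (h h' : H) :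
    ∫ ω, M.incr s t A h ω * M.incr s' t' B h' ω ∂P = 0 := by
  have hint : ∀ a b, Integrable (fun ω => M.val a A h ω * M.val b B h' ω) P := fun a b =>
    (M.memLp a A hA h).integrable_mul (M.memLp b B hB h')
  have h0 : ∀ a b, ∫ ω, M.val a A h ω * M.val b B h' ω ∂P = 0 := fun a b =>
    M.orthogonal b a A hA B hB hAB h h'
  have h1 : ∀ a, ∫ ω, M.val a A h ω * M.incr s' t' B h' ω ∂P = 0 := by
    intro a
    have h2 := integral_sub (hint a t') (hint a s')
    rw [h0, h0, sub_zero] at h2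
    rw [← h2]
    refine integral_congr_ae ?_
    filter_upwards [M.coeFn_incr s' t' B h'] with ω h3
    rw [h3]
    ring
  have hint' : ∀ a, Integrable (fun ω => M.val a A h ω * M.incr s' t' B h' ω) P := fun a =>
    (M.memLp a A hA h).integrable_mul (M.memLp_incr s' t' hB h')
  have h2 := integral_sub (hint' t) (hint' s)
  rw [h1, h1, sub_zero] at h2
  rw [← h2]
  refine integral_congr_ae ?_
  filter_upwards [M.coeFn_incr s t A h] with ω h3
  rw [h3]
  ring

lemma incr_union (s t : ℝ≥0) {A B : Set U} (hA : A ∈ M.ring) (hB : B ∈ M.ring) (h : H) :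
    M.incr s t A h = M.incr s t (A ∩ B) h + M.incr s t (A \ B) h := by
  have h1 := M.isSetRing.inter_mem hA hB
  have h2 := M.isSetRing.sdiff_mem hA hB
  have h3 : Disjoint (A ∩ B) (A \ B) := Set.disjoint_sdiff_inter.symm
  have h4 := M.val_union t _ h1 _ h2 h3 h
  have h5 := M.val_union s _ h1 _ h2 h3 h
  rw [Set.inter_union_sdiff] at h4 h5
  simp only [incr, LinearMap.sub_apply, h4, h5]
  abel

/-- Split both sets along A ∩ B: every cross term pairs disjoint sets and vanishes by orthogonality.
-/
lemma integral_incr_mul {s t : ℝ≥0} (hst : s ≤ t) (ht : t ≤ T) {A B : Set U} (hA : A ∈ M.ring)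
    (hB : B ∈ M.ring) (h h' : H) : ∫ ω, M.incr s t A h ω * M.incr s t B h' ω ∂P =
      ∫ p in Set.Ioc s t ×ˢ (A ∩ B), M.formFun h h' p ∂M.base T := by
  have hAB := M.isSetRing.inter_mem hA hB
  have hA' := M.isSetRing.sdiff_mem hA hB
  have hB' := M.isSetRing.sdiff_mem hB hA
  have e : ∫ ω, M.incr s t A h ω * M.incr s t B h' ω ∂P =
      ∫ ω, M.incr s t (A ∩ B) h ω * M.incr s t (A ∩ B) h' ω +
        M.incr s t (A ∩ B) h ω * M.incr s t (B \ A) h' ω +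
        M.incr s t (A \ B) h ω * M.incr s t B h' ω ∂P := by
    refine integral_congr_ae ?_
    rw [M.incr_union s t hA hB h]
    filter_upwards [AEEqFun.coeFn_add (M.incr s t (A ∩ B) h) (M.incr s t (A \ B) h),
      AEEqFun.coeFn_add (M.incr s t (B ∩ A) h') (M.incr s t (B \ A) h')] with ω h1 h2
    rw [h1, M.incr_union s t hB hA h', h2, Pi.add_apply, Pi.add_apply, Set.inter_comm B A]
    ring
  have i1 := M.integrable_incr_mul_incr s t s t hAB hAB h h'
  have i2 := M.integrable_incr_mul_incr s t s t hAB hB' h h'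
  have i3 := M.integrable_incr_mul_incr s t s t hA' hB h h'
  rw [e, integral_add_add i1 i2 i3,
    M.integral_incr_mul_of_disjoint s t s t hAB hB'
      (Set.disjoint_left.2 fun x hx hx' => hx'.2 hx.1),
    M.integral_incr_mul_of_disjoint s t s t hA' hB Set.disjoint_sdiff_left,
    M.integral_incr_mul_self hst ht hAB, add_zero, add_zero]

variable [IsProbabilityMeasure P]

/-- Independence of the pair of increments from `ℱ s` factors out P(F); independence of each
increment separately would say nothing about their product. -/
lemma integral_indicator_incr_mul {s t : ℝ≥0} (hst : s ≤ t) (ht : t ≤ T) {A B : Set U}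
    (hA : A ∈ M.ring) (hB : B ∈ M.ring) (h h' : H) {F : Set Ω} (hF : MeasurableSet[ℱ s] F) :
    ∫ ω, F.indicator 1 ω * (M.incr s t A h ω * M.incr s t B h' ω) ∂P =
      P.real F * ∫ p in Set.Ioc s t ×ˢ (A ∩ B), M.formFun h h' p ∂M.base T := by
  have hF' := ℱ.le s F hF
  rcases hst.eq_or_lt with rfl | hlt
  · have : ∀ ω, F.indicator 1 ω * (M.incr s s A h ω * M.incr s s B h' ω) =
        F.indicator 1 ω * ((0 : H →ₗ[ℝ] (Ω →ₘ[P] ℝ)) h ω * M.incr s s B h' ω) := by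
      intro ω; simp [incr]
    have h2 : ∫ ω, F.indicator 1 ω * ((0 : H →ₗ[ℝ] (Ω →ₘ[P] ℝ)) h ω * M.incr s s B h' ω) ∂P
        = 0 := by
      refine integral_eq_zero_of_ae ?_
      filter_upwards [AEEqFun.coeFn_zero (α := Ω) (β := ℝ) (μ := P)] with ω hω
      simp [hω]
    simp only [this, h2]
    simp
  set X : Ω → ℝ × ℝ := fun ω =>
    (M.val t A h ω - M.val s A h ω, M.val t B h' ω - M.val s B h' ω)
  have hX : AEMeasurable X P := ((M.memLp t A hA h).sub (M.memLp s A hA h)).1.aemeasurable.prodMk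
    ((M.memLp t B hB h').sub (M.memLp s B hB h')).1.aemeasurable
  have hind : IndepFun X (F.indicator (1 : Ω → ℝ)) P := by
    rw [IndepFun_iff_Indep]
    refine indep_of_indep_of_le_right (M.indep s t hlt A hA B hB h h') ?_
    have : StronglyMeasurable[ℱ s] (F.indicator (1 : Ω → ℝ)) := stronglyMeasurable_one.indicator hF
    exact this.measurable.comap_le
  have hind2 : IndepFun (F.indicator (1 : Ω → ℝ)) (fun ω => (X ω).1 * (X ω).2) P :=
    (hind.comp (φ := fun p : ℝ × ℝ => p.1 * p.2) (ψ := id) (by fun_prop) measurable_id).symm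
  have h1 := hind2.integral_fun_mul_eq_mul_integral
    (measurable_one.indicator hF').aestronglyMeasurable
    (hX.fst.mul hX.snd).aestronglyMeasurable
  have e : ∀ᵐ ω ∂P, M.incr s t A h ω * M.incr s t B h' ω = (X ω).1 * (X ω).2 := by
    filter_upwards [M.coeFn_incr s t A h, M.coeFn_incr s t B h'] with ω h2 h3
    rw [h2, h3]
  rw [integral_congr_ae (e.mono fun ω hω => by rw [hω]), h1, ← integral_congr_ae e,
    M.integral_incr_mul hst ht hA hB, integral_indicator_one hF']

/-- The later increment is a martingale difference and the other factors are known at s', so no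
independence is needed. -/
lemma integral_indicator_incr_mul_of_le {s t s' t' : ℝ≥0} (hst : s ≤ t) (hts : t ≤ s')
    (hst' : s' ≤ t') {A B : Set U}
    (hA : A ∈ M.ring) (hB : B ∈ M.ring) (h h' : H) {F : Set Ω} (hF : MeasurableSet[ℱ s'] F) :
    ∫ ω, F.indicator 1 ω * (M.incr s t A h ω * M.incr s' t' B h' ω) ∂P = 0 := by
  have hF' := ℱ.le s' F hF
  have hMA := M.martingale A hA h
  have hMB := M.martingale B hB h'
  have h1 := integral_mul_sub_eq_zero (P := P) (ℱ.le s')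
    (Y := F.indicator fun ω => M.val t A h ω - M.val s A h ω)
    ((((hMA.1 t).mono (ℱ.mono hts)).sub ((hMA.1 s).mono (ℱ.mono (hst.trans hts)))).indicator hF)
    (((M.memLp t A hA h).sub (M.memLp s A hA h)).indicator hF')
    (M.memLp t' B hB h') (M.memLp s' B hB h') (hMB.2 s' t' hst')
  rw [← h1]
  refine integral_congr_ae ?_
  filter_upwards [M.coeFn_incr s t A h, M.coeFn_incr s' t' B h'] with ω h2 h3
  rw [h2, h3]
  by_cases hω : ω ∈ F <;> simp [hω]

lemma incr_add_incr (s x t : ℝ≥0) (A : Set U) : M.incr s t A = M.incr s x A + M.incr x t A := by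
  simp only [incr]; abel

lemma integral_indicator_split {s x t s' t' : ℝ≥0} {A B : Set U}
    (hA : A ∈ M.ring) (hB : B ∈ M.ring) (h h' : H) {F : Set Ω} (hF : MeasurableSet F) :
    ∫ ω, F.indicator 1 ω * (M.incr s t A h ω * M.incr s' t' B h' ω) ∂P =
      ∫ ω, F.indicator 1 ω * (M.incr s x A h ω * M.incr s' t' B h' ω) ∂P +
      ∫ ω, F.indicator 1 ω * (M.incr x t A h ω * M.incr s' t' B h' ω) ∂P := by
  have hi : ∀ a b, Integrable (fun ω => F.indicator 1 ω *
      (M.incr a b A h ω * M.incr s' t' B h' ω)) P := by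
    intro a b
    refine ((M.integrable_incr_mul_incr a b s' t' hA hB h h').indicator hF).congr
      (ae_of_all _ fun ω => ?_)
    by_cases hω : ω ∈ F <;> simp [hω]
  rw [← integral_add (hi _ _) (hi _ _)]
  refine integral_congr_ae ?_
  rw [M.incr_add_incr s x t, LinearMap.add_apply]
  filter_upwards [AEEqFun.coeFn_add (M.incr s x A h) (M.incr x t A h)] with ω hω
  rw [hω, Pi.add_apply]
  ring

/-- The covariance of two localised increments. -/
theorem integral_indicator_incr_mul_general {s t s' t' : ℝ≥0} (hst : s ≤ t) (ht : t ≤ T)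
    (hst' : s' ≤ t') (ht' : t' ≤ T) {A B : Set U} (hA : A ∈ M.ring) (hB : B ∈ M.ring) (h h' : H)
    {F F' : Set Ω} (hF : MeasurableSet[ℱ s] F) (hF' : MeasurableSet[ℱ s'] F') :
    ∫ ω, (F ∩ F').indicator 1 ω * (M.incr s t A h ω * M.incr s' t' B h' ω) ∂P =
      P.real (F ∩ F') * ∫ p in (Set.Ioc s t ∩ Set.Ioc s' t') ×ˢ (A ∩ B),
        M.formFun h h' p ∂M.base T := by
  wlog hss : s ≤ s' generalizing s t s' t' A B h h' F F'
  · have h1 := this hst' ht' hst ht hB hA h' h hF' hF (not_le.1 hss).le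
    have h2 : M.formFun h' h = M.formFun h h' := funext fun p => (M.q p.1 p.2).symm h' h
    rw [h2, Set.inter_comm F', Set.inter_comm (Set.Ioc s' t'), Set.inter_comm B] at h1
    rw [← h1]
    exact integral_congr_ae (ae_of_all _ fun ω => by ring)
  have hFF : MeasurableSet[ℱ s'] (F ∩ F') := (ℱ.mono hss F hF).inter hF'
  have hFF' := ℱ.le s' _ hFF
  rcases le_total t s' with hts | hts
  · rw [M.integral_indicator_incr_mul_of_le hst hts hst' hA hB h h' hFF]
    have : Set.Ioc s t ∩ Set.Ioc s' t' = ∅ := by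
      ext x
      simp only [Set.mem_inter_iff, Set.mem_Ioc, Set.mem_empty_iff_false, iff_false]
      rintro ⟨⟨-, h1⟩, h2, -⟩
      exact absurd (h1.trans hts) (not_le.2 h2)
    simp [this]
  -- The overlap is (s', min t t']. Cutting the first increment at s', then whichever reaches
  -- further at the end of the other, leaves one pair over a common interval; the remaining pairs
  -- are successive and vanish.
  · rw [M.integral_indicator_split (x := s') hA hB h h' hFF',
      M.integral_indicator_incr_mul_of_le hss le_rfl hst' hA hB h h' hFF, zero_add]
    have hI : Set.Ioc s t ∩ Set.Ioc s' t' = Set.Ioc s' (min t t') := by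
      rw [Set.Ioc_inter_Ioc, max_eq_right hss]
    have hcomm : ∀ a b c d, ∀ A B : Set U, ∀ h h' : H,
        ∫ ω, (F ∩ F').indicator 1 ω * (M.incr a b A h ω * M.incr c d B h' ω) ∂P =
        ∫ ω, (F ∩ F').indicator 1 ω * (M.incr c d B h' ω * M.incr a b A h ω) ∂P :=
      fun a b c d A B h h' => integral_congr_ae (ae_of_all _ fun ω => by ring)
    rw [hI]
    rcases le_total t t' with htt | htt
    · rw [hcomm, M.integral_indicator_split (x := t) hB hA h' h hFF', hcomm,
        M.integral_indicator_incr_mul hts ht hA hB h h' hFF, hcomm,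
        M.integral_indicator_incr_mul_of_le hts le_rfl htt hA hB h h'
          (ℱ.mono hts _ hFF), add_zero, min_eq_left htt]
    · rw [M.integral_indicator_split (x := t') hA hB h h' hFF',
        M.integral_indicator_incr_mul hst' ht' hA hB h h' hFF, hcomm t' t,
        M.integral_indicator_incr_mul_of_le hst' le_rfl htt hB hA h' h
          (ℱ.mono hst' _ hFF), add_zero, min_eq_right htt]

end CylMartingaleMeasure

/-! ### Measurable sections of a field of Hilbert spaces -/

section Sections

variable {X : Type*} [MeasurableSpace X] {H : Type*} [NormedAddCommGroup H] [InnerProductSpace ℝ H]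
  {K : X → Type*} [∀ x, NormedAddCommGroup (K x)] [∀ x, InnerProductSpace ℝ (K x)]

/-- Measurability of a section of a field of Hilbert spaces, with respect to the constant
sections `x ↦ i x h`. -/
def IsMeasSection (i : ∀ x, H →L[ℝ] K x) (φ : ∀ x, K x) : Prop :=
  ∀ h, Measurable fun x => ⟪φ x, i x h⟫_ℝ

variable {i : ∀ x, H →L[ℝ] K x} {φ ψ : ∀ x, K x}

lemma IsMeasSection.add (hφ : IsMeasSection i φ) (hψ : IsMeasSection i ψ) :
    IsMeasSection i fun x => φ x + ψ x := fun h => by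
  simp only [inner_add_left]
  exact (hφ h).add (hψ h)

lemma IsMeasSection.sub (hφ : IsMeasSection i φ) (hψ : IsMeasSection i ψ) :
    IsMeasSection i fun x => φ x - ψ x := fun h => by
  simp only [inner_sub_left]
  exact (hφ h).sub (hψ h)

lemma IsMeasSection.smul (hφ : IsMeasSection i φ) {f : X → ℝ} (hf : Measurable f) :
    IsMeasSection i fun x => f x • φ x := fun h => by
  simp only [real_inner_smul_left]
  exact hf.mul (hφ h)

lemma isMeasSection_sum {ι : Type*} (s : Finset ι) {φ : ι → ∀ x, K x}
    (hφ : ∀ k ∈ s, IsMeasSection i (φ k)) : IsMeasSection i fun x => ∑ k ∈ s, φ k x := fun h => by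
  simp only [sum_inner]
  exact Finset.measurable_sum s fun k hk => hφ k hk h

lemma isMeasSection_const (hq : ∀ h h', Measurable fun x => ⟪i x h, i x h'⟫_ℝ) (h : H) :
    IsMeasSection i fun x => i x h := fun h' => hq h h'

/-- The identity 2⟨φ, y⟩ − ‖y‖² = ‖φ‖² − ‖φ − y‖² makes ‖φ‖² the supremum of the left side over a
dense set of y. Taking y among countably many constant sections, only measurable pairings occur and
the field need not be trivialised. -/
lemma IsMeasSection.measurable_enorm_sq [TopologicalSpace.SeparableSpace H]
    (hi : ∀ x, DenseRange (i x)) (hq : ∀ h h', Measurable fun x => ⟪i x h, i x h'⟫_ℝ)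
    (hφ : IsMeasSection i φ) : Measurable fun x => ‖φ x‖ₑ ^ 2 := by
  have key : ∀ x, ‖φ x‖ₑ ^ 2 = ⨆ k, ENNReal.ofReal (2 *
      ⟪φ x, i x (TopologicalSpace.denseSeq H k)⟫_ℝ -
      ⟪i x (TopologicalSpace.denseSeq H k), i x (TopologicalSpace.denseSeq H k)⟫_ℝ) := by
    intro x
    have hid : ∀ y : K x, 2 * ⟪φ x, y⟫_ℝ - ⟪y, y⟫_ℝ = ‖φ x‖ ^ 2 - ‖φ x - y‖ ^ 2 := fun y => by
      rw [norm_sub_sq_real, real_inner_self_eq_norm_sq]; ring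
    have hn : ‖φ x‖ₑ ^ 2 = ENNReal.ofReal (‖φ x‖ ^ 2) := by
      rw [← ofReal_norm, ENNReal.ofReal_pow (norm_nonneg _)]
    refine le_antisymm ?_ (iSup_le fun k => ?_)
    · have hd : DenseRange fun k => i x (TopologicalSpace.denseSeq H k) :=
        (hi x).comp (TopologicalSpace.denseRange_denseSeq H) (i x).continuous
      have hle : ∀ y : K x, ENNReal.ofReal (2 * ⟪φ x, y⟫_ℝ - ⟪y, y⟫_ℝ) ≤
          ⨆ k, ENNReal.ofReal (2 * ⟪φ x, i x (TopologicalSpace.denseSeq H k)⟫_ℝ -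
            ⟪i x (TopologicalSpace.denseSeq H k), i x (TopologicalSpace.denseSeq H k)⟫_ℝ) := by
        intro y
        refine hd.induction_on y (isClosed_le ?_ continuous_const) fun k => ?_
        · exact ENNReal.continuous_ofReal.comp (by fun_prop)
        · exact le_iSup (fun k => ENNReal.ofReal (2 *
            ⟪φ x, i x (TopologicalSpace.denseSeq H k)⟫_ℝ -
            ⟪i x (TopologicalSpace.denseSeq H k), i x (TopologicalSpace.denseSeq H k)⟫_ℝ)) k
      have := hle (φ x)
      rwa [hid, sub_self, norm_zero, zero_pow two_ne_zero, sub_zero, ← hn] at this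
    · rw [hid, hn]
      exact ENNReal.ofReal_le_ofReal (sub_le_self _ (sq_nonneg _))
  simp only [key]
  exact Measurable.iSup fun k => ((hφ _).const_mul 2 |>.sub (hq _ _)).ennreal_ofReal

end Sections

/-! ### The canonical map into the completion -/

namespace HilbertianSeminorm

variable {H : Type*} [NormedAddCommGroup H] [InnerProductSpace ℝ H] (q : HilbertianSeminorm H)

lemma inner_incl (h h' : H) : ⟪q.incl h, q.incl h'⟫_ℝ = q.form h h' :=
  UniformSpace.Completion.inner_coe (𝕜 := ℝ) (q.toPre h) (q.toPre h')

lemma enorm_incl_sq (h : H) : ‖q.incl h‖ₑ ^ 2 = ENNReal.ofReal (q.form h h) := by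
  rw [← q.inner_incl, real_inner_self_eq_norm_sq, ← ofReal_norm,
    ENNReal.ofReal_pow (norm_nonneg _)]

lemma denseRange_incl : DenseRange q.incl :=
  UniformSpace.Completion.denseRange_coe (α := q.Pre)

end HilbertianSeminorm

/-! ### The predictable product space -/

section PSpace

variable {Ω : Type*} [mΩ : MeasurableSpace Ω]

/-- The space `([0, T] × Ω) × U`, to be equipped with the product of the predictable `σ`-algebra
and the `σ`-algebra of `U`. -/
def PSpace (_ℱ : Filtration ℝ≥0 mΩ) (T : ℝ≥0) (U : Type*) : Type _ := (Set.Iic T × Ω) × U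

variable {ℱ : Filtration ℝ≥0 mΩ} {T : ℝ≥0} {U : Type*} [mU : MeasurableSpace U]

instance : MeasurableSpace (PSpace ℱ T U) := (predictableOn ℱ T).prod mU

namespace PSpace

/-- The time component. -/
def r (x : PSpace ℱ T U) : ℝ≥0 := x.1.1

/-- The random component. -/
def ω (x : PSpace ℱ T U) : Ω := x.1.2

/-- The mark component. -/
def u (x : PSpace ℱ T U) : U := x.2

lemma r_le (x : PSpace ℱ T U) : x.r ≤ T := x.1.1.2

lemma measurable_u : Measurable (u : PSpace ℱ T U → U) :=
  @measurable_snd _ _ (predictableOn ℱ T) mU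

lemma measurableSet_preimage_rω {C : Set (ℝ≥0 × Ω)} (hC : MeasurableSet[ℱ.predictable] C) :
    MeasurableSet {x : PSpace ℱ T U | (x.r, x.ω) ∈ C} :=
  @measurable_fst _ _ (predictableOn ℱ T) mU _ ⟨C, hC, rfl⟩

lemma measurable_r : Measurable (r : PSpace ℱ T U → ℝ≥0) := by
  refine measurable_of_Ioi fun a => ?_
  have h := measurableSet_preimage_rω (U := U) (T := T)
    (measurableSet_predictable_Ioi_prod (𝓕 := ℱ) (i := a) MeasurableSet.univ)
  convert h using 1
  ext x
  simp

lemma measurableSet_rect {s t : ℝ≥0} {F : Set Ω} (hF : MeasurableSet[ℱ s] F) {A : Set U}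
    (hA : MeasurableSet A) :
    MeasurableSet {x : PSpace ℱ T U | (x.r ∈ Set.Ioc s t ∧ x.ω ∈ F) ∧ x.u ∈ A} :=
  (measurableSet_preimage_rω (measurableSet_predictable_Ioc_prod s t hF)).inter (measurable_u hA)

/-- The point of `([0, T] × Ω) × U` with given components, the time being truncated at `T`. -/
def mk (z : Ω × (ℝ≥0 × U)) : PSpace ℱ T U := ((⟨min z.2.1 T, Set.mem_Iic.2 (min_le_right _ _)⟩, z.1), z.2.2)

lemma measurable_mk : Measurable (mk : Ω × (ℝ≥0 × U) → PSpace ℱ T U) := by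
  have h1 : ℱ.predictable ≤ (inferInstance : MeasurableSpace (ℝ≥0 × Ω)) := by
    refine measurableSpace_le_predictable_of_measurableSet (fun A hA => ?_) fun i A hA => ?_
    · exact (measurableSet_singleton _).prod (ℱ.le _ A hA)
    · exact measurableSet_Ioi.prod (ℱ.le _ A hA)
  have h2 : @Measurable _ _ _ (predictableOn ℱ T) fun z : Ω × (ℝ≥0 × U) =>
      ((⟨min z.2.1 T, Set.mem_Iic.2 (min_le_right _ _)⟩, z.1) : Set.Iic T × Ω) := by
    refine measurable_comap_iff.2 fun C hC => ?_
    have h3 : Measurable fun z : Ω × (ℝ≥0 × U) => (min z.2.1 T, z.1) := by fun_prop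
    exact h3 (h1 C hC)
  exact Measurable.prodMk h2 measurable_snd.snd

end PSpace

end PSpace

namespace CylMartingaleMeasure

variable {Ω : Type*} [mΩ : MeasurableSpace Ω] {P : Measure Ω} {ℱ : Filtration ℝ≥0 mΩ}
  {U : Type*} [TopologicalSpace U] [mU : MeasurableSpace U] [BorelSpace U]
  {H : Type*} [NormedAddCommGroup H] [InnerProductSpace ℝ H]
  (M : CylMartingaleMeasure P ℱ U H) (T : ℝ≥0)
  {G : Type*} [NormedAddCommGroup G] [InnerProductSpace ℝ G]

/-- The measure `P ⊗ lam ⊗ μ` on `([0, T] × Ω) × U`. -/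
def predMeasure : Measure (PSpace ℱ T U) := (P.prod (M.base T)).map PSpace.mk

variable {T} in
/-- The canonical maps `i_{q_{r,u}}`, as a field over `([0, T] × Ω) × U`. -/
def inclField (x : PSpace ℱ T U) : H →L[ℝ] (M.q x.r x.u).Space := (M.q x.r x.u).incl

lemma measurable_inclField (h h' : H) :
    Measurable fun x : PSpace ℱ T U => ⟪M.inclField x h, M.inclField x h'⟫_ℝ := by
  simp only [inclField, HilbertianSeminorm.inner_incl]
  exact (M.q_measurable h h').comp (PSpace.measurable_r.prodMk PSpace.measurable_u)

variable {M}

/-- Weak predictability of a family of operators on `[0, T]`. -/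
def IsPredictable [CompleteSpace G] (Φ : M.OperatorFamily G) : Prop :=
  ∀ g : G, IsMeasSection (fun x : PSpace ℱ T U => M.inclField x)
    fun x => ContinuousLinearMap.adjoint (Φ x.r x.ω x.u) g

variable {T} [CompleteSpace G]

lemma MemLambda2.isPredictable {Φ : M.OperatorFamily G} (hΦ : MemLambda2 T Φ) :
    IsPredictable T Φ := fun g h => hΦ.predictable h g

lemma IsPredictable.sub {Φ Ψ : M.OperatorFamily G} (hΦ : IsPredictable T Φ)
    (hΨ : IsPredictable T Ψ) :
    IsPredictable T (fun r ω u => Φ r ω u - Ψ r ω u : M.OperatorFamily G) := fun g => by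
  simp only [map_sub, sub_apply]
  exact (hΦ g).sub (hΨ g)

lemma IsPredictable.comp {E : Type*} [NormedAddCommGroup E] [InnerProductSpace ℝ E]
    [CompleteSpace E] (R : G →L[ℝ] E) {Φ : M.OperatorFamily G} (hΦ : IsPredictable T Φ) :
    IsPredictable T (fun r ω u => R.comp (Φ r ω u) : M.OperatorFamily E) := fun g => by
  simp only [ContinuousLinearMap.adjoint_comp, ContinuousLinearMap.comp_apply]
  exact hΦ _

variable [TopologicalSpace.SeparableSpace H] [TopologicalSpace.SeparableSpace G]

lemma measurable_enorm_sq_section {φ : ∀ x : PSpace ℱ T U, (M.q x.r x.u).Space}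
    (hφ : IsMeasSection (fun x : PSpace ℱ T U => M.inclField x) φ) :
    Measurable fun x => ‖φ x‖ₑ ^ 2 :=
  hφ.measurable_enorm_sq (fun x => (M.q x.r x.u).denseRange_incl) (M.measurable_inclField T)

lemma IsPredictable.measurable_hsNormSq {Φ : M.OperatorFamily G} (hΦ : IsPredictable T Φ) :
    Measurable fun x : PSpace ℱ T U => hsNormSq (Φ x.r x.ω x.u) := by
  obtain ⟨w, b, -⟩ := exists_hilbertBasis ℝ G
  have : Countable w := HilbertBasis.countable_of_separable b
  simp only [hsNormSq_eq_tsum_adjoint b]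
  exact Measurable.tsum fun i => measurable_enorm_sq_section (hΦ (b i))

variable [IsProbabilityMeasure P]

lemma lintegral_predMeasure {f : PSpace ℱ T U → ℝ≥0∞} (hf : Measurable f) :
    ∫⁻ x, f x ∂M.predMeasure T = ∫⁻ ω, ∫⁻ r in Set.Ioc 0 T, ∫⁻ u,
      f (PSpace.mk (ω, (r, u))) ∂M.μ ∂M.lam ∂P := by
  have hf' : Measurable fun z : Ω × (ℝ≥0 × U) => f (PSpace.mk z) := hf.comp PSpace.measurable_mk
  rw [predMeasure, lintegral_map hf PSpace.measurable_mk,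
    lintegral_prod _ hf'.aemeasurable]
  refine lintegral_congr fun ω => ?_
  have hω : Measurable fun y : ℝ≥0 × U => f (PSpace.mk (ω, y)) := hf'.comp measurable_prodMk_left
  rw [base, lintegral_prod _ hω.aemeasurable]

/-- Only times in (0, T] are integrated, so the truncation in `PSpace.mk` is invisible. A single
integral of a measurable function then replaces the iterated lower integrals. -/
lemma lambdaNormSq_eq {Φ : M.OperatorFamily G} (hΦ : IsPredictable T Φ) :
    lambdaNormSq T Φ = ∫⁻ x, hsNormSq (Φ x.r x.ω x.u) ∂M.predMeasure T := by
  rw [lintegral_predMeasure hΦ.measurable_hsNormSq, lambdaNormSq]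
  refine lintegral_congr fun ω => setLIntegral_congr_fun measurableSet_Ioc fun r hr => ?_
  refine lintegral_congr fun u => ?_
  -- The operator's domain depends on r and u, so min r T = r cannot simply be rewritten; with all
  -- components generalised, substitution is possible.
  have h : ∀ x : PSpace ℱ T U, ∀ r ω u, x.r = r → x.ω = ω → x.u = u →
      hsNormSq (Φ r ω u) = hsNormSq (Φ x.r x.ω x.u) := by
    rintro x _ _ _ rfl rfl rfl; rfl
  exact h (PSpace.mk (ω, (r, u))) r ω u (min_eq_left hr.2) rfl rfl

lemma lambdaNormSq_sub_le {Φ Ψ Θ : M.OperatorFamily G} (hΦ : IsPredictable T Φ)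
    (hΨ : IsPredictable T Ψ) (hΘ : IsPredictable T Θ) :
    lambdaNormSq T (fun r ω u => Φ r ω u - Θ r ω u : M.OperatorFamily G) ≤
      2 * lambdaNormSq T (fun r ω u => Φ r ω u - Ψ r ω u : M.OperatorFamily G) +
      2 * lambdaNormSq T (fun r ω u => Ψ r ω u - Θ r ω u : M.OperatorFamily G) := by
  rw [lambdaNormSq_eq (hΦ.sub hΘ), lambdaNormSq_eq (hΦ.sub hΨ), lambdaNormSq_eq (hΨ.sub hΘ),
    ← lintegral_const_mul' _ _ ENNReal.ofNat_ne_top,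
    ← lintegral_const_mul' _ _ ENNReal.ofNat_ne_top,
    ← lintegral_add_left ((hΦ.sub hΨ).measurable_hsNormSq.const_mul 2)]
  refine lintegral_mono fun x => ?_
  refine le_trans (le_of_eq ?_) (hsNormSq_add_le _ _)
  rw [sub_add_sub_cancel]

end CylMartingaleMeasure

namespace CylMartingaleMeasure

variable {Ω : Type*} [mΩ : MeasurableSpace Ω] {P : Measure Ω} {ℱ : Filtration ℝ≥0 mΩ}
  {U : Type*} [TopologicalSpace U] [mU : MeasurableSpace U] [BorelSpace U]
  {H : Type*} [NormedAddCommGroup H] [InnerProductSpace ℝ H]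
  (M : CylMartingaleMeasure P ℱ U H) {T : ℝ≥0}
  {G : Type*} [NormedAddCommGroup G] [InnerProductSpace ℝ G]

/-! ### The isometry for simple integrands -/

section Isometry

variable [IsProbabilityMeasure P] {κ : Type*} [Fintype κ] {s t : κ → ℝ≥0} {F : κ → Set Ω}
  {A : κ → Set U}

/-- The coefficient `1_{(s, t]}(r) 1_F(ω) 1_A(u)`. -/
def coef (s t : ℝ≥0) (F : Set Ω) (A : Set U) (r : ℝ≥0) (ω : Ω) (u : U) : ℝ :=
  (Set.Ioc s t).indicator (fun _ => (1 : ℝ)) r * F.indicator (fun _ => (1 : ℝ)) ω *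
    A.indicator (fun _ => (1 : ℝ)) u

lemma indicator_prod_inter {X Y : Type*} (I I' : Set X) (A A' : Set Y) (f : X × Y → ℝ)
    (z : X × Y) : ((I ∩ I') ×ˢ (A ∩ A')).indicator f z =
      I.indicator (fun _ => 1) z.1 * I'.indicator (fun _ => 1) z.1 *
      (A.indicator (fun _ => 1) z.2 * A'.indicator (fun _ => 1) z.2) * f z := by
  by_cases h1 : z.1 ∈ I <;> by_cases h2 : z.1 ∈ I' <;>
    by_cases h3 : z.2 ∈ A <;> by_cases h4 : z.2 ∈ A' <;>
    simp [Set.mem_prod, h1, h2, h3, h4]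

lemma coef_mul_coef_mul (s t s' t' : ℝ≥0) (F F' : Set Ω) (A A' : Set U) (h h' : H)
    (z : Ω × (ℝ≥0 × U)) :
    coef s t F A z.2.1 z.1 z.2.2 * coef s' t' F' A' z.2.1 z.1 z.2.2 * M.formFun h h' z.2 =
      (F ∩ F').indicator 1 z.1 *
        ((Set.Ioc s t ∩ Set.Ioc s' t') ×ˢ (A ∩ A')).indicator (M.formFun h h') z.2 := by
  obtain ⟨ω, r, u⟩ := z
  have h1 : (F ∩ F').indicator (1 : Ω → ℝ) ω =
      F.indicator (fun _ => 1) ω * F'.indicator (fun _ => 1) ω := by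
    by_cases h1 : ω ∈ F <;> by_cases h2 : ω ∈ F' <;> simp [h1, h2]
  have h2 := indicator_prod_inter (Set.Ioc s t) (Set.Ioc s' t') A A' (M.formFun h h') (r, u)
  rw [h1, h2]
  simp only [coef]
  ring

/-- The scalar Itô isometry: expand the square, evaluate each pair by
`integral_indicator_incr_mul_general`, and recognise the double sum as a quadratic form at a random
linear combination of the h_k (`hform`). -/
theorem lintegral_sum_incr_sq (hst : ∀ k, s k ≤ t k) (ht : ∀ k, t k ≤ T)
    (hF : ∀ k, MeasurableSet[ℱ (s k)] (F k)) (hA : ∀ k, A k ∈ M.ring) (h : κ → H) :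
    ∫⁻ ω, ‖∑ k, (F k).indicator 1 ω * M.incr (s k) (t k) (A k) (h k) ω‖ₑ ^ 2 ∂P =
      ∫⁻ z, ENNReal.ofReal (M.formFun (∑ k, coef (s k) (t k) (F k) (A k) z.2.1 z.1 z.2.2 • h k)
        (∑ k, coef (s k) (t k) (F k) (A k) z.2.1 z.1 z.2.2 • h k) z.2) ∂P.prod (M.base T) := by
  set R : κ → Ω → ℝ := fun k ω => (F k).indicator 1 ω * M.incr (s k) (t k) (A k) (h k) ω
  have hR : ∀ k, MemLp (R k) 2 P := by
    intro k
    refine ((M.memLp_incr (s k) (t k) (hA k) (h k)).indicator (ℱ.le _ _ (hF k))).ae_eq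
      (ae_of_all _ fun ω => ?_)
    by_cases hω : ω ∈ F k <;> simp [R, hω]
  have hRR : ∀ k l, Integrable (fun ω => R k ω * R l ω) P := fun k l => (hR k).integrable_mul (hR l)
  set W : κ → κ → Ω × (ℝ≥0 × U) → ℝ := fun k l z => (F k ∩ F l).indicator 1 z.1 *
    ((Set.Ioc (s k) (t k) ∩ Set.Ioc (s l) (t l)) ×ˢ (A k ∩ A l)).indicator
      (M.formFun (h k) (h l)) z.2
  have hmeas : ∀ k l, MeasurableSet ((Set.Ioc (s k) (t k) ∩ Set.Ioc (s l) (t l)) ×ˢ (A k ∩ A l)) :=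
    fun k l => (measurableSet_Ioc.inter measurableSet_Ioc).prod
      (M.measurableSet_of_mem_ring (M.isSetRing.inter_mem (hA k) (hA l)))
  have hFF : ∀ k l, MeasurableSet (F k ∩ F l) := fun k l =>
    (ℱ.le _ _ (hF k)).inter (ℱ.le _ _ (hF l))
  have hW : ∀ k l, Integrable (W k l) (P.prod (M.base T)) := fun k l =>
    ((integrable_const (1 : ℝ)).indicator (hFF k l)).mul_prod
      ((integrable_indicator_iff (hmeas k l)).2 (M.integrableOn_formFun T
        (M.isSetRing.inter_mem (hA k) (hA l)) _ _))
  have hRW : ∀ k l, ∫ ω, R k ω * R l ω ∂P = ∫ z, W k l z ∂P.prod (M.base T) := by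
    intro k l
    have h1 := M.integral_indicator_incr_mul_general (hst k) (ht k) (hst l) (ht l) (hA k) (hA l)
      (h k) (h l) (hF k) (hF l)
    rw [integral_prod_mul, integral_indicator_one (hFF k l), integral_indicator (hmeas k l), ← h1]
    refine integral_congr_ae (ae_of_all _ fun ω => ?_)
    by_cases h1 : ω ∈ F k <;> by_cases h2 : ω ∈ F l <;> simp [R, h1, h2]
  have hL : ∫ ω, (∑ k, R k ω) ^ 2 ∂P = ∑ k, ∑ l, ∫ ω, R k ω * R l ω ∂P := by
    simp only [sq, Finset.sum_mul_sum]
    rw [integral_finsetSum _ fun k _ => integrable_finsetSum _ fun l _ => hRR k l]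
    exact Finset.sum_congr rfl fun k _ => integral_finsetSum _ fun l _ => hRR k l
  have hform : ∀ z : Ω × (ℝ≥0 × U),
      M.formFun (∑ k, coef (s k) (t k) (F k) (A k) z.2.1 z.1 z.2.2 • h k)
        (∑ k, coef (s k) (t k) (F k) (A k) z.2.1 z.1 z.2.2 • h k) z.2 = ∑ k, ∑ l, W k l z := by
    intro z
    simp only [W, ← coef_mul_coef_mul]
    simp only [formFun, map_sum, map_smul, sum_apply,
      smul_apply, smul_eq_mul, Finset.mul_sum]
    rw [Finset.sum_comm]
    refine Finset.sum_congr rfl fun k _ => Finset.sum_congr rfl fun l _ => by ring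
  have hI : Integrable (fun z => ∑ k, ∑ l, W k l z) (P.prod (M.base T)) :=
    integrable_finsetSum _ fun k _ => integrable_finsetSum _ fun l _ => hW k l
  have hsq : ∀ y : ℝ, ‖y‖ₑ ^ 2 = ENNReal.ofReal (y ^ 2) := fun y => by
    rw [← ofReal_norm, ← ENNReal.ofReal_pow (norm_nonneg _), Real.norm_eq_abs, sq_abs]
  have hRsum : MemLp (fun ω => ∑ k, R k ω) 2 P := memLp_finsetSum _ fun k _ => hR k
  have e1 : ∫⁻ ω, ‖∑ k, R k ω‖ₑ ^ 2 ∂P = ENNReal.ofReal (∫ ω, (∑ k, R k ω) ^ 2 ∂P) := by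
    rw [ofReal_integral_eq_lintegral_ofReal hRsum.integrable_sq (ae_of_all _ fun _ => sq_nonneg _)]
    exact lintegral_congr fun ω => hsq _
  rw [e1, hL, lintegral_congr fun z => by rw [hform z],
    ← ofReal_integral_eq_lintegral_ofReal hI (ae_of_all _ fun z => ?_)]
  · congr 1
    rw [integral_finsetSum _ fun k _ => integrable_finsetSum _ fun l _ => hW k l]
    refine Finset.sum_congr rfl fun k _ => ?_
    rw [integral_finsetSum _ fun l _ => hW k l]
    exact Finset.sum_congr rfl fun l _ => hRW k l
  · show (0 : ℝ) ≤ ∑ k, ∑ l, W k l z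
    rw [← hform z]
    exact M.formFun_nonneg _ _

end Isometry

/-! ### Simple integrands as predictable fields, and their integrals -/

section Simple

variable [CompleteSpace H] [CompleteSpace G] {M}

/-- The adjoint of S ∘ i_q^* is i_q ∘ S^*, so the values are images of vectors of H and their norms
are given by the form q. -/
lemma adjoint_toFamily (D : SimpleIntegrand M T G) (r : ℝ≥0) (ω : Ω) (u : U) (g : G) :
    ContinuousLinearMap.adjoint (D.toFamily r ω u) g = (M.q r u).incl
      (∑ k : Fin D.n × Fin D.m, coef (D.s k.1) (D.t k.1) (D.F k.1) (D.A k.2) r ω u •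
        ContinuousLinearMap.adjoint (D.S k.1 k.2) g) := by
  rw [Fintype.sum_prod_type]
  simp only [SimpleIntegrand.toFamily, map_sum, map_smul, sum_apply, coef,
    smul_apply, ContinuousLinearMap.adjoint_comp,
    ContinuousLinearMap.adjoint_adjoint, ContinuousLinearMap.comp_apply]

lemma measurable_coef (D : SimpleIntegrand M T G) (k : Fin D.n × Fin D.m) :
    Measurable fun x : PSpace ℱ T U =>
      coef (D.s k.1) (D.t k.1) (D.F k.1) (D.A k.2) x.r x.ω x.u := by
  have h : Measurable ({x : PSpace ℱ T U | (x.r ∈ Set.Ioc (D.s k.1) (D.t k.1) ∧ x.ω ∈ D.F k.1) ∧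
      x.u ∈ D.A k.2}.indicator fun _ => (1 : ℝ)) := measurable_const.indicator
    (PSpace.measurableSet_rect (T := T) (t := D.t k.1) (D.measurable_F k.1)
      (M.measurableSet_of_mem_ring (D.A_mem k.2)))
  classical
  convert h using 2 with x
  by_cases h1 : x.r ∈ Set.Ioc (D.s k.1) (D.t k.1) <;> by_cases h2 : x.ω ∈ D.F k.1 <;>
    by_cases h3 : x.u ∈ D.A k.2 <;>
    simp only [coef, Set.indicator_apply, Set.mem_ofPred_eq, h1, h2, h3] <;> simp

lemma SimpleIntegrand.isPredictable (D : SimpleIntegrand M T G) : IsPredictable T D.toFamily := by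
  intro g
  simp only [adjoint_toFamily, map_sum, map_smul]
  refine isMeasSection_sum _ fun k _ => ?_
  exact (isMeasSection_const (M.measurable_inclField T) _).smul (measurable_coef D k)

variable [IsProbabilityMeasure P] [TopologicalSpace.SeparableSpace H]
  [TopologicalSpace.SeparableSpace G]

lemma lintegral_predMeasure_eq {f : PSpace ℱ T U → ℝ≥0∞} (hf : Measurable f) :
    ∫⁻ x, f x ∂M.predMeasure T = ∫⁻ z, f (PSpace.mk z) ∂P.prod (M.base T) :=
  lintegral_map hf PSpace.measurable_mk

/-- The Itô isometry for simple integrands. -/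
theorem IsSimpleIntegral.lintegral_sq {D : SimpleIntegrand M T G} {X : ℝ≥0 → Ω → G}
    (hX : IsSimpleIntegral D X) :
    ∫⁻ ω, ‖X T ω‖ₑ ^ 2 ∂P = lambdaNormSq T D.toFamily := by
  obtain ⟨Y, hY, hXY⟩ := hX
  obtain ⟨w, b, -⟩ := exists_hilbertBasis ℝ G
  have : Countable w := HilbertBasis.countable_of_separable b
  -- Each coordinate is a finite sum of localised increments, so the scalar isometry applies to it;
  -- summing over the basis gives the Hilbert–Schmidt norm.
  have hXb : ∀ i, ∀ᵐ ω ∂P, ⟪b i, X T ω⟫_ℝ = ∑ k : Fin D.n × Fin D.m, (D.F k.1).indicator 1 ω *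
      M.incr (D.s k.1) (D.t k.1) (D.A k.2) (ContinuousLinearMap.adjoint (D.S k.1 k.2) (b i)) ω := by
    intro i
    have h1 : ∀ k : Fin D.n × Fin D.m, ∀ᵐ ω ∂P, ⟪Y k.1 k.2 T ω, b i⟫_ℝ =
        M.incr (D.s k.1) (D.t k.1) (D.A k.2)
          (ContinuousLinearMap.adjoint (D.S k.1 k.2) (b i)) ω := by
      intro k
      filter_upwards [(hY k.1 k.2).inner_eq T le_rfl (b i), M.coeFn_incr (D.s k.1) (D.t k.1)
        (D.A k.2) (ContinuousLinearMap.adjoint (D.S k.1 k.2) (b i))] with ω h2 h3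
      rw [h2, h3, min_eq_left (D.t_le k.1), min_eq_left ((D.s_lt_t k.1).le.trans (D.t_le k.1))]
    filter_upwards [ae_all_iff.2 h1] with ω hω
    rw [hXY T le_rfl ω, real_inner_comm, sum_inner, Fintype.sum_prod_type]
    refine Finset.sum_congr rfl fun a _ => ?_
    rw [sum_inner]
    refine Finset.sum_congr rfl fun c _ => ?_
    rw [← hω (a, c)]
    by_cases h2 : ω ∈ D.F a <;> simp [h2]
  have hXm : AEStronglyMeasurable (X T) P := by
    have h1 : X T = fun ω => ∑ i, ∑ j, (D.F i).indicator (fun ω' => Y i j T ω') ω :=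
      funext (hXY T le_rfl)
    rw [h1]
    refine Finset.aestronglyMeasurable_fun_sum _ fun i _ =>
      Finset.aestronglyMeasurable_fun_sum _ fun j _ => ?_
    exact (((hY i j).martingale.memLp T le_rfl).1).indicator (ℱ.le _ _ (D.measurable_F i))
  have hsec : ∀ i, Measurable fun x : PSpace ℱ T U =>
      ‖ContinuousLinearMap.adjoint (D.toFamily x.r x.ω x.u) (b i)‖ₑ ^ 2 := fun i =>
    measurable_enorm_sq_section (D.isPredictable (b i))
  calc ∫⁻ ω, ‖X T ω‖ₑ ^ 2 ∂P = ∑' i, ∫⁻ ω, ‖⟪b i, X T ω⟫_ℝ‖ₑ ^ 2 ∂P := by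
        rw [← lintegral_tsum fun i => (hXm.const_inner).enorm.pow_const 2]
        simp only [HilbertBasis.tsum_enorm_inner_sq b]
    _ = ∑' i, ∫⁻ x : PSpace ℱ T U,
          ‖ContinuousLinearMap.adjoint (D.toFamily x.r x.ω x.u) (b i)‖ₑ ^ 2 ∂M.predMeasure T := by
        refine tsum_congr fun i => ?_
        rw [lintegral_sq_congr_ae (hXb i), lintegral_predMeasure_eq (hsec i),
          M.lintegral_sum_incr_sq (T := T) (κ := Fin D.n × Fin D.m) (fun k => (D.s_lt_t k.1).le)
            (fun k => D.t_le k.1) (fun k => D.measurable_F k.1) (fun k => D.A_mem k.2)]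
        have hae : ∀ᵐ z ∂P.prod (M.base T), z.2.1 ∈ Set.Ioc 0 T :=
          Measure.quasiMeasurePreserving_snd.ae (M.ae_base T)
        refine lintegral_congr_ae ?_
        filter_upwards [hae] with z hz
        have h1 : (PSpace.mk z : PSpace ℱ T U).r = z.2.1 := min_eq_left hz.2
        rw [adjoint_toFamily, HilbertianSeminorm.enorm_incl_sq, h1]
        rfl
    _ = ∫⁻ x : PSpace ℱ T U, hsNormSq (D.toFamily x.r x.ω x.u) ∂M.predMeasure T := by
        rw [← lintegral_tsum fun i => (hsec i).aemeasurable]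
        exact lintegral_congr fun x => (hsNormSq_eq_tsum_adjoint b _).symm
    _ = lambdaNormSq T D.toFamily := (lambdaNormSq_eq D.isPredictable).symm

/-- Before s both truncated times equal r, so all pairings vanish, and a countable basis collects
the exceptional sets. This is what `IsSqMartingale.indicator` needs. -/
lemma IsRadonification.ae_eq_zero {s t : ℝ≥0} (hst : s ≤ t) {A : Set U} {S : H →L[ℝ] G}
    {Y : ℝ≥0 → Ω → G} (hY : M.IsRadonification T s t A S Y) {r : ℝ≥0} (hr : r ≤ T) (hrs : r ≤ s) :
    Y r =ᵐ[P] 0 := by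
  obtain ⟨w, b, -⟩ := exists_hilbertBasis ℝ G
  have : Countable w := HilbertBasis.countable_of_separable b
  filter_upwards [ae_all_iff.2 fun i => hY.inner_eq r hr (b i)] with ω hω
  have h : ‖Y r ω‖ₑ ^ 2 = 0 := by
    rw [← HilbertBasis.tsum_enorm_inner_sq b]
    simp only [real_inner_comm, hω, min_eq_right hrs, min_eq_right (hrs.trans hst), sub_self,
      enorm_zero, ne_eq, OfNat.ofNat_ne_zero, not_false_eq_true, zero_pow, tsum_zero]
  simpa using h

lemma IsSimpleIntegral.isSqMartingale (hnull : ∀ s, P s = 0 → MeasurableSet[ℱ 0] s)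
    {D : SimpleIntegrand M T G} {X : ℝ≥0 → Ω → G} (hX : IsSimpleIntegral D X) :
    IsSqMartingale P ℱ T X := by
  have := UniformSpace.secondCountable_of_separable G
  obtain ⟨Y, hY, hXY⟩ := hX
  refine IsSqMartingale.congr_of_le ?_ hXY
  exact isSqMartingale_sum _ fun i _ => isSqMartingale_sum _ fun j _ =>
    (hY i j).martingale.indicator hnull (D.measurable_F i) fun r hr hrs =>
      (hY i j).ae_eq_zero (D.s_lt_t i).le hr hrs

lemma exists_isSimpleIntegral (hnull : ∀ s, P s = 0 → MeasurableSet[ℱ 0] s)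
    (D : SimpleIntegrand M T G) : ∃ X, IsSimpleIntegral D X := by
  choose Y hY using fun i j => M.exists_isRadonification T hnull (D.s_lt_t i).le (D.A_mem j)
    (D.hilbertSchmidt i j)
  exact ⟨_, Y, hY, fun t _ ω => rfl⟩

end Simple

end CylMartingaleMeasure

namespace CylMartingaleMeasure

variable {Ω : Type*} [mΩ : MeasurableSpace Ω] {P : Measure Ω} {ℱ : Filtration ℝ≥0 mΩ}
  {U : Type*} [TopologicalSpace U] [mU : MeasurableSpace U] [BorelSpace U]
  {H : Type*} [NormedAddCommGroup H] [InnerProductSpace ℝ H]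
  {M : CylMartingaleMeasure P ℱ U H} {T : ℝ≥0}
  {G : Type*} [NormedAddCommGroup G] [InnerProductSpace ℝ G]
  {E : Type*} [NormedAddCommGroup E] [InnerProductSpace ℝ E]
  [CompleteSpace H] [CompleteSpace G] [CompleteSpace E]

/-! ### Algebra of simple integrands -/

namespace SimpleIntegrand

/-- The composition of a simple integrand with a continuous linear operator. -/
def comp (R : G →L[ℝ] E) (D : SimpleIntegrand M T G) : SimpleIntegrand M T E where
  n := D.n
  m := D.m
  s := D.s
  t := D.t
  F := D.F
  A := D.A
  S i j := R.comp (D.S i j)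
  s_lt_t := D.s_lt_t
  t_le := D.t_le
  measurable_F := D.measurable_F
  A_mem := D.A_mem
  hilbertSchmidt i j := (hsNormSq_comp_le R _).trans_lt
    (ENNReal.mul_lt_top (ENNReal.pow_lt_top enorm_lt_top) (D.hilbertSchmidt i j))

lemma toFamily_comp (R : G →L[ℝ] E) (D : SimpleIntegrand M T G) (r : ℝ≥0) (ω : Ω) (u : U) :
    (D.comp R).toFamily r ω u = R.comp (D.toFamily r ω u) := by
  ext y
  simp only [toFamily, comp, sum_apply, smul_apply, ContinuousLinearMap.comp_apply, map_sum,
    map_smul]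
  rfl

/-- The sum of two simple integrands. -/
def add (D D' : SimpleIntegrand M T G) : SimpleIntegrand M T G where
  n := D.n + D'.n
  m := D.m + D'.m
  s := Fin.append D.s D'.s
  t := Fin.append D.t D'.t
  F := Fin.append D.F D'.F
  A := Fin.append D.A D'.A
  -- The sum runs over a product of indices, so the two arrays are placed as diagonal blocks, with
  -- zero operators elsewhere.
  S := Fin.append (fun i => Fin.append (D.S i) fun _ => 0)
    (fun i => Fin.append (fun _ => 0) (D'.S i))
  s_lt_t := Fin.addCases (fun i => by simpa using D.s_lt_t i) fun i => by simpa using D'.s_lt_t i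
  t_le := Fin.addCases (fun i => by simpa using D.t_le i) fun i => by simpa using D'.t_le i
  measurable_F := Fin.addCases
    (fun i => by rw [Fin.append_left, Fin.append_left]; exact D.measurable_F i)
    fun i => by rw [Fin.append_right, Fin.append_right]; exact D'.measurable_F i
  A_mem := Fin.addCases (fun i => by simpa using D.A_mem i) fun i => by simpa using D'.A_mem i
  hilbertSchmidt := by
    have h0 : IsHilbertSchmidt (0 : H →L[ℝ] G) := by simp [IsHilbertSchmidt, hsNormSq_zero]
    refine Fin.addCases (fun i => Fin.addCases (fun j => ?_) fun j => ?_)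
      fun i => Fin.addCases (fun j => ?_) fun j => ?_
    · simpa using D.hilbertSchmidt i j
    · simpa using h0
    · simpa using h0
    · simpa using D'.hilbertSchmidt i j

lemma toFamily_add (D D' : SimpleIntegrand M T G) (r : ℝ≥0) (ω : Ω) (u : U) :
    (D.add D').toFamily r ω u = D.toFamily r ω u + D'.toFamily r ω u := by
  have h : (D.add D').toFamily r ω u = ∑ i : Fin (D.n + D'.n), ∑ j : Fin (D.m + D'.m),
      ((Set.Ioc (Fin.append D.s D'.s i) (Fin.append D.t D'.t i)).indicator (fun _ => (1 : ℝ)) r *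
        (Fin.append D.F D'.F i).indicator (fun _ => (1 : ℝ)) ω *
        (Fin.append D.A D'.A j).indicator (fun _ => (1 : ℝ)) u) •
      (Fin.append (fun i => Fin.append (D.S i) fun _ => 0)
        (fun i => Fin.append (fun _ => 0) (D'.S i)) i j).comp
        (ContinuousLinearMap.adjoint (M.q r u).incl) := rfl
  rw [h]
  simp only [toFamily, Fin.sum_univ_add, Fin.append_left, Fin.append_right,
    ContinuousLinearMap.zero_comp, smul_zero, Finset.sum_const_zero, add_zero, zero_add]

/-- The difference of two simple integrands. -/
def sub (D D' : SimpleIntegrand M T G) : SimpleIntegrand M T G :=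
  D.add (D'.comp (-ContinuousLinearMap.id ℝ G))

lemma toFamily_sub (D D' : SimpleIntegrand M T G) (r : ℝ≥0) (ω : Ω) (u : U) :
    (D.sub D').toFamily r ω u = D.toFamily r ω u - D'.toFamily r ω u := by
  rw [sub, toFamily_add, toFamily_comp, ContinuousLinearMap.neg_comp, ContinuousLinearMap.id_comp,
    sub_eq_add_neg]

end SimpleIntegrand

variable [IsProbabilityMeasure P]

lemma IsRadonification.clm {s t : ℝ≥0} {A : Set U} {S : H →L[ℝ] G} {Y : ℝ≥0 → Ω → G}
    (hY : M.IsRadonification T s t A S Y) (R : G →L[ℝ] E) :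
    M.IsRadonification T s t A (R.comp S) fun r ω => R (Y r ω) where
  martingale := hY.martingale.clm R
  inner_eq r hr g := by
    filter_upwards [hY.inner_eq r hr (ContinuousLinearMap.adjoint R g)] with ω hω
    rw [ContinuousLinearMap.adjoint_inner_right] at hω
    rw [hω, ContinuousLinearMap.adjoint_comp, ContinuousLinearMap.comp_apply]

lemma isRadonification_zero (s t : ℝ≥0) (A : Set U) :
    M.IsRadonification T s t A (0 : H →L[ℝ] G) 0 where
  martingale := isSqMartingale_zero
  inner_eq r _ g := by
    filter_upwards [AEEqFun.coeFn_zero (α := Ω) (β := ℝ) (μ := P)] with ω hω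
    simp [hω]

lemma IsSimpleIntegral.comp {D : SimpleIntegrand M T G} {X : ℝ≥0 → Ω → G}
    (hX : IsSimpleIntegral D X) (R : G →L[ℝ] E) :
    IsSimpleIntegral (D.comp R) fun t ω => R (X t ω) := by
  obtain ⟨Y, hY, hXY⟩ := hX
  refine ⟨fun i j t ω => R (Y i j t ω), fun i j => (hY i j).clm R, fun t ht ω => ?_⟩
  simp only [hXY t ht ω, map_sum]
  refine Finset.sum_congr rfl fun i _ => Finset.sum_congr rfl fun j _ => ?_
  by_cases h : ω ∈ D.F i
  · rw [Set.indicator_of_mem h]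
    exact (Set.indicator_of_mem (s := D.F i) h fun ω' => R (Y i j t ω')).symm
  · rw [Set.indicator_of_notMem h, map_zero]
    exact (Set.indicator_of_notMem (s := D.F i) h fun ω' => R (Y i j t ω')).symm

lemma IsSimpleIntegral.add {D D' : SimpleIntegrand M T G} {X X' : ℝ≥0 → Ω → G}
    (hX : IsSimpleIntegral D X) (hX' : IsSimpleIntegral D' X') :
    IsSimpleIntegral (D.add D') fun t ω => X t ω + X' t ω := by
  obtain ⟨Y, hY, hXY⟩ := hX
  obtain ⟨Y', hY', hXY'⟩ := hX'
  let Z : Fin (D.n + D'.n) → Fin (D.m + D'.m) → ℝ≥0 → Ω → G :=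
    Fin.append (fun i => Fin.append (Y i) fun _ => (0 : ℝ≥0 → Ω → G))
      (fun i => Fin.append (fun _ => (0 : ℝ≥0 → Ω → G)) (Y' i))
  refine ⟨Z, ?_, fun t ht ω => ?_⟩
  · refine Fin.addCases (fun i => Fin.addCases (fun j => ?_) fun j => ?_)
      fun i => Fin.addCases (fun j => ?_) fun j => ?_
    · simpa [SimpleIntegrand.add, Z] using hY i j
    · simpa [SimpleIntegrand.add, Z] using isRadonification_zero _ _ _
    · simpa [SimpleIntegrand.add, Z] using isRadonification_zero _ _ _
    · simpa [SimpleIntegrand.add, Z] using hY' i j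
  · show _ = ∑ i : Fin (D.n + D'.n), ∑ j : Fin (D.m + D'.m),
      (Fin.append D.F D'.F i).indicator (fun ω' => Z i j t ω') ω
    simp only [Z, Fin.sum_univ_add, Fin.append_left, Fin.append_right, hXY t ht ω, hXY' t ht ω,
      Pi.zero_apply, Set.indicator_zero, Finset.sum_const_zero, add_zero, zero_add]

lemma IsSimpleIntegral.sub {D D' : SimpleIntegrand M T G} {X X' : ℝ≥0 → Ω → G}
    (hX : IsSimpleIntegral D X) (hX' : IsSimpleIntegral D' X') :
    IsSimpleIntegral (D.sub D') fun t ω => X t ω - X' t ω := by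
  have h := hX.add (hX'.comp (-ContinuousLinearMap.id ℝ G))
  simpa [SimpleIntegrand.sub, sub_eq_add_neg] using h

variable [TopologicalSpace.SeparableSpace H] [TopologicalSpace.SeparableSpace G]

/-- The difference is again the integral of a simple integrand: Doob's inequality gives the 8 and
the isometry the norm. -/
lemma IsSimpleIntegral.martNormSq_sub_le (hnull : ∀ s, P s = 0 → MeasurableSet[ℱ 0] s)
    {D D' : SimpleIntegrand M T G} {X X' : ℝ≥0 → Ω → G}
    (hX : IsSimpleIntegral D X) (hX' : IsSimpleIntegral D' X') :
    martNormSq P T (fun t ω => X t ω - X' t ω) ≤ 8 * lambdaNormSq T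
      (fun r ω u => D.toFamily r ω u - D'.toFamily r ω u : M.OperatorFamily G) := by
  have h := hX.sub hX'
  have h1 := (h.isSqMartingale hnull).martNormSq_le
  rw [h.lintegral_sq] at h1
  have e : (D.sub D').toFamily = fun r ω u => D.toFamily r ω u - D'.toFamily r ω u := by
    funext r ω u
    exact D.toFamily_sub D' r ω u
  rwa [e] at h1

end CylMartingaleMeasure

namespace CylMartingaleMeasure

variable {Ω : Type*} [mΩ : MeasurableSpace Ω] {P : Measure Ω} {ℱ : Filtration ℝ≥0 mΩ}
  {U : Type*} [TopologicalSpace U] [mU : MeasurableSpace U] [BorelSpace U]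
  {H : Type*} [NormedAddCommGroup H] [InnerProductSpace ℝ H]
  (M : CylMartingaleMeasure P ℱ U H) (T : ℝ≥0)

/-! ### A generating `π`-system of the predictable product space -/

section Rectangles

/-- The predictable rectangles `(s, T] × F × A` and `{0} × F × A`. -/
inductive IsPredRect : Set (PSpace ℱ T U) → Prop
  | Ioi (s : ℝ≥0) (F : Set Ω) (A : Set U) (hF : MeasurableSet[ℱ s] F)
      (hA : A ∈ M.ring ∨ A = Set.univ) : IsPredRect {x | s < x.r ∧ x.ω ∈ F ∧ x.u ∈ A}
  | zero (F : Set Ω) (A : Set U) (hF : MeasurableSet[ℱ 0] F)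
      (hA : A ∈ M.ring ∨ A = Set.univ) : IsPredRect {x | x.r = 0 ∧ x.ω ∈ F ∧ x.u ∈ A}

variable {T}

lemma inter_mem_ring_or {A B : Set U} (hA : A ∈ M.ring ∨ A = Set.univ)
    (hB : B ∈ M.ring ∨ B = Set.univ) : A ∩ B ∈ M.ring ∨ A ∩ B = Set.univ := by
  rcases hA with hA | rfl
  · rcases hB with hB | rfl
    · exact Or.inl (M.isSetRing.inter_mem hA hB)
    · rw [Set.inter_univ]; exact Or.inl hA
  · rwa [Set.univ_inter]

/-- Rectangles of the same kind intersect in that kind; mixed ones are disjoint, a case excluded by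
the definition of a π-system. -/
lemma isPiSystem_isPredRect : IsPiSystem {C : Set (PSpace ℱ T U) | M.IsPredRect T C} := by
  rintro _ (⟨s, F, A, hF, hA⟩ | ⟨F, A, hF, hA⟩) _ (⟨s', F', A', hF', hA'⟩ | ⟨F', A', hF', hA'⟩) hne
  · have h := IsPredRect.Ioi (M := M) (T := T) (s ⊔ s') (F ∩ F') (A ∩ A')
      ((ℱ.mono le_sup_left _ hF).inter (ℱ.mono le_sup_right _ hF')) (M.inter_mem_ring_or hA hA')
    refine (congrArg (M.IsPredRect T) (Set.ext fun x => ?_)).mp h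
    show s ⊔ s' < x.r ∧ x.ω ∈ F ∩ F' ∧ x.u ∈ A ∩ A' ↔
      (s < x.r ∧ x.ω ∈ F ∧ x.u ∈ A) ∧ (s' < x.r ∧ x.ω ∈ F' ∧ x.u ∈ A')
    simp only [sup_lt_iff, Set.mem_inter_iff]
    tauto
  · obtain ⟨x, ⟨h1, -⟩, ⟨h2, -⟩⟩ := hne
    exact absurd h1 (by rw [h2]; exact not_lt_zero)
  · obtain ⟨x, ⟨h2, -⟩, ⟨h1, -⟩⟩ := hne
    exact absurd h1 (by rw [h2]; exact not_lt_zero)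
  · have h := IsPredRect.zero (M := M) (T := T) (F ∩ F') (A ∩ A') (hF.inter hF')
      (M.inter_mem_ring_or hA hA')
    refine (congrArg (M.IsPredRect T) (Set.ext fun x => ?_)).mp h
    show x.r = 0 ∧ x.ω ∈ F ∩ F' ∧ x.u ∈ A ∩ A' ↔
      (x.r = 0 ∧ x.ω ∈ F ∧ x.u ∈ A) ∧ (x.r = 0 ∧ x.ω ∈ F' ∧ x.u ∈ A')
    simp only [Set.mem_inter_iff]
    tauto

/-- Allowing A = U, which need not be in the ring, recovers the predictable generators; with F = Ω,
uniting time 0 with (0, T] recovers the sets of marks. -/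
lemma generateFrom_isPredRect : (inferInstance : MeasurableSpace (PSpace ℱ T U)) =
    MeasurableSpace.generateFrom {C : Set (PSpace ℱ T U) | M.IsPredRect T C} := by
  refine le_antisymm ?_ (MeasurableSpace.generateFrom_le ?_)
  · set m' := MeasurableSpace.generateFrom {C : Set (PSpace ℱ T U) | M.IsPredRect T C}
    have h1 : ℱ.predictable ≤ m'.map fun x => (x.r, x.ω) := by
      refine measurableSpace_le_predictable_of_measurableSet (fun F hF => ?_) fun s F hF => ?_
      · refine MeasurableSpace.measurableSet_generateFrom ?_
        have h := IsPredRect.zero (M := M) (T := T) F Set.univ hF (Or.inr rfl)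
        refine (congrArg (M.IsPredRect T) (Set.ext fun x => ?_)).mp h
        show x.r = 0 ∧ x.ω ∈ F ∧ x.u ∈ Set.univ ↔ x.r = 0 ∧ x.ω ∈ F
        simp
      · refine MeasurableSpace.measurableSet_generateFrom ?_
        have h := IsPredRect.Ioi (M := M) (T := T) s F Set.univ hF (Or.inr rfl)
        refine (congrArg (M.IsPredRect T) (Set.ext fun x => ?_)).mp h
        show s < x.r ∧ x.ω ∈ F ∧ x.u ∈ Set.univ ↔ s < x.r ∧ x.ω ∈ F
        simp
    have h2 : mU ≤ m'.map PSpace.u := by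
      rw [M.generate]
      refine MeasurableSpace.generateFrom_le fun A hA => ?_
      have h3 := IsPredRect.zero (M := M) (T := T) Set.univ A MeasurableSet.univ (Or.inl hA)
      have h4 := IsPredRect.Ioi (M := M) (T := T) 0 Set.univ A MeasurableSet.univ (Or.inl hA)
      have h5 := (MeasurableSpace.measurableSet_generateFrom (s := {C | M.IsPredRect T C}) h3).union
        (MeasurableSpace.measurableSet_generateFrom (s := {C | M.IsPredRect T C}) h4)
      refine (congrArg (MeasurableSet[m']) (Set.ext fun x => ?_)).mp h5
      show (x.r = 0 ∧ x.ω ∈ Set.univ ∧ x.u ∈ A) ∨ (0 < x.r ∧ x.ω ∈ Set.univ ∧ x.u ∈ A) ↔ x.u ∈ A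
      have := eq_zero_or_pos x.r
      simp only [Set.mem_univ, true_and]
      tauto
    refine sup_le ?_ (MeasurableSpace.comap_le_iff_le_map.2 h2)
    rw [MeasurableSpace.comap_comp]
    exact MeasurableSpace.comap_le_iff_le_map.2 h1
  · rintro _ (⟨s, F, A, hF, hA⟩ | ⟨F, A, hF, hA⟩)
    · have hA' : MeasurableSet A := by
        rcases hA with hA | rfl
        exacts [M.measurableSet_of_mem_ring hA, MeasurableSet.univ]
      have h := (PSpace.measurableSet_preimage_rω (T := T) (U := U)
        (measurableSet_predictable_Ioi_prod hF)).inter (PSpace.measurable_u hA')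
      refine (congrArg MeasurableSet (Set.ext fun x => ?_)).mp h
      exact and_assoc
    · have hA' : MeasurableSet A := by
        rcases hA with hA | rfl
        exacts [M.measurableSet_of_mem_ring hA, MeasurableSet.univ]
      have h := (PSpace.measurableSet_preimage_rω (T := T) (U := U)
        (measurableSet_predictable_singleton_bot_prod hF)).inter (PSpace.measurable_u hA')
      refine (congrArg MeasurableSet (Set.ext fun x => ?_)).mp h
      exact and_assoc

variable [IsProbabilityMeasure P]

lemma ae_predMeasure_pos : ∀ᵐ x ∂M.predMeasure T, 0 < x.r := by
  refine (ae_map_iff PSpace.measurable_mk.aemeasurable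
    (PSpace.measurable_r measurableSet_Ioi)).2 ?_
  have hae : ∀ᵐ z ∂P.prod (M.base T), z.2.1 ∈ Set.Ioc 0 T :=
    Measure.quasiMeasurePreserving_snd.ae (M.ae_base T)
  filter_upwards [hae] with z hz
  exact lt_min hz.1 (hz.1.trans_le hz.2)

lemma ae_predMeasure_u {p : U → Prop} (hp : MeasurableSet {u | p u}) (h : ∀ᵐ u ∂M.μ, p u) :
    ∀ᵐ x ∂M.predMeasure T, p x.u := by
  refine (ae_map_iff PSpace.measurable_mk.aemeasurable (PSpace.measurable_u hp)).2 ?_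
  have h1 : ∀ᵐ y ∂M.base T, p y.2 := Measure.quasiMeasurePreserving_snd.ae h
  exact Measure.quasiMeasurePreserving_snd.ae h1

end Rectangles

end CylMartingaleMeasure

namespace CylMartingaleMeasure

variable {Ω : Type*} [mΩ : MeasurableSpace Ω] {P : Measure Ω} {ℱ : Filtration ℝ≥0 mΩ}
  {U : Type*} [TopologicalSpace U] [mU : MeasurableSpace U] [BorelSpace U]
  {H : Type*} [NormedAddCommGroup H] [InnerProductSpace ℝ H]
  {M : CylMartingaleMeasure P ℱ U H} {T : ℝ≥0} [CompleteSpace H]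

/-! ### Approximation of predictable sections by scalar simple integrands -/

/-- The section `D^* 1` given by a real-valued simple integrand `D`. -/
def SimpleIntegrand.sec (D : SimpleIntegrand M T ℝ) (x : PSpace ℱ T U) : (M.q x.r x.u).Space :=
  ContinuousLinearMap.adjoint (D.toFamily x.r x.ω x.u) (1 : ℝ)

/-- The simple integrand `0`. -/
def SimpleIntegrand.zero (M : CylMartingaleMeasure P ℱ U H) (T : ℝ≥0) (G : Type*)
    [NormedAddCommGroup G] [InnerProductSpace ℝ G] : SimpleIntegrand M T G where
  n := 0
  m := 0
  s := Fin.elim0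
  t := Fin.elim0
  F := Fin.elim0
  A := Fin.elim0
  S := Fin.elim0
  s_lt_t i := i.elim0
  t_le i := i.elim0
  measurable_F i := i.elim0
  A_mem i := i.elim0
  hilbertSchmidt i := i.elim0

lemma SimpleIntegrand.toFamily_zero {G : Type*} [NormedAddCommGroup G] [InnerProductSpace ℝ G]
    [CompleteSpace G] (r : ℝ≥0) (ω : Ω) (u : U) :
    (SimpleIntegrand.zero M T G).toFamily r ω u = 0 :=
  Finset.sum_of_isEmpty (ι := Fin 0) _

lemma isHilbertSchmidt_innerSL (h : H) : IsHilbertSchmidt (innerSL ℝ h) := by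
  have hb := (exists_hilbertBasis ℝ H).choose_spec
  obtain ⟨b, hb⟩ := hb
  have h1 : hsNormSq (innerSL ℝ h) = ‖h‖ₑ ^ 2 := by
    rw [← HilbertBasis.tsum_enorm_inner_sq b h]
    refine tsum_congr fun i => ?_
    rw [hb, innerSL_apply_apply, real_inner_comm]
  rw [IsHilbertSchmidt, h1]
  exact ENNReal.pow_lt_top enorm_lt_top

/-- The real-valued simple integrand `1_{(s, T]}(r) 1_F(ω) 1_A(u) ⟪h, ·⟫`. -/
def SimpleIntegrand.single (M : CylMartingaleMeasure P ℱ U H) {s T : ℝ≥0} (hs : s < T) {F : Set Ω}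
    (hF : MeasurableSet[ℱ s] F) {A : Set U} (hA : A ∈ M.ring) (h : H) : SimpleIntegrand M T ℝ where
  n := 1
  m := 1
  s _ := s
  t _ := T
  F _ := F
  A _ := A
  S _ _ := innerSL ℝ h
  s_lt_t _ := hs
  t_le _ := le_rfl
  measurable_F _ := hF
  A_mem _ := hA
  hilbertSchmidt _ _ := isHilbertSchmidt_innerSL h

lemma adjoint_innerSL_one (h : H) : ContinuousLinearMap.adjoint (innerSL ℝ h) (1 : ℝ) = h := by
  refine ext_inner_right ℝ fun v => ?_
  rw [ContinuousLinearMap.adjoint_inner_left, innerSL_apply_apply]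
  simp

lemma SimpleIntegrand.sec_single {s : ℝ≥0} (hs : s < T) {F : Set Ω}
    (hF : MeasurableSet[ℱ s] F) {A : Set U} (hA : A ∈ M.ring) (h : H) (x : PSpace ℱ T U) :
    (SimpleIntegrand.single M hs hF hA h).sec x =
      coef s T F A x.r x.ω x.u • M.inclField x h := by
  rw [SimpleIntegrand.sec, adjoint_toFamily]
  have h1 : (∑ k : Fin 1 × Fin 1, coef s T F A x.r x.ω x.u •
      ContinuousLinearMap.adjoint (innerSL ℝ h) (1 : ℝ)) = coef s T F A x.r x.ω x.u • h := by
    rw [adjoint_innerSL_one]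
    simp
  exact (congrArg (M.q x.r x.u).incl h1).trans (map_smul _ _ _)

variable [TopologicalSpace.SeparableSpace H]

/-- A measurable section that is a limit, in the `L²` sense, of sections of simple integrands. -/
structure IsApprox (φ : ∀ x : PSpace ℱ T U, (M.q x.r x.u).Space) : Prop where
  meas : IsMeasSection (fun x : PSpace ℱ T U => M.inclField x) φ
  approx : ∀ ε ≠ 0, ∃ D : SimpleIntegrand M T ℝ,
    ∫⁻ x, ‖φ x - D.sec x‖ₑ ^ 2 ∂M.predMeasure T ≤ ε

lemma SimpleIntegrand.isMeasSection_sec (D : SimpleIntegrand M T ℝ) :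
    IsMeasSection (fun x : PSpace ℱ T U => M.inclField x) D.sec :=
  D.isPredictable (1 : ℝ)

lemma SimpleIntegrand.isApprox_sec (D : SimpleIntegrand M T ℝ) : IsApprox D.sec :=
  ⟨D.isMeasSection_sec, fun ε _ => ⟨D, by simp⟩⟩

lemma lintegral_sq_sub_le {φ ψ χ : ∀ x : PSpace ℱ T U, (M.q x.r x.u).Space}
    (hφ : IsMeasSection (fun x : PSpace ℱ T U => M.inclField x) φ)
    (hψ : IsMeasSection (fun x : PSpace ℱ T U => M.inclField x) ψ) :
    ∫⁻ x, ‖φ x - χ x‖ₑ ^ 2 ∂M.predMeasure T ≤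
      2 * ∫⁻ x, ‖φ x - ψ x‖ₑ ^ 2 ∂M.predMeasure T +
      2 * ∫⁻ x, ‖ψ x - χ x‖ₑ ^ 2 ∂M.predMeasure T := by
  rw [← lintegral_const_mul' _ _ ENNReal.ofNat_ne_top,
    ← lintegral_const_mul' _ _ ENNReal.ofNat_ne_top,
    ← lintegral_add_left ((measurable_enorm_sq_section (hφ.sub hψ)).const_mul 2)]
  refine lintegral_mono fun x => ?_
  have h := enorm_sub_sq_le (φ x - ψ x) 0 (χ x - ψ x)
  simp only [sub_zero, zero_sub, neg_sub, sub_sub_sub_cancel_right] at h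
  exact h

lemma two_mul_div_four_add {ε : ℝ≥0∞} : 2 * (ε / 4) + 2 * (ε / 4) = ε := by
  rw [← two_mul, ← mul_assoc]
  norm_num
  exact ENNReal.mul_div_cancel (by norm_num) (by norm_num)

variable {φ ψ : ∀ x : PSpace ℱ T U, (M.q x.r x.u).Space}

/-- The approximable sections are closed. Squared errors add with coefficients 2, hence the choice
ε/4. -/
lemma isApprox_of_approx (hφ : IsMeasSection (fun x : PSpace ℱ T U => M.inclField x) φ)
    (h : ∀ ε ≠ 0, ∃ ψ, IsApprox ψ ∧ ∫⁻ x, ‖φ x - ψ x‖ₑ ^ 2 ∂M.predMeasure T ≤ ε) :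
    IsApprox φ := by
  refine ⟨hφ, fun ε hε => ?_⟩
  have hε' : ε / 4 ≠ 0 := ENNReal.div_ne_zero.2 ⟨hε, by norm_num⟩
  obtain ⟨ψ, hψ, hφψ⟩ := h _ hε'
  obtain ⟨D, hD⟩ := hψ.approx _ hε'
  refine ⟨D, (lintegral_sq_sub_le hφ hψ.meas).trans ?_⟩
  calc _ ≤ 2 * (ε / 4) + 2 * (ε / 4) := by gcongr
    _ = ε := two_mul_div_four_add

lemma IsApprox.congr_ae (hψ : IsApprox ψ)
    (hφ : IsMeasSection (fun x : PSpace ℱ T U => M.inclField x) φ)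
    (h : ∀ᵐ x ∂M.predMeasure T, φ x = ψ x) : IsApprox φ := by
  refine isApprox_of_approx hφ fun ε _ => ⟨ψ, hψ, ?_⟩
  rw [lintegral_congr_ae (g := fun _ => 0)]
  · simp
  · filter_upwards [h] with x hx
    simp [hx]

lemma IsApprox.add (hφ : IsApprox φ) (hψ : IsApprox ψ) : IsApprox fun x => φ x + ψ x := by
  refine ⟨hφ.meas.add hψ.meas, fun ε hε => ?_⟩
  have hε' : ε / 4 ≠ 0 := ENNReal.div_ne_zero.2 ⟨hε, by norm_num⟩
  obtain ⟨D, hD⟩ := hφ.approx _ hε'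
  obtain ⟨D', hD'⟩ := hψ.approx _ hε'
  refine ⟨D.add D', ?_⟩
  have hsec : ∀ x, (D.add D').sec x = D.sec x + D'.sec x := fun x => by
    simp only [SimpleIntegrand.sec, SimpleIntegrand.toFamily_add, map_add, add_apply]
  calc ∫⁻ x, ‖φ x + ψ x - (D.add D').sec x‖ₑ ^ 2 ∂M.predMeasure T
      ≤ ∫⁻ x, 2 * ‖φ x - D.sec x‖ₑ ^ 2 + 2 * ‖ψ x - D'.sec x‖ₑ ^ 2 ∂M.predMeasure T := by
        refine lintegral_mono fun x => ?_
        have h := enorm_sub_sq_le (φ x - D.sec x) 0 (-(ψ x - D'.sec x))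
        simp only [sub_zero, zero_add, sub_neg_eq_add] at h
        simp only [hsec]
        rwa [add_sub_add_comm]
    _ = 2 * ∫⁻ x, ‖φ x - D.sec x‖ₑ ^ 2 ∂M.predMeasure T +
          2 * ∫⁻ x, ‖ψ x - D'.sec x‖ₑ ^ 2 ∂M.predMeasure T := by
        rw [lintegral_add_left
          ((measurable_enorm_sq_section (hφ.meas.sub D.isMeasSection_sec)).const_mul 2),
          lintegral_const_mul' _ _ ENNReal.ofNat_ne_top,
          lintegral_const_mul' _ _ ENNReal.ofNat_ne_top]
    _ ≤ 2 * (ε / 4) + 2 * (ε / 4) := by gcongr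
    _ = ε := two_mul_div_four_add

lemma isApprox_zero : IsApprox (fun x : PSpace ℱ T U => (0 : (M.q x.r x.u).Space)) := by
  convert (SimpleIntegrand.zero M T ℝ).isApprox_sec using 2 with x
  rw [SimpleIntegrand.sec, SimpleIntegrand.toFamily_zero, map_zero, zero_apply]

lemma IsApprox.neg (hφ : IsApprox φ) : IsApprox fun x => -φ x := by
  refine ⟨?_, fun ε hε => ?_⟩
  · have h := hφ.meas.smul (measurable_const (a := (-1 : ℝ)))
    simpa only [neg_smul, one_smul] using h
  · obtain ⟨D, hD⟩ := hφ.approx ε hε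
    refine ⟨D.comp (-ContinuousLinearMap.id ℝ ℝ), le_of_eq_of_le ?_ hD⟩
    refine lintegral_congr fun x => ?_
    have hsec : (D.comp (-ContinuousLinearMap.id ℝ ℝ)).sec x = -D.sec x := by
      simp only [SimpleIntegrand.sec, SimpleIntegrand.toFamily_comp,
        ContinuousLinearMap.neg_comp, ContinuousLinearMap.id_comp, map_neg, neg_apply]
    rw [hsec, ← neg_sub', enorm_neg]

lemma isApprox_sum {ι : Type*} (s : Finset ι) {φ : ι → ∀ x : PSpace ℱ T U, (M.q x.r x.u).Space}
    (hφ : ∀ i ∈ s, IsApprox (φ i)) : IsApprox fun x => ∑ i ∈ s, φ i x := by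
  classical
  induction s using Finset.induction_on with
  | empty => simpa using isApprox_zero
  | insert a s ha ih =>
    simp only [Finset.sum_insert ha]
    exact (hφ a (Finset.mem_insert_self _ _)).add
      (ih fun i hi => hφ i (Finset.mem_insert_of_mem hi))

/-- Truncation of a section to a set. -/
def cut (B : Set (PSpace ℱ T U)) (φ : ∀ x : PSpace ℱ T U, (M.q x.r x.u).Space)
    (x : PSpace ℱ T U) : (M.q x.r x.u).Space := B.indicator (fun _ => (1 : ℝ)) x • φ x

lemma cut_of_mem {B : Set (PSpace ℱ T U)} {x : PSpace ℱ T U} (hx : x ∈ B) : cut B φ x = φ x := by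
  rw [cut, Set.indicator_of_mem hx, one_smul]

lemma cut_of_notMem {B : Set (PSpace ℱ T U)} {x : PSpace ℱ T U} (hx : x ∉ B) :
    cut B φ x = 0 := by
  rw [cut, Set.indicator_of_notMem hx, zero_smul]

lemma isMeasSection_cut (hφ : IsMeasSection (fun x : PSpace ℱ T U => M.inclField x) φ)
    {B : Set (PSpace ℱ T U)} (hB : MeasurableSet B) :
    IsMeasSection (fun x : PSpace ℱ T U => M.inclField x) (cut B φ) :=
  hφ.smul (measurable_const.indicator hB)

/-- Dominated convergence with bound ‖φ‖²; the sets need only exhaust, almost everywhere, the points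
where φ ≠ 0. -/
lemma exists_lintegral_sub_cut_le
    (hφ : IsMeasSection (fun x : PSpace ℱ T U => M.inclField x) φ)
    (hfin : ∫⁻ x, ‖φ x‖ₑ ^ 2 ∂M.predMeasure T ≠ ∞) {S : ℕ → Set (PSpace ℱ T U)}
    (hS : ∀ n, MeasurableSet (S n)) (hmono : Monotone S)
    (hcov : ∀ᵐ x ∂M.predMeasure T, φ x ≠ 0 → ∃ n, x ∈ S n) {ε : ℝ≥0∞} (hε : ε ≠ 0) :
    ∃ n, ∫⁻ x, ‖φ x - cut (S n) φ x‖ₑ ^ 2 ∂M.predMeasure T ≤ ε := by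
  have hlim : Tendsto (fun n => ∫⁻ x, ‖φ x - cut (S n) φ x‖ₑ ^ 2 ∂M.predMeasure T) atTop
      (𝓝 (∫⁻ _, 0 ∂M.predMeasure T)) := by
    refine tendsto_lintegral_of_dominated_convergence (fun x => ‖φ x‖ₑ ^ 2)
      (fun n => measurable_enorm_sq_section (hφ.sub (isMeasSection_cut hφ (hS n))))
      (fun n => ae_of_all _ fun x => ?_) hfin ?_
    · by_cases hx : x ∈ S n
      · simp [cut_of_mem hx]
      · simp [cut_of_notMem hx]
    · filter_upwards [hcov] with x hx
      by_cases h0 : φ x = 0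
      · simp [cut, h0]
      · obtain ⟨n, hn⟩ := hx h0
        refine tendsto_const_nhds.congr' ?_
        filter_upwards [eventually_ge_atTop n] with m hm
        simp [cut_of_mem (hmono hm hn)]
  rw [lintegral_zero] at hlim
  obtain ⟨n, hn⟩ := (hlim.eventually (ge_mem_nhds (pos_iff_ne_zero.2 hε))).exists
  exact ⟨n, hn⟩

lemma isApprox_of_cut (hφ : IsMeasSection (fun x : PSpace ℱ T U => M.inclField x) φ)
    (hfin : ∫⁻ x, ‖φ x‖ₑ ^ 2 ∂M.predMeasure T ≠ ∞) {S : ℕ → Set (PSpace ℱ T U)}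
    (hS : ∀ n, MeasurableSet (S n)) (hmono : Monotone S)
    (hcov : ∀ᵐ x ∂M.predMeasure T, φ x ≠ 0 → ∃ n, x ∈ S n)
    (h : ∀ n, IsApprox (cut (S n) φ)) : IsApprox φ := by
  refine isApprox_of_approx hφ fun ε hε => ?_
  obtain ⟨n, hn⟩ := exists_lintegral_sub_cut_le hφ hfin hS hmono hcov hε
  exact ⟨_, h n, hn⟩

end CylMartingaleMeasure

/-! ### Density of simple sections among square integrable predictable sections -/

namespace CylMartingaleMeasure

variable {Ω : Type*} [mΩ : MeasurableSpace Ω] {P : Measure Ω} {ℱ : Filtration ℝ≥0 mΩ}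
  {U : Type*} [TopologicalSpace U] [mU : MeasurableSpace U] [BorelSpace U]
  {H : Type*} [NormedAddCommGroup H] [InnerProductSpace ℝ H]
  {M : CylMartingaleMeasure P ℱ U H} {T : ℝ≥0} [CompleteSpace H]
  [TopologicalSpace.SeparableSpace H]

lemma sum_cut_of_mem {φ : ℕ → ∀ x : PSpace ℱ T U, (M.q x.r x.u).Space}
    {B : ℕ → Set (PSpace ℱ T U)} (hB : Pairwise (Function.onFun Disjoint B)) {x : PSpace ℱ T U}
    {n k : ℕ} (hk : k < n) (hx : x ∈ B k) : ∑ j ∈ Finset.range n, cut (B j) (φ j) x = φ k x := by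
  rw [Finset.sum_eq_single k, cut_of_mem hx]
  · intro j _ hj
    exact cut_of_notMem fun hxj => Set.disjoint_left.1 (hB hj) hxj hx
  · intro h
    exact absurd (Finset.mem_range.2 hk) h

lemma sum_cut_of_notMem {φ : ℕ → ∀ x : PSpace ℱ T U, (M.q x.r x.u).Space}
    {B : ℕ → Set (PSpace ℱ T U)} {x : PSpace ℱ T U} {n : ℕ} (hx : ∀ k < n, x ∉ B k) :
    ∑ j ∈ Finset.range n, cut (B j) (φ j) x = 0 :=
  Finset.sum_eq_zero fun k hk => cut_of_notMem (hx k (Finset.mem_range.1 hk))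

lemma mem_biUnion_range {X : Type*} {B : ℕ → Set X} {x : X} {n : ℕ} :
    x ∈ ⋃ k ∈ Finset.range n, B k ↔ ∃ k < n, x ∈ B k := by
  simp

lemma monotone_biUnion_range {X : Type*} (B : ℕ → Set X) :
    Monotone fun n => ⋃ k ∈ Finset.range n, B k := fun m n hmn x hx => by
  obtain ⟨k, hk, hx⟩ := mem_biUnion_range.1 hx
  exact mem_biUnion_range.2 ⟨k, hk.trans_le hmn, hx⟩

variable (M) in
lemma isMeasSection_incl (h : H) :
    IsMeasSection (fun x : PSpace ℱ T U => M.inclField x) fun x => M.inclField x h :=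
  isMeasSection_const (M.measurable_inclField T) h

variable [IsProbabilityMeasure P]

lemma lintegral_cut_incl_ne_top {A : Set U} (hA : A ∈ M.ring) (h : H) :
    ∫⁻ x, ‖cut {x : PSpace ℱ T U | x.u ∈ A} (fun x => M.inclField x h) x‖ₑ ^ 2
      ∂M.predMeasure T ≠ ∞ := by
  obtain ⟨C, hC⟩ := M.q_bounded T h h
  have hAm : MeasurableSet {x : PSpace ℱ T U | x.u ∈ A} := PSpace.measurable_u (ℱ := ℱ) (T := T) (M.measurableSet_of_mem_ring hA)
  have hν : M.predMeasure T {x : PSpace ℱ T U | x.u ∈ A} < ∞ := by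
    have h1 : (PSpace.mk : _ → PSpace ℱ T U) ⁻¹' {x | x.u ∈ A} =
        Set.univ ×ˢ (Set.univ ×ˢ A) := by
      ext z
      exact ⟨fun hz => ⟨trivial, trivial, hz⟩, fun hz => hz.2.2⟩
    rw [predMeasure, Measure.map_apply PSpace.measurable_mk hAm, h1, Measure.prod_prod, base,
      Measure.prod_prod]
    exact ENNReal.mul_lt_top (measure_lt_top _ _)
      (ENNReal.mul_lt_top (measure_lt_top _ _) (M.μ_lt_top A hA))
  refine ne_of_lt ?_
  calc ∫⁻ x, ‖cut {x : PSpace ℱ T U | x.u ∈ A} (fun x => M.inclField x h) x‖ₑ ^ 2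
        ∂M.predMeasure T
      ≤ ∫⁻ x, {x : PSpace ℱ T U | x.u ∈ A}.indicator (fun _ => ENNReal.ofReal C) x
        ∂M.predMeasure T := by
        refine lintegral_mono fun x => ?_
        by_cases hx : x ∈ {x : PSpace ℱ T U | x.u ∈ A}
        · rw [cut_of_mem hx, Set.indicator_of_mem hx, inclField,
            HilbertianSeminorm.enorm_incl_sq]
          exact ENNReal.ofReal_le_ofReal ((le_abs_self _).trans (hC _ x.r_le _))
        · simp [cut_of_notMem hx]
    _ = ENNReal.ofReal C * M.predMeasure T {x : PSpace ℱ T U | x.u ∈ A} := by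
        rw [lintegral_indicator hAm, setLIntegral_const]
    _ < ∞ := ENNReal.mul_lt_top ENNReal.ofReal_lt_top hν

/-- A π-λ argument in B, starting from predictable rectangles. Confining the marks to A makes the
constant section square integrable, as the passage to countable unions requires. -/
lemma isApprox_cut_incl {B : Set (PSpace ℱ T U)} (hB : MeasurableSet B) {A : Set U}
    (hA : A ∈ M.ring) (h : H) :
    IsApprox (cut (B ∩ {x | x.u ∈ A}) fun x => M.inclField x h) := by
  set V : Set (PSpace ℱ T U) := {x | x.u ∈ A}
  have hV : MeasurableSet V := PSpace.measurable_u (M.measurableSet_of_mem_ring hA)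
  have hm : ∀ {B}, MeasurableSet B → IsMeasSection (fun x : PSpace ℱ T U => M.inclField x)
      (cut (B ∩ V) fun x => M.inclField x h) := fun hB =>
    isMeasSection_cut (M.isMeasSection_incl h) (hB.inter hV)
  have basic : ∀ C (hC : M.IsPredRect T C), IsApprox (cut (C ∩ V) fun x => M.inclField x h) := by
    intro C hC
    have hCm : MeasurableSet C := by
      have := MeasurableSpace.measurableSet_generateFrom (s := {C | M.IsPredRect T C}) hC
      rwa [← M.generateFrom_isPredRect] at this
    have hm := hm hCm
    rcases hC with ⟨s, F, A', hF, hA'⟩ | ⟨F, A', hF, hA'⟩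
    · have hA'' : A' ∩ A ∈ M.ring := by
        rcases hA' with hA' | rfl
        · exact M.isSetRing.inter_mem hA' hA
        · rwa [Set.univ_inter]
      rcases lt_or_ge s T with hs | hs
      · refine (SimpleIntegrand.single M hs hF hA'' h).isApprox_sec.congr_ae hm
          (ae_of_all _ fun x => ?_)
        rw [SimpleIntegrand.sec_single]
        by_cases hx : x ∈ {x : PSpace ℱ T U | s < x.r ∧ x.ω ∈ F ∧ x.u ∈ A'} ∩ V
        · obtain ⟨⟨h1, h2, h3⟩, h4⟩ := id hx
          have h1' : x.r ∈ Set.Ioc s T := ⟨h1, x.r_le⟩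
          have h3' : x.u ∈ A' ∩ A := ⟨h3, h4⟩
          rw [cut_of_mem hx, coef, Set.indicator_of_mem h1', Set.indicator_of_mem h2,
            Set.indicator_of_mem h3', one_mul, one_mul, one_smul]
        · rw [cut_of_notMem hx]
          have h0 : coef s T F (A' ∩ A) x.r x.ω x.u = 0 := by
            rw [coef]
            by_cases h1 : x.r ∈ Set.Ioc s T
            · by_cases h2 : x.ω ∈ F
              · have h3 : x.u ∉ A' ∩ A := fun h3 => hx ⟨⟨h1.1, h2, h3.1⟩, h3.2⟩
                rw [Set.indicator_of_notMem h3, mul_zero]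
              · rw [Set.indicator_of_notMem h2, mul_zero, zero_mul]
            · rw [Set.indicator_of_notMem h1, zero_mul, zero_mul]
          rw [h0, zero_smul]
      · refine isApprox_zero.congr_ae hm (ae_of_all _ fun x => cut_of_notMem fun hx => ?_)
        exact absurd (hx.1.1.trans_le x.r_le) (not_lt.2 hs)
    -- Simple integrands cannot see time 0, but `predMeasure` gives it no mass.
    · refine isApprox_zero.congr_ae hm ?_
      filter_upwards [M.ae_predMeasure_pos] with x hx
      exact cut_of_notMem fun hx' => hx.ne' hx'.1.1
  -- The full set V is needed to pass to complements; almost everywhere it is the rectangle over (0,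
  -- T].
  have hcV : IsApprox (cut V fun x => M.inclField x h) := by
    refine (basic _ (IsPredRect.Ioi 0 Set.univ Set.univ MeasurableSet.univ (Or.inr rfl))).congr_ae
      (isMeasSection_cut (M.isMeasSection_incl h) hV) ?_
    filter_upwards [M.ae_predMeasure_pos] with x hx
    by_cases hx' : x ∈ V
    · rw [cut_of_mem hx']
      exact (cut_of_mem (φ := fun x => M.inclField x h)
        (B := {x : PSpace ℱ T U | 0 < x.r ∧ x.ω ∈ Set.univ ∧ x.u ∈ Set.univ} ∩ V)
        ⟨⟨hx, trivial, trivial⟩, hx'⟩).symm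
    · rw [cut_of_notMem hx', cut_of_notMem fun h => hx' h.2]
  refine MeasurableSpace.induction_on_inter
    (C := fun B _ => IsApprox (cut (B ∩ V) fun x => M.inclField x h))
    M.generateFrom_isPredRect M.isPiSystem_isPredRect ?_ basic ?_ ?_ B hB
  · exact isApprox_zero.congr_ae (hm MeasurableSet.empty)
      (ae_of_all _ fun x => cut_of_notMem fun hx => hx.1)
  · intro B hB hBA
    refine (hcV.add hBA.neg).congr_ae (hm hB.compl) (ae_of_all _ fun x => ?_)
    by_cases hx : x ∈ V
    · by_cases hxB : x ∈ B
      · rw [cut_of_notMem fun hx' => hx'.1 hxB, cut_of_mem hx, cut_of_mem (Set.mem_inter hxB hx),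
          add_neg_cancel]
      · rw [cut_of_mem (Set.mem_inter hxB hx), cut_of_mem hx, cut_of_notMem fun hx' => hxB hx'.1, neg_zero,
          add_zero]
    · rw [cut_of_notMem fun hx' => hx hx'.2, cut_of_notMem hx, cut_of_notMem fun hx' => hx hx'.2,
        neg_zero, add_zero]
  · intro f hf hfm hfA
    have hfin : ∫⁻ x, ‖cut ((⋃ k, f k) ∩ V) (fun x => M.inclField x h) x‖ₑ ^ 2
        ∂M.predMeasure T ≠ ∞ := by
      refine ne_top_of_le_ne_top (lintegral_cut_incl_ne_top hA h) (lintegral_mono fun x => ?_)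
      by_cases hx : x ∈ (⋃ k, f k) ∩ V
      · rw [cut_of_mem hx, cut_of_mem hx.2]
      · simp [cut_of_notMem hx]
    have hS : ∀ n, MeasurableSet (⋃ k ∈ Finset.range n, f k) := fun n =>
      Finset.measurableSet_biUnion _ fun k _ => hfm k
    refine isApprox_of_cut (hm (MeasurableSet.iUnion hfm)) hfin hS (monotone_biUnion_range f)
      (ae_of_all _ fun x hx => ?_) fun n => ?_
    · by_contra! hn
      refine hx (cut_of_notMem fun hx' => ?_)
      obtain ⟨k, hk⟩ := Set.mem_iUnion.1 hx'.1
      exact hn (k + 1) (mem_biUnion_range.2 ⟨k, k.lt_succ_self, hk⟩)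
    · refine (isApprox_sum (Finset.range n) fun k _ => hfA k).congr_ae
        (isMeasSection_cut (hm (MeasurableSet.iUnion hfm)) (hS n)) (ae_of_all _ fun x => ?_)
      by_cases hx : x ∈ V
      · by_cases hxn : x ∈ ⋃ k ∈ Finset.range n, f k
        · obtain ⟨k, hk, hxk⟩ := mem_biUnion_range.1 hxn
          rw [cut_of_mem hxn, cut_of_mem (Set.mem_inter (Set.mem_iUnion.2 ⟨k, hxk⟩) hx)]
          exact (sum_cut_of_mem (φ := fun _ x => M.inclField x h)
            (fun i j hij => (hf hij).mono Set.inter_subset_left Set.inter_subset_left) hk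
            ⟨hxk, hx⟩).symm
        · rw [cut_of_notMem hxn]
          exact (sum_cut_of_notMem (φ := fun _ x => M.inclField x h)
            fun k hk hxk => hxn (mem_biUnion_range.2 ⟨k, hk, hxk.1⟩)).symm
      · rw [cut, cut_of_notMem fun hx' => hx hx'.2, smul_zero]
        exact (sum_cut_of_notMem (φ := fun _ x => M.inclField x h) fun k _ hxk => hx hxk.2).symm

/-- Square integrable predictable sections are limits of sections of simple integrands. -/
theorem isApprox_of_isMeasSection {φ : ∀ x : PSpace ℱ T U, (M.q x.r x.u).Space}
    (hφ : IsMeasSection (fun x : PSpace ℱ T U => M.inclField x) φ)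
    (hfin : ∫⁻ x, ‖φ x‖ₑ ^ 2 ∂M.predMeasure T ≠ ∞) : IsApprox φ := by
  refine isApprox_of_approx hφ fun ε hε => ?_
  have hε2 : ε / 2 ≠ 0 := ENNReal.div_ne_zero.2 ⟨hε, by norm_num⟩
  obtain ⟨δ, hδ, hδε⟩ := ENNReal.exists_nnreal_pos_mul_lt hfin hε2
  obtain ⟨A, hA, hAμ⟩ := M.μ_sigmaFinite
  let I : ℕ → ∀ x : PSpace ℱ T U, (M.q x.r x.u).Space := fun k x =>
    M.inclField x (TopologicalSpace.denseSeq H k)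
  have hI : ∀ k, IsMeasSection (fun x : PSpace ℱ T U => M.inclField x) (I k) := fun k =>
    M.isMeasSection_incl _
  -- Index j codes a constant section from a dense sequence and a ring set. Closeness is measured
  -- relative to ‖φ‖², so the errors over disjoint cells add up to at most δ ∫ ‖φ‖² < ε/2, without
  -- any finiteness of the measure.
  let D : ℕ → Set (PSpace ℱ T U) := fun j =>
    {x | ‖φ x - I j.unpair.1 x‖ₑ ^ 2 < δ * ‖φ x‖ₑ ^ 2} ∩ {x | x.u ∈ A j.unpair.2}
  have hD : ∀ j, MeasurableSet (D j) := fun j =>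
    (measurableSet_lt (measurable_enorm_sq_section (hφ.sub (hI _)))
      ((measurable_enorm_sq_section hφ).const_mul _)).inter
      (PSpace.measurable_u (M.measurableSet_of_mem_ring (hA _)))
  let B := disjointed D
  have hBD : ∀ j, B j ⊆ D j := fun j => disjointed_subset D j
  have hBd : Pairwise (Function.onFun Disjoint B) := disjoint_disjointed D
  have hBm : ∀ j, MeasurableSet (B j) := fun j => MeasurableSet.disjointed hD j
  have hS : ∀ n, MeasurableSet (⋃ k ∈ Finset.range n, B k) := fun n =>
    Finset.measurableSet_biUnion _ fun k _ => hBm k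
  have hcov : ∀ᵐ x ∂M.predMeasure T, φ x ≠ 0 → ∃ n, x ∈ ⋃ k ∈ Finset.range n, B k := by
    filter_upwards [M.ae_predMeasure_u (T := T) (p := fun u => u ∈ ⋃ n, A n)
      (MeasurableSet.iUnion fun n => M.measurableSet_of_mem_ring (hA n)) hAμ] with x hx h0
    obtain ⟨n, hn⟩ := Set.mem_iUnion.1 hx
    have hd : DenseRange fun k => (M.q x.r x.u).incl (TopologicalSpace.denseSeq H k) :=
      (M.q x.r x.u).denseRange_incl.comp (TopologicalSpace.denseRange_denseSeq H)
        (M.q x.r x.u).incl.continuous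
    have hpos : 0 < (δ : ℝ≥0∞) * ‖φ x‖ₑ ^ 2 :=
      ENNReal.mul_pos (ENNReal.coe_ne_zero.2 hδ.ne') (pow_ne_zero 2 (enorm_ne_zero.2 h0))
    have hopen : IsOpen {y : (M.q x.r x.u).Space | ‖φ x - y‖ₑ ^ 2 < δ * ‖φ x‖ₑ ^ 2} :=
      isOpen_lt (by fun_prop) continuous_const
    obtain ⟨k, hk⟩ := hd.exists_mem_open hopen ⟨φ x, by
      show ‖φ x - φ x‖ₑ ^ 2 < δ * ‖φ x‖ₑ ^ 2
      simpa using hpos⟩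
    have hxD : x ∈ ⋃ j, D j := Set.mem_iUnion.2 ⟨Nat.pair k n, by
      show ‖φ x - I (Nat.unpair (Nat.pair k n)).1 x‖ₑ ^ 2 < δ * ‖φ x‖ₑ ^ 2 ∧
        x.u ∈ A (Nat.unpair (Nat.pair k n)).2
      rw [Nat.unpair_pair]
      exact ⟨hk, hn⟩⟩
    rw [← iUnion_disjointed] at hxD
    obtain ⟨j, hj⟩ := Set.mem_iUnion.1 hxD
    exact ⟨j + 1, mem_biUnion_range.2 ⟨j, j.lt_succ_self, hj⟩⟩
  obtain ⟨N, hN⟩ := exists_lintegral_sub_cut_le hφ hfin hS (monotone_biUnion_range B) hcov hε2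
  refine ⟨fun x => ∑ j ∈ Finset.range N, cut (B j) (I j.unpair.1) x,
    isApprox_sum _ fun j _ => ?_, ?_⟩
  · have h1 := isApprox_cut_incl (hBm j) (hA j.unpair.2) (TopologicalSpace.denseSeq H j.unpair.1)
    rwa [Set.inter_eq_self_of_subset_left fun x hx => (hBD j hx).2] at h1
  · calc ∫⁻ x, ‖φ x - ∑ j ∈ Finset.range N, cut (B j) (I j.unpair.1) x‖ₑ ^ 2 ∂M.predMeasure T
        ≤ ∫⁻ x, δ * ‖φ x‖ₑ ^ 2 + ‖φ x - cut (⋃ k ∈ Finset.range N, B k) φ x‖ₑ ^ 2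
          ∂M.predMeasure T := by
          refine lintegral_mono fun x => ?_
          by_cases hx : x ∈ ⋃ k ∈ Finset.range N, B k
          · obtain ⟨k, hk, hxk⟩ := mem_biUnion_range.1 hx
            rw [sum_cut_of_mem (φ := fun j => I j.unpair.1) hBd hk hxk]
            exact (hBD k hxk).1.le.trans le_self_add
          · rw [sum_cut_of_notMem (φ := fun j => I j.unpair.1)
              fun k hk hxk => hx (mem_biUnion_range.2 ⟨k, hk, hxk⟩), cut_of_notMem hx]
            exact le_add_self
      _ = δ * ∫⁻ x, ‖φ x‖ₑ ^ 2 ∂M.predMeasure T +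
          ∫⁻ x, ‖φ x - cut (⋃ k ∈ Finset.range N, B k) φ x‖ₑ ^ 2 ∂M.predMeasure T := by
          rw [lintegral_add_left ((measurable_enorm_sq_section hφ).const_mul _),
            lintegral_const_mul' _ _ ENNReal.coe_ne_top]
      _ ≤ ε / 2 + ε / 2 := add_le_add hδε.le hN
      _ = ε := ENNReal.add_halves ε

end CylMartingaleMeasure

namespace CylMartingaleMeasure

variable {Ω : Type*} [mΩ : MeasurableSpace Ω] {P : Measure Ω} {ℱ : Filtration ℝ≥0 mΩ}
  {U : Type*} [TopologicalSpace U] [mU : MeasurableSpace U] [BorelSpace U]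
  {H : Type*} [NormedAddCommGroup H] [InnerProductSpace ℝ H]
  {M : CylMartingaleMeasure P ℱ U H} {T : ℝ≥0} [CompleteSpace H]
  [TopologicalSpace.SeparableSpace H] [IsProbabilityMeasure P]
  {G : Type*} [NormedAddCommGroup G] [InnerProductSpace ℝ G] [CompleteSpace G]
  [TopologicalSpace.SeparableSpace G]
  {E : Type*} [NormedAddCommGroup E] [InnerProductSpace ℝ E] [CompleteSpace E]
  [TopologicalSpace.SeparableSpace E]

/-! ### Density of the simple integrands -/

/-- Reduces approximation of operator families to that of the scalar sections Φ^* b_i. -/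
lemma lambdaNormSq_eq_tsum {ι : Type*} [Countable ι] (b : HilbertBasis ι ℝ G)
    {Φ : M.OperatorFamily G} (hΦ : IsPredictable T Φ) :
    lambdaNormSq T Φ = ∑' i, ∫⁻ x : PSpace ℱ T U,
      ‖ContinuousLinearMap.adjoint (Φ x.r x.ω x.u) (b i)‖ₑ ^ 2 ∂M.predMeasure T := by
  rw [lambdaNormSq_eq hΦ,
    ← lintegral_tsum fun i => (measurable_enorm_sq_section (hΦ (b i))).aemeasurable]
  exact lintegral_congr fun x => hsNormSq_eq_tsum_adjoint b _

lemma exists_toFamily_eq_sum {ι : Type*} (s : Finset ι) (D : ι → SimpleIntegrand M T G) :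
    ∃ D' : SimpleIntegrand M T G, ∀ r ω u, D'.toFamily r ω u = ∑ i ∈ s, (D i).toFamily r ω u := by
  classical
  induction s using Finset.induction_on with
  | empty => exact ⟨SimpleIntegrand.zero M T G, fun r ω u => by
      rw [SimpleIntegrand.toFamily_zero, Finset.sum_empty]⟩
  | insert a s ha ih =>
    obtain ⟨D', hD'⟩ := ih
    exact ⟨(D a).add D', fun r ω u => by
      rw [SimpleIntegrand.toFamily_add, hD', Finset.sum_insert ha]⟩

/-- The simple integrands are dense in `Λ²(M, T; H, G)`. -/
theorem exists_lambdaNormSq_sub_le {Φ : M.OperatorFamily G} (hΦ : IsPredictable T Φ)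
    (hfin : lambdaNormSq T Φ ≠ ∞) {ε : ℝ≥0∞} (hε : ε ≠ 0) :
    ∃ D : SimpleIntegrand M T G, lambdaNormSq T
      (fun r ω u => D.toFamily r ω u - Φ r ω u : M.OperatorFamily G) ≤ ε := by
  classical
  obtain ⟨w, b, -⟩ := exists_hilbertBasis ℝ G
  have : Countable w := HilbertBasis.countable_of_separable b
  have hε2 : ε / 2 ≠ 0 := ENNReal.div_ne_zero.2 ⟨hε, by norm_num⟩
  have htsum := lambdaNormSq_eq_tsum b hΦ
  rw [htsum] at hfin
  -- Finitely many coordinates carry all but ε/2 of the norm; they share the other ε/2 in their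
  -- approximations, and the rest are replaced by 0.
  obtain ⟨s, hs⟩ := ((ENNReal.tendsto_tsum_compl_atTop_zero hfin).eventually
    (ge_mem_nhds (pos_iff_ne_zero.2 hε2))).exists
  have hne : ε / 2 / (s.card + 1) ≠ 0 := ENNReal.div_ne_zero.2 ⟨hε2, by finiteness⟩
  have happ : ∀ i, ∃ D : SimpleIntegrand M T ℝ, ∫⁻ x : PSpace ℱ T U,
      ‖ContinuousLinearMap.adjoint (Φ x.r x.ω x.u) (b i) - D.sec x‖ₑ ^ 2 ∂M.predMeasure T ≤
        ε / 2 / (s.card + 1) := fun i =>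
    (isApprox_of_isMeasSection (hΦ (b i)) (ENNReal.ne_top_of_tsum_ne_top hfin i)).approx _ hne
  choose D hD using happ
  -- Each scalar approximant is put in the direction b_i; by orthonormality the coordinates do not
  -- interfere.
  obtain ⟨D', hD'⟩ := exists_toFamily_eq_sum s
    fun i => (D i).comp (ContinuousLinearMap.toSpanSingleton ℝ (b i))
  have hadj : ∀ i (x : PSpace ℱ T U), ContinuousLinearMap.adjoint (D'.toFamily x.r x.ω x.u) (b i) =
      if i ∈ s then (D i).sec x else 0 := by
    intro i x
    have h1 : ∀ j ∈ s, ContinuousLinearMap.adjoint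
        (((D j).comp (ContinuousLinearMap.toSpanSingleton ℝ (b j))).toFamily x.r x.ω x.u) (b i) =
        if j = i then (D i).sec x else 0 := by
      intro j _
      rw [SimpleIntegrand.toFamily_comp, ContinuousLinearMap.adjoint_comp,
        ContinuousLinearMap.comp_apply, ContinuousLinearMap.adjoint_toSpanSingleton,
        innerSL_apply_apply, orthonormal_iff_ite.1 b.orthonormal j i]
      split_ifs with hji
      · subst hji; rfl
      · exact map_zero _
    rw [hD', map_sum, sum_apply, Finset.sum_congr rfl h1, Finset.sum_ite_eq']
  refine ⟨D', ?_⟩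
  rw [lambdaNormSq_eq_tsum b (D'.isPredictable.sub hΦ), ← ENNReal.sum_add_tsum_compl s]
  have h1 : ∀ i ∈ s, ∫⁻ x : PSpace ℱ T U, ‖ContinuousLinearMap.adjoint
      (D'.toFamily x.r x.ω x.u - Φ x.r x.ω x.u) (b i)‖ₑ ^ 2 ∂M.predMeasure T ≤
      ε / 2 / (s.card + 1) := by
    intro i hi
    refine le_of_eq_of_le (lintegral_congr fun x => ?_) (hD i)
    rw [map_sub, sub_apply, hadj, if_pos hi, enorm_sub_rev]
  have h2 : ∀ i ∉ s, ∫⁻ x : PSpace ℱ T U, ‖ContinuousLinearMap.adjoint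
      (D'.toFamily x.r x.ω x.u - Φ x.r x.ω x.u) (b i)‖ₑ ^ 2 ∂M.predMeasure T =
      ∫⁻ x : PSpace ℱ T U, ‖ContinuousLinearMap.adjoint (Φ x.r x.ω x.u) (b i)‖ₑ ^ 2
        ∂M.predMeasure T := by
    intro i hi
    refine lintegral_congr fun x => ?_
    rw [map_sub, sub_apply, hadj, if_neg hi, zero_sub, enorm_neg]
  calc _ ≤ ε / 2 + ε / 2 := by
        refine add_le_add ((Finset.sum_le_card_nsmul _ _ _ h1).trans ?_)
          ((tsum_congr fun i : {i // i ∉ s} => h2 i i.2).trans_le hs)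
        rw [nsmul_eq_mul]
        exact (mul_le_mul_left le_self_add _).trans ENNReal.mul_div_le
    _ = ε := ENNReal.add_halves ε

/-! ### The stochastic integral -/

lemma lambdaNormSq_sub_comm (Φ Ψ : M.OperatorFamily G) :
    lambdaNormSq T (fun r ω u => Φ r ω u - Ψ r ω u : M.OperatorFamily G) =
      lambdaNormSq T (fun r ω u => Ψ r ω u - Φ r ω u : M.OperatorFamily G) := by
  refine lintegral_congr fun ω => lintegral_congr fun r => lintegral_congr fun u => ?_
  show hsNormSq (Φ r ω u - Ψ r ω u) = hsNormSq (Ψ r ω u - Φ r ω u)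
  rw [← neg_sub (Ψ r ω u) (Φ r ω u), hsNormSq_neg]

lemma lambdaNormSq_comp_le (R : G →L[ℝ] E) (Φ : M.OperatorFamily G) :
    lambdaNormSq T (fun r ω u => R.comp (Φ r ω u) : M.OperatorFamily E) ≤
      ‖R‖ₑ ^ 2 * lambdaNormSq T Φ := by
  have hR : ‖R‖ₑ ^ 2 ≠ ∞ := (ENNReal.pow_lt_top enorm_lt_top).ne
  simp only [lambdaNormSq, ← lintegral_const_mul' _ _ hR]
  exact lintegral_mono fun ω => lintegral_mono fun r => lintegral_mono fun u =>
    hsNormSq_comp_le R _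

lemma martNormSq_clm_le (R : G →L[ℝ] E) (X : ℝ≥0 → Ω → G) :
    martNormSq P T (fun t ω => R (X t ω)) ≤ ‖R‖ₑ ^ 2 * martNormSq P T X := by
  have hR : ‖R‖ₑ ^ 2 ≠ ∞ := (ENNReal.pow_lt_top enorm_lt_top).ne
  rw [martNormSq, martNormSq, ← lintegral_const_mul' _ _ hR]
  refine lintegral_mono fun ω => iSup_le fun t => ?_
  refine le_trans ?_ (mul_le_mul_right (le_iSup (fun t : Set.Iic T => ‖X t ω‖ₑ ^ 2) t) _)
  rw [← mul_pow]
  gcongr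
  exact R.le_opENorm _

lemma MemLambda2.comp (R : G →L[ℝ] E) {Φ : M.OperatorFamily G} (hΦ : MemLambda2 T Φ) :
    MemLambda2 T (fun r ω u => R.comp (Φ r ω u) : M.OperatorFamily E) where
  hilbertSchmidt r hr ω u := (hsNormSq_comp_le R _).trans_lt
    (ENNReal.mul_lt_top (ENNReal.pow_lt_top enorm_lt_top) (hΦ.hilbertSchmidt r hr ω u))
  predictable h g := hΦ.isPredictable.comp R g h
  norm_lt_top := (lambdaNormSq_comp_le R Φ).trans_lt
    (ENNReal.mul_lt_top (ENNReal.pow_lt_top enorm_lt_top) hΦ.norm_lt_top)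

/-- R acts on simple integrands and on their integrals compatibly, and enlarges both squared norms
by at most ‖R‖², so the approximating sequence can be transported term by term. -/
lemma IsStochasticIntegral.comp {Φ : M.OperatorFamily G} {I : ℝ≥0 → Ω → G}
    (hI : IsStochasticIntegral T Φ I) (R : G →L[ℝ] E) :
    IsStochasticIntegral T (fun r ω u => R.comp (Φ r ω u) : M.OperatorFamily E)
      fun t ω => R (I t ω) := by
  obtain ⟨hI, D, X, hX, hD, hXI⟩ := hI
  have hR : ‖R‖ₑ ^ 2 ≠ ∞ := (ENNReal.pow_lt_top enorm_lt_top).ne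
  refine ⟨hI.clm R, fun n => (D n).comp R, fun n t ω => R (X n t ω), fun n => (hX n).comp R, ?_, ?_⟩
  · have h := ENNReal.Tendsto.const_mul hD (Or.inr hR)
    rw [mul_zero] at h
    refine tendsto_of_tendsto_of_tendsto_of_le_of_le tendsto_const_nhds h (fun _ => zero_le)
      fun n => ?_
    refine le_of_eq_of_le ?_ (lambdaNormSq_comp_le R _)
    simp only [SimpleIntegrand.toFamily_comp, ContinuousLinearMap.comp_sub]
  · have h := ENNReal.Tendsto.const_mul hXI (Or.inr hR)
    rw [mul_zero] at h
    refine tendsto_of_tendsto_of_tendsto_of_le_of_le tendsto_const_nhds h (fun _ => zero_le)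
      fun n => ?_
    refine le_of_eq_of_le ?_ (martNormSq_clm_le R _)
    simp only [map_sub]

lemma IsSimpleIntegral.martNormSq_sub_le_of (hnull : ∀ s, P s = 0 → MeasurableSet[ℱ 0] s)
    {D D' : SimpleIntegrand M T G} {X X' : ℝ≥0 → Ω → G}
    (hX : IsSimpleIntegral D X) (hX' : IsSimpleIntegral D' X') {Φ : M.OperatorFamily G}
    (hΦ : IsPredictable T Φ) :
    martNormSq P T (fun t ω => X t ω - X' t ω) ≤
      8 * (2 * lambdaNormSq T (fun r ω u => D.toFamily r ω u - Φ r ω u : M.OperatorFamily G) +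
        2 * lambdaNormSq T (fun r ω u => D'.toFamily r ω u - Φ r ω u : M.OperatorFamily G)) := by
  refine (hX.martNormSq_sub_le hnull hX').trans (mul_le_mul_right ?_ _)
  rw [lambdaNormSq_sub_comm D'.toFamily Φ]
  exact lambdaNormSq_sub_le D.isPredictable hΦ D'.isPredictable

/-- Two versions of the stochastic integral are indistinguishable. -/
theorem IsStochasticIntegral.ae_eq (hnull : ∀ s, P s = 0 → MeasurableSet[ℱ 0] s)
    {Φ : M.OperatorFamily G} (hΦ : IsPredictable T Φ) {I J : ℝ≥0 → Ω → G}
    (hI : IsStochasticIntegral T Φ I) (hJ : IsStochasticIntegral T Φ J) :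
    ∀ᵐ ω ∂P, ∀ t ≤ T, I t ω = J t ω := by
  obtain ⟨hI, D, X, hX, hD, hXI⟩ := hI
  obtain ⟨hJ, D', X', hX', hD', hXJ⟩ := hJ
  -- Compare along I, X n, X' n, J: the middle distance is controlled by the integrands, which
  -- approach the same Φ.
  have hle : ∀ n, martNormSq P T (fun t ω => I t ω - J t ω) ≤
      2 * martNormSq P T (fun t ω => X n t ω - I t ω) +
      2 * (2 * (8 * (2 * lambdaNormSq T
          (fun r ω u => (D n).toFamily r ω u - Φ r ω u : M.OperatorFamily G) +
        2 * lambdaNormSq T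
          (fun r ω u => (D' n).toFamily r ω u - Φ r ω u : M.OperatorFamily G))) +
        2 * martNormSq P T (fun t ω => X' n t ω - J t ω)) := by
    intro n
    have m1 := (hX n).isSqMartingale hnull
    have m2 := (hX' n).isSqMartingale hnull
    refine (martNormSq_sub_le (Z := J) (hI.sub m1)).trans ?_
    rw [martNormSq_sub_comm I (X n)]
    gcongr
    refine (martNormSq_sub_le (Z := J) (m1.sub m2)).trans ?_
    gcongr
    exact (hX n).martNormSq_sub_le_of hnull (hX' n) hΦ
  have hlim : Tendsto (fun n => 2 * martNormSq P T (fun t ω => X n t ω - I t ω) +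
      2 * (2 * (8 * (2 * lambdaNormSq T
          (fun r ω u => (D n).toFamily r ω u - Φ r ω u : M.OperatorFamily G) +
        2 * lambdaNormSq T
          (fun r ω u => (D' n).toFamily r ω u - Φ r ω u : M.OperatorFamily G))) +
        2 * martNormSq P T (fun t ω => X' n t ω - J t ω))) atTop
      (𝓝 (2 * 0 + 2 * (2 * (8 * (2 * 0 + 2 * 0)) + 2 * 0))) := by
    have c : ∀ {f : ℕ → ℝ≥0∞} {a : ℝ≥0∞} (k : ℝ≥0∞), k ≠ ∞ → Tendsto f atTop (𝓝 a) →
      Tendsto (fun n => k * f n) atTop (𝓝 (k * a)) := fun k hk h =>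
        ENNReal.Tendsto.const_mul h (Or.inr hk)
    exact (c 2 (by simp) hXI).add (c 2 (by simp) ((c 2 (by simp) (c 8 (by simp)
      ((c 2 (by simp) hD).add (c 2 (by simp) hD')))).add (c 2 (by simp) hXJ)))
  have h0 : martNormSq P T (fun t ω => I t ω - J t ω) = 0 := by
    have := ge_of_tendsto' hlim hle
    simpa using this
  filter_upwards [(hI.sub hJ).ae_eq_zero h0] with ω hω t ht
  exact sub_eq_zero.1 (hω t ht)

/-- Existence of the stochastic integral. -/
theorem exists_isStochasticIntegral (hnull : ∀ s, P s = 0 → MeasurableSet[ℱ 0] s)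
    {Φ : M.OperatorFamily G} (hΦ : MemLambda2 T Φ) : ∃ I, IsStochasticIntegral T Φ I := by
  have := UniformSpace.secondCountable_of_separable G
  -- The tolerance is the inverse of n in `ℝ≥0∞`, harmlessly infinite at n = 0.
  choose D hD using fun n : ℕ => exists_lambdaNormSq_sub_le hΦ.isPredictable hΦ.norm_lt_top.ne
    (ENNReal.inv_ne_zero.2 (ENNReal.natCast_ne_top n))
  choose X hX using fun n => exists_isSimpleIntegral hnull (D n)
  have hlim := tendsto_of_tendsto_of_tendsto_of_le_of_le tendsto_const_nhds
    ENNReal.tendsto_inv_nat_nhds_zero (fun _ => zero_le) hD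
  have hC : ∀ ε > 0, ∃ N, ∀ m ≥ N, ∀ n ≥ N,
      martNormSq P T (fun t ω => X m t ω - X n t ω) ≤ ε := by
    intro ε hε
    -- 32 = 8 · (2 + 2): Doob's constant times the coefficients of the squared triangle inequality.
    have hpos : 0 < ε / 32 := ENNReal.div_pos hε.ne' (by norm_num)
    obtain ⟨N, hN⟩ := eventually_atTop.1 (hlim.eventually (ge_mem_nhds hpos))
    refine ⟨N, fun m hm n hn => ((hX m).martNormSq_sub_le_of hnull (hX n)
      hΦ.isPredictable).trans ?_⟩
    calc _ ≤ 8 * (2 * (ε / 32) + 2 * (ε / 32)) := by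
          gcongr
          exacts [hN m hm, hN n hn]
      _ = 32 * (ε / 32) := by ring
      _ = ε := ENNReal.mul_div_cancel (by norm_num) (by norm_num)
  obtain ⟨I, hI, hXI⟩ := exists_limit_of_cauchy hnull (fun n => (hX n).isSqMartingale hnull) hC
  exact ⟨I, hI, D, X, hX, hlim, hXI⟩

end CylMartingaleMeasure

end CylMart

end

open CylMart CylMartingaleMeasure in
theorem mainTheorem10
    {Ω : Type*} [mΩ : MeasurableSpace Ω] (P : Measure Ω) [IsProbabilityMeasure P]
    (ℱ : Filtration ℝ≥0 mΩ) (hℱ : UsualConditions P ℱ)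
    {U : Type*} [TopologicalSpace U] [MeasurableSpace U] [BorelSpace U]
    {H : Type*} [NormedAddCommGroup H] [InnerProductSpace ℝ H] [CompleteSpace H]
    [TopologicalSpace.SeparableSpace H]
    {G : Type*} [NormedAddCommGroup G] [InnerProductSpace ℝ G] [CompleteSpace G]
    [TopologicalSpace.SeparableSpace G]
    {E : Type*} [NormedAddCommGroup E] [InnerProductSpace ℝ E] [CompleteSpace E]
    [TopologicalSpace.SeparableSpace E]
    (M : CylMartingaleMeasure P ℱ U H) (T : ℝ≥0) (hT : 0 < T)
    (R : G →L[ℝ] E) (Φ : M.OperatorFamily G) (hΦ : MemLambda2 T Φ) :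
    MemLambda2 T (fun r ω u => R.comp (Φ r ω u) : M.OperatorFamily E) ∧
    (∃ I, IsStochasticIntegral T Φ I) ∧
    (∃ J, IsStochasticIntegral T (fun r ω u => R.comp (Φ r ω u) : M.OperatorFamily E) J) ∧
    ∀ (I : ℝ≥0 → Ω → G) (J : ℝ≥0 → Ω → E),
      IsStochasticIntegral T Φ I →
      IsStochasticIntegral T (fun r ω u => R.comp (Φ r ω u) : M.OperatorFamily E) J →
      ∀ᵐ ω ∂P, ∀ t ≤ T, J t ω = R (I t ω) :=
  ⟨hΦ.comp R, exists_isStochasticIntegral hℱ.null hΦ,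
    exists_isStochasticIntegral hℱ.null (hΦ.comp R),
    fun _ _ hI hJ => hJ.ae_eq hℱ.null (hΦ.comp R).isPredictable (hI.comp R)⟩
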